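/- Let $N\ge 1$ be an integer and let $\Gamma_0(N)\subset \mathrm{SL}_2(\mathbb Z)$ be the subgroup of matrices $\begin{pmatrix}a&b\\c&d\end{pmatrix}$ with $N\mid c$. Let $\mathbb H^*=\mathbb H\cup\mathbb Q\cup\{\infty\}$ be the extended upper half plane, let $j$ be the modular function on $\mathbb H$ normalized by $j(e^{\pi i/3})=0$, $j(i)=1728$ and with a simple pole at $\infty$, and let $X_0(N)=\Gamma_0(N)\backslash\mathbb H^*$ be the modular curve, which with its standard topology and complex structure is a compact Riemann surface. A *Belyi function* on a compact Riemann surface is a nonconstant holomorphic map to $\mathbb{CP}^1$ all of whose ramification values lie in $\{0,1,\infty\}$. Define $f,g:X_0(N)\to\mathbb{CP}^1$ by $f([z])=\frac{1}{1728}j(z)$ and $g([z])=\frac1{1728}j(Nz)$ for $z\in\mathbb H$, with value $\infty$ at the cusps. Then: 1. $f$ and $g$ are Belyi functions on $X_0(N)$. 2. $[z]\mapsto\left[\frac{-1}{Nz}\right]$ is a well-defined holomorphic involution $w$ of $X_0(N)$ (that is, $w\circ w=\mathrm{id}$), and $f\circ w=g$, $g\circ w=f$. 3. $f$ and $g$ generate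 the field of meromorphic functions on $X_0(N)$: $\mathbb C(X_0(N))=\mathbb C(f,g)$. 4. The modular equation for $\Gamma_0(N)$, that is, the algebraic dependence relation between $j(z)$ and $j(Nz)$, exists: there is a polynomial $\Phi(X,Y)\in\mathbb C[X,Y]$, monic in $Y$, such that a polynomial $P\in\mathbb C[X,Y]$ satisfies $P(j(z),j(Nz))=0$ for all $z\in\mathbb H$ if and only if $\Phi$ divides $P$. The minimal polynomial of $1728g$ over the field $\mathbb C(f)$ is $\Phi(1728f,Y)$. If $N\ge2$, then $\Phi$ is symmetric, $\Phi(X,Y)=\Phi(Y,X)$; if $N=1$, then $\Phi(X,Y)=Y-X$. -/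

import Mathlib

open Filter Topology UpperHalfPlane
open scoped Manifold ContDiff MatrixGroups

noncomputable section

/-! ## Riemann surfaces and their function fields -/

/-- A Riemann surface: a connected Hausdorff space with a holomorphic atlas. -/
class RiemannSurface (X : Type*) [TopologicalSpace X] extends
  ChartedSpace ℂ X, IsManifold 𝓘(ℂ) ω X, T2Space X, ConnectedSpace X

namespace RiemannSurface

variable {X : Type*} [TopologicalSpace X] [RiemannSurface X]

/-- `h : X → ℂ` is meromorphic, i.e. meromorphic in a chart around every point (its values at the
poles are irrelevant). -/
def IsMeromorphic (h : X → ℂ) : Prop :=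
  ∀ x : X, MeromorphicAt (h ∘ (chartAt ℂ x).symm) (chartAt ℂ x x)

theorem map_nhdsNE (x : X) :
    map (chartAt ℂ x) (𝓝[≠] x) = 𝓝[≠] (chartAt ℂ x x) := by
  have hx : x ∈ (chartAt ℂ x).source := ChartedSpace.mem_chart_source x
  rw [(chartAt ℂ x).map_nhdsWithin_eq hx]
  have hnhds : (chartAt ℂ x).target ∈ 𝓝 (chartAt ℂ x x) :=
    (chartAt ℂ x).open_target.mem_nhds ((chartAt ℂ x).map_source hx)
  have himg : (chartAt ℂ x) '' ((chartAt ℂ x).source ∩ {x}ᶜ) =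
      (chartAt ℂ x).target ∩ {chartAt ℂ x x}ᶜ := by
    ext w
    constructor
    · rintro ⟨y, ⟨hy, hyx⟩, rfl⟩
      exact ⟨(chartAt ℂ x).map_source hy, fun h => hyx ((chartAt ℂ x).injOn hy hx h)⟩
    · rintro ⟨hw, hwx⟩
      refine ⟨(chartAt ℂ x).symm w, ⟨(chartAt ℂ x).map_target hw, fun h => hwx ?_⟩,
        (chartAt ℂ x).right_inv hw⟩
      have h2 := congrArg (chartAt ℂ x) (Set.mem_singleton_iff.mp h)
      rwa [(chartAt ℂ x).right_inv hw] at h2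
  rw [himg, Set.inter_comm]
  exact nhdsWithin_inter_of_mem' (mem_nhdsWithin_of_mem_nhds hnhds)

instance nhdsNE_neBot (x : X) : NeBot (𝓝[≠] x) := by
  rw [← map_neBot_iff (chartAt ℂ x), map_nhdsNE]
  infer_instance

theorem eventually_comp_symm (x : X) (p : X → Prop) :
    (∀ᶠ w in 𝓝[≠] (chartAt ℂ x x), p ((chartAt ℂ x).symm w)) ↔ ∀ᶠ y in 𝓝[≠] x, p y := by
  rw [← map_nhdsNE, eventually_map]
  apply eventually_congr
  have hs : ∀ᶠ y in 𝓝[≠] x, y ∈ (chartAt ℂ x).source :=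
    mem_nhdsWithin_of_mem_nhds
      ((chartAt ℂ x).open_source.mem_nhds (ChartedSpace.mem_chart_source x))
  filter_upwards [hs] with y hy
  rw [(chartAt ℂ x).left_inv hy]

theorem mem_codiscrete_iff {X : Type*} [TopologicalSpace X] {s : Set X} : s ∈ codiscrete X ↔ ∀ x, s ∈ 𝓝[≠] x := by
  rw [codiscrete, mem_codiscreteWithin_iff_forall_mem_nhdsNE]
  simp

instance codiscrete_neBot : NeBot (codiscrete X) := by
  refine ⟨fun h => ?_⟩
  obtain ⟨x⟩ : Nonempty X := inferInstance
  have : (∅ : Set X) ∈ codiscrete X := by rw [h]; exact mem_bot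
  exact (nhdsNE_neBot x).ne (empty_mem_iff_bot.mp (mem_codiscrete_iff.mp this x))

theorem eventually_nhdsNE_of_nhdsNE {x : X} {p : X → Prop} (h : ∀ᶠ y in 𝓝[≠] x, p y) :
    ∀ᶠ y in 𝓝 x, ∀ᶠ z in 𝓝[≠] y, p z := by
  have h1 : ∀ᶠ y in 𝓝[≠] x, ∀ᶠ z in 𝓝[≠] y, p z := by
    filter_upwards [eventually_eventually_nhdsWithin.mpr h, self_mem_nhdsWithin] with y hy hyx
    rw [isOpen_compl_singleton.nhdsWithin_eq hyx] at hy
    exact hy.filter_mono nhdsWithin_le_nhds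
  rw [eventually_nhdsWithin_iff] at h1
  filter_upwards [h1] with y hy
  by_cases hyx : y = x
  · rw [hyx]; exact h
  · exact hy hyx

/-- The identity theorem. -/
theorem IsMeromorphic.eventually_zero_or {h : X → ℂ} (hh : IsMeromorphic h) :
    (∀ᶠ x in codiscrete X, h x = 0) ∨ ∀ᶠ x in codiscrete X, h x ≠ 0 := by
  have dich : ∀ x, (∀ᶠ y in 𝓝[≠] x, h y = 0) ∨ ∀ᶠ y in 𝓝[≠] x, h y ≠ 0 := by
    intro x
    rw [← eventually_comp_symm x (fun y => h y = 0), ← eventually_comp_symm x (fun y => h y ≠ 0)]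
    exact (hh x).eventually_eq_zero_or_eventually_ne_zero
  have excl : ∀ x, (∀ᶠ y in 𝓝[≠] x, h y = 0) → ¬ ∀ᶠ y in 𝓝[≠] x, h y ≠ 0 := by
    intro x h0 h1
    obtain ⟨y, hy0, hy1⟩ := (h0.and h1).exists
    exact hy1 hy0
  have hclopen : IsClopen {x : X | ∀ᶠ y in 𝓝[≠] x, h y = 0} := by
    constructor
    · rw [← isOpen_compl_iff, isOpen_iff_mem_nhds]
      intro x hx
      filter_upwards [eventually_nhdsNE_of_nhdsNE ((dich x).resolve_left hx)] with y hy hy0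
      exact excl y hy0 hy
    · rw [isOpen_iff_mem_nhds]
      intro x hx
      exact eventually_nhdsNE_of_nhdsNE hx
  rcases isClopen_iff.mp hclopen with hc | hc
  · right
    refine mem_codiscrete_iff.mpr fun x => (dich x).resolve_left fun h0 => ?_
    have : x ∈ ({x : X | ∀ᶠ y in 𝓝[≠] x, h y = 0} : Set X) := h0
    rw [hc] at this
    exact this
  · left
    refine mem_codiscrete_iff.mpr fun x => ?_
    have : x ∈ ({x : X | ∀ᶠ y in 𝓝[≠] x, h y = 0} : Set X) := by rw [hc]; trivial
    exact this

variable (X) in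
/-- The ring of meromorphic functions on `X`, where two functions are identified if they agree
outside a closed discrete set. -/
def meromorphicSubring : Subring (Germ (codiscrete X) ℂ) where
  carrier := {φ | ∃ h : X → ℂ, IsMeromorphic h ∧ φ = (h : Germ (codiscrete X) ℂ)}
  mul_mem' := by
    rintro _ _ ⟨a, ha, rfl⟩ ⟨b, hb, rfl⟩
    exact ⟨a * b, fun x => (ha x).mul (hb x), rfl⟩
  one_mem' := ⟨1, fun _ => MeromorphicAt.const 1 _, rfl⟩
  add_mem' := by
    rintro _ _ ⟨a, ha, rfl⟩ ⟨b, hb, rfl⟩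
    exact ⟨a + b, fun x => (ha x).add (hb x), rfl⟩
  zero_mem' := ⟨0, fun _ => MeromorphicAt.const 0 _, rfl⟩
  neg_mem' := by
    rintro _ ⟨a, ha, rfl⟩
    exact ⟨-a, fun x => (ha x).neg, rfl⟩

variable (X) in
/-- The field `ℂ(X)` of meromorphic functions on the Riemann surface `X`. -/
def FunctionField : Type _ := meromorphicSubring X

instance : CommRing (FunctionField X) := inferInstanceAs (CommRing (meromorphicSubring X))

instance : Inv (FunctionField X) where
  inv φ := ⟨φ.1⁻¹, by
    obtain ⟨a, ha, h⟩ := φ.2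
    exact ⟨a⁻¹, fun x => (ha x).inv, by rw [h]; rfl⟩⟩

instance : Field (FunctionField X) where
  exists_pair_ne := ⟨0, 1, fun h => zero_ne_one (α := Germ (codiscrete X) ℂ)
    (congrArg Subtype.val h)⟩
  mul_inv_cancel := by
    rintro ⟨φ, a, ha, rfl⟩ hne
    refine Subtype.ext ?_
    change ((a * a⁻¹ : X → ℂ) : Germ (codiscrete X) ℂ) = ((1 : X → ℂ) : Germ (codiscrete X) ℂ)
    rcases ha.eventually_zero_or with h0 | h1
    · exact absurd (Subtype.ext (Germ.coe_eq.mpr h0)) hne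
    · refine Germ.coe_eq.mpr ?_
      filter_upwards [h1] with x hx
      exact mul_inv_cancel₀ hx
  inv_zero := by
    refine Subtype.ext ?_
    change (((0 : X → ℂ)⁻¹ : X → ℂ) : Germ (codiscrete X) ℂ) =
      ((0 : X → ℂ) : Germ (codiscrete X) ℂ)
    exact congrArg _ (funext fun _ => inv_zero)
  nnqsmul := _
  nnqsmul_def := fun _ _ => rfl
  qsmul := _
  qsmul_def := fun _ _ => rfl

/-- The constant functions. -/
def constHom : ℂ →+* FunctionField X :=
  ((Germ.coeRingHom (codiscrete X)).comp (Pi.constRingHom X ℂ)).codRestrict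
    (meromorphicSubring X) fun c => ⟨fun _ => c, fun _ => MeromorphicAt.const c _, rfl⟩

instance : Algebra ℂ (FunctionField X) := constHom.toAlgebra

/-- The element `φ` of the function field is the meromorphic function `F : X → ℂ ∪ {∞}`. -/
def FunctionField.Represents (φ : FunctionField X) (F : X → OnePoint ℂ) : Prop :=
  ∃ h : X → ℂ, (∀ᶠ x in codiscrete X, F x = (h x : OnePoint ℂ)) ∧
    φ.1 = (h : Germ (codiscrete X) ℂ)

end RiemannSurface

/-! ## The Riemann sphere and Belyi functions -/

namespace RiemannSphere

/-- The inversion `z ↦ 1 / z`. -/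
def inversion : OnePoint ℂ → OnePoint ℂ
  | OnePoint.infty => ((0 : ℂ) : OnePoint ℂ)
  | OnePoint.some z => if z = 0 then OnePoint.infty else ((z⁻¹ : ℂ) : OnePoint ℂ)

@[simp] theorem inversion_infty : inversion OnePoint.infty = ((0 : ℂ) : OnePoint ℂ) := rfl

@[simp] theorem inversion_zero : inversion ((0 : ℂ) : OnePoint ℂ) = OnePoint.infty := if_pos rfl

theorem inversion_coe {z : ℂ} (hz : z ≠ 0) :
    inversion (z : OnePoint ℂ) = ((z⁻¹ : ℂ) : OnePoint ℂ) := if_neg hz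

theorem inversion_inversion (p : OnePoint ℂ) : inversion (inversion p) = p := by
  induction p using OnePoint.rec with
  | infty => simp
  | coe z =>
    by_cases hz : z = 0
    · simp [hz]
    · rw [inversion_coe hz, inversion_coe (inv_ne_zero hz), inv_inv]

theorem continuous_inversion : Continuous inversion := by
  rw [continuous_iff_continuousAt]
  intro p
  induction p using OnePoint.rec with
  | infty =>
    rw [OnePoint.continuousAt_infty', inversion_infty, coclosedCompact_eq_cocompact]
    have h1 : Tendsto (fun z : ℂ => z⁻¹) (cocompact ℂ) (𝓝 0) := by
      rw [← Metric.cobounded_eq_cocompact]; exact tendsto_inv₀_cobounded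
    refine ((OnePoint.continuous_coe.tendsto (0 : ℂ)).comp h1).congr' ?_
    have h0 : ∀ᶠ z : ℂ in cocompact ℂ, z ≠ 0 :=
      (isCompact_singleton (x := (0 : ℂ))).compl_mem_cocompact
    filter_upwards [h0] with z hz
    exact (inversion_coe hz).symm
  | coe z =>
    rw [OnePoint.continuousAt_coe]
    by_cases hz : z = 0
    · subst hz
      rw [ContinuousAt, Function.comp_apply, inversion_zero, ← nhdsNE_sup_pure, tendsto_sup]
      constructor
      · have h1 : Tendsto (fun z : ℂ => z⁻¹) (𝓝[≠] 0) (cocompact ℂ) := by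
          rw [← Metric.cobounded_eq_cocompact]; exact tendsto_inv₀_nhdsNE_zero
        have h2 : Tendsto ((↑) : ℂ → OnePoint ℂ) (cocompact ℂ) (𝓝 OnePoint.infty) := by
          rw [← coclosedCompact_eq_cocompact, ← OnePoint.comap_coe_nhds_infty]
          exact tendsto_comap
        refine (h2.comp h1).congr' ?_
        filter_upwards [self_mem_nhdsWithin] with z hz
        exact (inversion_coe hz).symm
      · rw [tendsto_pure_left]
        intro s hs
        rw [Function.comp_apply, inversion_zero]
        exact mem_of_mem_nhds hs
    · have h1 : ContinuousAt (fun z : ℂ => ((z⁻¹ : ℂ) : OnePoint ℂ)) z :=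
        OnePoint.continuous_coe.continuousAt.comp (continuousAt_inv₀ hz)
      refine h1.congr ?_
      filter_upwards [isOpen_ne.mem_nhds hz] with w hw
      exact (inversion_coe hw).symm

/-- The inversion as a homeomorphism. -/
def inversionHomeo : OnePoint ℂ ≃ₜ OnePoint ℂ where
  toFun := inversion
  invFun := inversion
  left_inv := inversion_inversion
  right_inv := inversion_inversion
  continuous_toFun := continuous_inversion
  continuous_invFun := continuous_inversion

/-- The coordinate `z` on `ℂ ∪ {∞}` minus `∞`. -/
def chartZero : OpenPartialHomeomorph (OnePoint ℂ) ℂ :=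
  (OnePoint.isOpenEmbedding_coe.toOpenPartialHomeomorph ((↑) : ℂ → OnePoint ℂ)).symm

/-- The coordinate `1 / z` on `ℂ ∪ {∞}` minus `0`. -/
def chartInfty : OpenPartialHomeomorph (OnePoint ℂ) ℂ :=
  inversionHomeo.toOpenPartialHomeomorph.trans chartZero

theorem chartZero_source : chartZero.source = Set.range ((↑) : ℂ → OnePoint ℂ) := by
  simp [chartZero]

@[simp] theorem chartZero_symm (z : ℂ) : chartZero.symm z = (z : OnePoint ℂ) := rfl

@[simp] theorem chartZero_coe (z : ℂ) : chartZero (z : OnePoint ℂ) = z :=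
  chartZero.right_inv (x := z) (by simp [chartZero])

theorem mem_chartInfty_source {p : OnePoint ℂ} :
    p ∈ chartInfty.source ↔ inversion p ∈ Set.range ((↑) : ℂ → OnePoint ℂ) := by
  rw [← chartZero_source]
  simp [chartInfty, inversionHomeo]

@[simp] theorem chartInfty_symm (z : ℂ) : chartInfty.symm z = inversion (z : OnePoint ℂ) := rfl

theorem chartInfty_apply (p : OnePoint ℂ) : chartInfty p = chartZero (inversion p) := rfl

open Classical in
instance : ChartedSpace ℂ (OnePoint ℂ) where
  atlas := {chartZero, chartInfty}
  chartAt p := if p = OnePoint.infty then chartInfty else chartZero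
  mem_chart_source p := by
    split_ifs with h
    · rw [mem_chartInfty_source, h]; exact ⟨0, rfl⟩
    · rw [chartZero_source]; exact OnePoint.ne_infty_iff_exists.mp h
  chart_mem_atlas p := by split_ifs <;> simp

theorem contDiffOn_transition {e e' : OpenPartialHomeomorph (OnePoint ℂ) ℂ}
    (he : e ∈ ({chartZero, chartInfty} : Set (OpenPartialHomeomorph (OnePoint ℂ) ℂ)))
    (he' : e' ∈ ({chartZero, chartInfty} : Set (OpenPartialHomeomorph (OnePoint ℂ) ℂ))) :
    ContDiffOn ℂ ω (e.symm.trans e') (e.symm.trans e').source := by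
  have hinv : ∀ s : Set ℂ, (∀ z ∈ s, z ≠ 0) → ∀ F : ℂ → ℂ, (∀ z ∈ s, F z = z⁻¹) →
      ContDiffOn ℂ ω F s := fun s hs F hF =>
    ContDiffOn.congr (fun z hz => (contDiffAt_inv ℂ (hs z hz)).contDiffWithinAt) hF
  rcases he with rfl | rfl <;> rcases he' with rfl | rfl
  · exact contDiffOn_id.congr fun z _ => by simp
  · have hs : ∀ z ∈ (chartZero.symm.trans chartInfty).source, z ≠ 0 := by
      rintro z hz rfl
      have := hz.2
      rw [Set.mem_preimage, mem_chartInfty_source] at this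
      simp at this
    refine hinv _ hs _ fun z hz => ?_
    simp [chartInfty_apply, inversion_coe (hs z hz)]
  · have hs : ∀ z ∈ (chartInfty.symm.trans chartZero).source, z ≠ 0 := by
      rintro z hz rfl
      have := hz.2
      rw [Set.mem_preimage, chartZero_source] at this
      simp at this
    refine hinv _ hs _ fun z hz => ?_
    simp [inversion_coe (hs z hz)]
  · exact contDiffOn_id.congr fun z _ => by simp [chartInfty_apply, inversion_inversion]

instance : IsManifold 𝓘(ℂ) ω (OnePoint ℂ) :=
  isManifold_of_contDiffOn _ _ _ fun e e' he he' => by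
    simpa using! contDiffOn_transition he he'

/-- The Riemann sphere `ℂP¹ = ℂ ∪ {∞}`. -/
instance : RiemannSurface (OnePoint ℂ) where

end RiemannSphere

/-- A Belyi function: a nonconstant holomorphic map to the Riemann sphere all of whose
ramification values are among `0`, `1`, `∞`. -/
structure IsBelyiFunction {X : Type*} [TopologicalSpace X] [RiemannSurface X]
    (F : X → OnePoint ℂ) : Prop where
  holomorphic : MDifferentiable 𝓘(ℂ) 𝓘(ℂ) F
  nonconstant : ¬ ∃ c, ∀ x, F x = c
  ramification : ∀ x, mfderiv 𝓘(ℂ) 𝓘(ℂ) F x = 0 →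
    F x = ((0 : ℂ) : OnePoint ℂ) ∨ F x = ((1 : ℂ) : OnePoint ℂ) ∨ F x = OnePoint.infty

/-! ## Modular curves -/

/-- The extended upper half plane `ℍ* = ℍ ∪ ℚ ∪ {∞}`. -/
inductive HStar : Type
  | point (z : ℍ) : HStar
  | cusp (c : OnePoint ℚ) : HStar

namespace HStar

/-- `SL(2, ℤ)` acts on `ℍ*` by Moebius transformations. -/
instance : MulAction SL(2, ℤ) HStar where
  smul γ
    | point z => point (γ • z)
    | cusp c => cusp (Matrix.SpecialLinearGroup.mapGL ℚ γ • c)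
  one_smul := by
    rintro (z | c)
    · exact congrArg point (one_smul _ z)
    · change cusp (Matrix.SpecialLinearGroup.mapGL ℚ (1 : SL(2, ℤ)) • c) = cusp c
      rw [map_one, one_smul]
  mul_smul := by
    rintro γ δ (z | c)
    · exact congrArg point (mul_smul γ δ z)
    · change cusp (Matrix.SpecialLinearGroup.mapGL ℚ (γ * δ) • c) = cusp (_ • _ • c)
      rw [map_mul, mul_smul]

theorem smul_point (γ : SL(2, ℤ)) (z : ℍ) : γ • point z = point (γ • z) := rfl

theorem smul_cusp (γ : SL(2, ℤ)) (c : OnePoint ℚ) :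
    γ • cusp c = cusp (Matrix.SpecialLinearGroup.mapGL ℚ γ • c) := rfl

/-- The horoball topology: a neighbourhood of the cusp `γ ∞` contains some
`γ {z | Im z > C}`. -/
instance : TopologicalSpace HStar where
  IsOpen U := IsOpen {z : ℍ | point z ∈ U} ∧
    ∀ γ : SL(2, ℤ), γ • cusp OnePoint.infty ∈ U →
      ∃ C : ℝ, ∀ z : ℍ, C < z.im → γ • point z ∈ U
  isOpen_univ := ⟨by simp, fun _ _ => ⟨0, fun _ _ => trivial⟩⟩
  isOpen_inter := by
    rintro U V ⟨hU, hU'⟩ ⟨hV, hV'⟩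
    refine ⟨hU.inter hV, fun γ hγ => ?_⟩
    obtain ⟨C, hC⟩ := hU' γ hγ.1
    obtain ⟨D, hD⟩ := hV' γ hγ.2
    exact ⟨max C D, fun z hz => ⟨hC z ((le_max_left C D).trans_lt hz),
      hD z ((le_max_right C D).trans_lt hz)⟩⟩
  isOpen_sUnion := by
    intro S hS
    constructor
    · have : {z : ℍ | point z ∈ ⋃₀ S} = ⋃ U ∈ S, {z : ℍ | point z ∈ U} := by
        ext z; simp
      rw [this]
      exact isOpen_biUnion fun U hU => (hS U hU).1
    · rintro γ ⟨U, hU, hγ⟩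
      obtain ⟨C, hC⟩ := (hS U hU).2 γ hγ
      exact ⟨C, fun z hz => ⟨U, hU, hC z hz⟩⟩

end HStar

/-- The modular curve `X(Γ) = Γ \ ℍ*`. -/
def ModularCurve (Γ : Subgroup SL(2, ℤ)) : Type := MulAction.orbitRel.Quotient Γ HStar

namespace ModularCurve

variable (Γ : Subgroup SL(2, ℤ))

/-- The quotient topology. -/
instance : TopologicalSpace (ModularCurve Γ) :=
  inferInstanceAs (TopologicalSpace (Quotient (MulAction.orbitRel Γ HStar)))

variable {Γ} in
/-- The orbit `[z]` of a point of `ℍ*`. -/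
def mk (z : HStar) : ModularCurve Γ := Quotient.mk (MulAction.orbitRel Γ HStar) z

/-- The complex atlas of `X(Γ)`: all homeomorphisms `e` from an open subset of `X(Γ)` to an open
subset of `ℂ` such that `z ↦ e([z])` is holomorphic on the part of `ℍ` where it is defined. -/
def holomorphicAtlas : Set (OpenPartialHomeomorph (ModularCurve Γ) ℂ) :=
  {e | ∀ z : ℍ, (mk (.point z) : ModularCurve Γ) ∈ e.source →
    MDifferentiableAt 𝓘(ℂ) 𝓘(ℂ) (fun w : ℍ => e (mk (.point w))) z}

end ModularCurve

/-- The modular curve `X₀(N) = Γ₀(N) \ ℍ*`. -/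
abbrev X₀ (N : ℕ) : Type := ModularCurve (CongruenceSubgroup.Gamma0 N)

/-! ## The `j`-function and the functions `f`, `g` -/

/-- The modular function `j = E₄³ / Δ`, so that `j(e^{πi/3}) = 0` and `j(i) = 1728`. -/
def jFunction (z : ℍ) : ℂ := ModularForm.E₄ z ^ 3 / ModularForm.discriminant z

theorem jFunction_smul (γ : SL(2, ℤ)) (z : ℍ) : jFunction (γ • z) = jFunction z := by
  have hγ : Matrix.SpecialLinearGroup.mapGL ℝ γ ∈ 𝒮ℒ := ⟨γ, rfl⟩
  have h4 := SlashInvariantForm.slash_action_eqn'' ModularForm.E₄ hγ z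
  have h12 := SlashInvariantForm.slash_action_eqn'' CuspForm.discriminant hγ z
  rw [CuspForm.coe_discriminant] at h12
  have hd : denom (Matrix.SpecialLinearGroup.mapGL ℝ γ) z ≠ 0 := denom_ne_zero _ z
  have hD := ModularForm.discriminant_ne_zero z
  have hsmul : γ • z = Matrix.SpecialLinearGroup.mapGL ℝ γ • z := rfl
  rw [jFunction, hsmul, h4, h12, jFunction]
  generalize ModularForm.E₄ z = a
  generalize denom (Matrix.SpecialLinearGroup.mapGL ℝ γ) z = d at hd
  have e1 : d ^ (4 : ℤ) = d ^ 4 := zpow_natCast d 4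
  have e2 : d ^ (12 : ℤ) = d ^ 12 := zpow_natCast d 12
  rw [e1, e2]
  field_simp

/-- The point `N z` of the upper half plane. -/
def scale (N : ℕ) [NeZero N] (z : ℍ) : ℍ :=
  ⟨N * (z : ℂ), by simpa using mul_pos (Nat.cast_pos.mpr (NeZero.pos N)) z.im_pos⟩

theorem exists_scale_smul (N : ℕ) [NeZero N] {γ : SL(2, ℤ)}
    (hγ : γ ∈ CongruenceSubgroup.Gamma0 N) (z : ℍ) :
    ∃ δ : SL(2, ℤ), scale N (γ • z) = δ • scale N z := by
  rw [CongruenceSubgroup.Gamma0_mem, ZMod.intCast_zmod_eq_zero_iff_dvd] at hγ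
  obtain ⟨c, hc⟩ := hγ
  have hdet : γ 0 0 * γ 1 1 - γ 0 1 * γ 1 0 = 1 := by
    rw [← Matrix.det_fin_two]; exact γ.det_coe
  obtain ⟨δ, h00, h01, h10, h11⟩ : ∃ δ : SL(2, ℤ),
      δ 0 0 = γ 0 0 ∧ δ 0 1 = γ 0 1 * N ∧ δ 1 0 = c ∧ δ 1 1 = γ 1 1 := by
    refine ⟨⟨!![γ 0 0, γ 0 1 * N; c, γ 1 1], ?_⟩, rfl, rfl, rfl, rfl⟩
    rw [Matrix.det_fin_two_of]
    rw [hc] at hdet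
    linear_combination hdet
  refine ⟨δ, UpperHalfPlane.ext ?_⟩
  have hcC : ((γ 1 0 : ℤ) : ℂ) = N * c := by rw [hc]; push_cast; ring
  have h1 : ((γ 1 0 : ℤ) : ℂ) * z + (γ 1 1 : ℤ) ≠ 0 := by
    simpa [denom] using denom_ne_zero (Matrix.SpecialLinearGroup.mapGL ℝ γ) z
  change (N : ℂ) * ((γ • z : ℍ) : ℂ) = _
  rw [UpperHalfPlane.coe_specialLinearGroup_apply, UpperHalfPlane.coe_specialLinearGroup_apply,
    h00, h01, h10, h11]
  simp only [scale, algebraMap_int_eq, eq_intCast, Complex.ofReal_intCast]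
  rw [hcC] at h1 ⊢
  push_cast
  have h2 : (c : ℂ) * (N * (z : ℂ)) + (γ 1 1 : ℤ) ≠ 0 := by
    convert h1 using 1; ring
  rw [mul_div_assoc', div_eq_div_iff h1 h2]
  ring

/-- `f : X₀(N) → ℂP¹`, `[z] ↦ j(z) / 1728`, with value `∞` at the cusps. -/
def belyiF (N : ℕ) : X₀ N → OnePoint ℂ :=
  Quotient.lift (s := MulAction.orbitRel (CongruenceSubgroup.Gamma0 N) HStar)
    (fun
      | .point z => ((jFunction z / 1728 : ℂ) : OnePoint ℂ)
      | .cusp _ => OnePoint.infty) (by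
    rintro _ b ⟨⟨γ, hγ⟩, rfl⟩
    rcases b with z | c
    · change ((jFunction (γ • z) / 1728 : ℂ) : OnePoint ℂ) = _
      rw [jFunction_smul]
    · rfl)

/-- `g : X₀(N) → ℂP¹`, `[z] ↦ j(N z) / 1728`, with value `∞` at the cusps. -/
def belyiG (N : ℕ) [NeZero N] : X₀ N → OnePoint ℂ :=
  Quotient.lift (s := MulAction.orbitRel (CongruenceSubgroup.Gamma0 N) HStar)
    (fun
      | .point z => ((jFunction (scale N z) / 1728 : ℂ) : OnePoint ℂ)
      | .cusp _ => OnePoint.infty) (by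
    rintro _ b ⟨⟨γ, hγ⟩, rfl⟩
    rcases b with z | c
    · change ((jFunction (scale N (γ • z)) / 1728 : ℂ) : OnePoint ℂ) = _
      obtain ⟨δ, hδ⟩ := exists_scale_smul N hγ z
      rw [hδ, jFunction_smul]
    · rfl)

/-- The transformation `z ↦ -1 / (N z)` of `ℍ*`. -/
def frickeStar (N : ℕ) [NeZero N] : HStar → HStar
  | .point z => .point (ModularGroup.S • scale N z)
  | .cusp c => .cusp (Matrix.GeneralLinearGroup.mkOfDetNeZero !![(0 : ℚ), -1; (N : ℚ), 0]
      (by simp [NeZero.ne N]) • c)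

/-- `Φ(X, Y)` is the modular equation for `Γ₀(N)`, i.e. the algebraic dependence relation between
`X = j(z)` and `Y = j(N z)`: it is monic in `Y`, and the polynomial relations between these two
functions are exactly the multiples of `Φ`. Here `Y` is the outer variable. -/
def IsModularEquation (N : ℕ) [NeZero N] (Φ : Polynomial (Polynomial ℂ)) : Prop :=
  Φ.Monic ∧ ∀ P : Polynomial (Polynomial ℂ),
    (∀ z : ℍ, P.evalEval (jFunction z) (jFunction (scale N z)) = 0) ↔ Φ ∣ P

end

/-!
The Riemann surface. At a point `z₀` of `ℍ` with stabiliser of order `k` modulo `±1`, the `k`-th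
power of the Cayley coordinate is a coordinate on `X(Γ)` (`exists_isUniformizer_point`), because the
stabiliser acts in the Cayley coordinate by the `k`-th roots of unity; at a cusp `σ ∞` of width `h`,
the function `σ z ↦ exp (2πiz/h)` is one (`exists_isUniformizer_cusp`). Away from the centre of such
a coordinate the projection from `ℍ` has local inverses, and the centre is a removable singularity,
so a continuous function on `X(Γ)` is holomorphic as soon as its lift to `ℍ` is
(`differentiableAt_comp_symm_of_isUniformizer`). This makes any two charts of the holomorphic atlas
compatible, and it reduces the holomorphy of `f`, `g` and `w` to the holomorphy of functions on `ℍ`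
(`mdifferentiable_of_comp_mk`). `X(Γ)` is compact because finitely many translates of the closed
fundamental domain, with its cusp, cover it.

Ramification. The function `j' Δ` is a modular form of weight `14`, hence a nonzero multiple of
`E₄² E₆`. So `j' = 0` forces `E₄ = 0` or `E₆ = 0`, that is `j = 0` or `j = 1728`
(`jFunction_eq_of_deriv_eq_zero`). This shows that `f` is a Belyi function, and `g = f ∘ w` is one
because `w` is an involution. That `w` extends continuously to the cusps comes from
`exists_frickeStar_smul`: the map `z ↦ -1/(Nz)` composed with an element of `SL(2, ℤ)` is an element
of `SL(2, ℤ)` composed with an affine map.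

Relations. In the algebra `cuspAlgebra` of holomorphic functions on `ℍ` which grow at most
exponentially at the cusps, the `SL(2, ℤ)`-invariant functions are the polynomials in `j`
(`exists_eq_eval_jFunction`). The conjugates `z ↦ j(N σ⁻¹ z)`, for `σ` in `SL(2, ℤ) / Γ₀(N)`, are
pairwise distinct, because the growth of `j` at `i∞` determines `σ` modulo `Γ₀(N)`
(`mem_Gamma0_of_jFunction_scale_smul`). Therefore `Φ = ∏ (Y - j(N σ⁻¹ z))` has coefficients in
`ℂ[j]`, and it divides every relation between `j(z)` and `j(Nz)`, since all the conjugates are roots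
of such a relation (`exists_monic_evalPair_eq_zero_iff`). By Gauss's lemma it is the minimal
polynomial over `ℂ(f)` (`minpoly_eq_map_aeval`).

Generation. Lagrange interpolation at the conjugates of `j(Nz)` writes every `Γ₀(N)`-invariant
function of `cuspAlgebra` as a rational function of `j(z)` and `j(Nz)` (`exists_evalPair_eq_mul`).
By compactness a meromorphic function on `X₀(N)` becomes such an invariant function on
multiplication by a polynomial in `j` (`ModularCurve.exists_eq_eval_jFunction_mul`), so `f` and `g`
generate the function field.

Symmetry. The involution `w` exchanges `j(z)` and `j(Nz)`, so `Φ(Y, X) = c Φ(X, Y)` with `c = ±1`.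
If `c = -1`, then `Φ` vanishes on the diagonal, and `Y - X` divides it; as `Φ` has minimal degree
in `Y` among the relations, `j(Nz) = j(z)`, which happens only for `N = 1`
(`IsModularEquation.swap_eq`).
-/

/-! ### The topology of the extended upper half plane -/

instance : ContinuousConstSMul SL(2, ℤ) ℍ where
  continuous_const_smul γ := continuous_const_smul (Matrix.SpecialLinearGroup.mapGL ℝ γ)

namespace ModularGroup

theorem im_smul_eq_of_c_eq_zero {g : SL(2, ℤ)} (hg : g 1 0 = 0) (z : ℍ) : (g • z).im = z.im := by
  obtain ⟨n, hn⟩ := exists_eq_T_zpow_of_c_eq_zero hg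
  rw [hn, im_T_zpow_smul]

/-- If the lower left entry of `g` does not vanish, then `|cz + d| ≥ Im z`. -/
theorem im_smul_le_inv_im {g : SL(2, ℤ)} (hg : g 1 0 ≠ 0) (z : ℍ) : (g • z).im ≤ z.im⁻¹ := by
  have h : (g • z).im = z.im / Complex.normSq (denom (Matrix.SpecialLinearGroup.mapGL ℝ g) z) :=
    ModularGroup.im_smul_eq_div_normSq g z
  rw [h]
  have h1 : z.im ^ 2 ≤ Complex.normSq (denom (Matrix.SpecialLinearGroup.mapGL ℝ g) z) := by
    have hc : (1 : ℝ) ≤ (g 1 0 : ℝ) ^ 2 := by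
      have : 1 ≤ (g 1 0) ^ 2 := by
        have := sq_pos_of_ne_zero hg
        omega
      exact_mod_cast this
    simp [denom, Complex.normSq_apply]
    nlinarith [sq_nonneg ((g 1 0 : ℝ) * z.re + g 1 1), sq_nonneg z.im,
      mul_le_mul_of_nonneg_right hc (sq_nonneg z.im)]
  have hz := z.im_pos
  rw [div_le_iff₀ (lt_of_lt_of_le (by positivity) h1), inv_mul_eq_div, le_div_iff₀ hz, ← sq]
  exact h1

end ModularGroup

namespace HStar

theorem continuous_point : Continuous point :=
  continuous_def.mpr fun _ hU => hU.1

theorem isOpenMap_point : IsOpenMap point := by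
  intro U hU
  constructor
  · convert hU using 1
    ext z
    simp
  · rintro γ ⟨z, -, hz⟩
    exact absurd hz (by simp [smul_cusp])

theorem injective_point : Function.Injective point := fun _ _ h => by injection h

theorem isOpenEmbedding_point : IsOpenEmbedding point :=
  .of_continuous_injective_isOpenMap continuous_point injective_point isOpenMap_point

instance : ContinuousConstSMul SL(2, ℤ) HStar where
  continuous_const_smul γ := by
    refine continuous_def.mpr fun U hU => ⟨?_, fun δ hδ => ?_⟩
    · exact hU.1.preimage (continuous_const_smul γ)
    · obtain ⟨C, hC⟩ := hU.2 (γ * δ) (by rw [mul_smul]; exact hδ)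
      exact ⟨C, fun z hz => by have := hC z hz; rwa [mul_smul] at this⟩

theorem exists_smul_cusp_infty (c : OnePoint ℚ) :
    ∃ σ : SL(2, ℤ), σ • cusp OnePoint.infty = cusp c := by
  obtain ⟨g, hg⟩ := OnePoint.exists_mem_SL2 ℤ c
  exact ⟨g, by rw [smul_cusp, hg]⟩

theorem smul_cusp_infty_eq_self_iff {g : SL(2, ℤ)} :
    g • cusp OnePoint.infty = cusp OnePoint.infty ↔ g 1 0 = 0 := by
  rw [smul_cusp, cusp.injEq, OnePoint.smul_infty_eq_self_iff]
  simp

theorem smul_cusp_infty_eq_iff {σ τ : SL(2, ℤ)} :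
    σ • cusp OnePoint.infty = τ • cusp OnePoint.infty ↔ (σ⁻¹ * τ) 1 0 = 0 := by
  rw [← smul_cusp_infty_eq_self_iff, mul_smul, inv_smul_eq_iff, eq_comm]

/-- The horoball `σ {z | Im z > C}` together with its cusp `σ ∞`. -/
def horoball (σ : SL(2, ℤ)) (C : ℝ) : Set HStar :=
  {p | p = σ • cusp OnePoint.infty ∨ ∃ z : ℍ, C < z.im ∧ p = σ • point z}

theorem smul_cusp_mem_horoball (σ : SL(2, ℤ)) (C : ℝ) : σ • cusp OnePoint.infty ∈ horoball σ C :=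
  Or.inl rfl

theorem smul_point_mem_horoball {σ : SL(2, ℤ)} {C : ℝ} {z : ℍ} :
    σ • point z ∈ horoball σ C ↔ C < z.im := by
  constructor
  · rintro (h | ⟨w, hw, h⟩)
    · rw [smul_point, smul_cusp] at h; exact absurd h (by simp)
    · have := smul_left_cancel σ h
      rwa [injective_point this]
  · exact fun h => Or.inr ⟨z, h, rfl⟩

theorem isOpen_horoball (σ : SL(2, ℤ)) (C : ℝ) : IsOpen (horoball σ C) := by
  constructor
  · have : {z : ℍ | point z ∈ horoball σ C} = (fun z => σ⁻¹ • z) ⁻¹' {z : ℍ | C < z.im} := by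
      ext z
      change point z ∈ horoball σ C ↔ C < (σ⁻¹ • z).im
      rw [← smul_point_mem_horoball (σ := σ), smul_point, smul_inv_smul]
    rw [this]
    exact (isOpen_lt continuous_const continuous_im).preimage (continuous_const_smul _)
  · rintro γ (h | ⟨w, hw, h⟩)
    · have h10 := smul_cusp_infty_eq_iff.mp h.symm
      refine ⟨C, fun z hz => Or.inr ⟨(σ⁻¹ * γ) • z, ?_, ?_⟩⟩
      · rwa [ModularGroup.im_smul_eq_of_c_eq_zero h10]
      · rw [← smul_point, ← mul_smul, mul_inv_cancel_left]
    · rw [smul_point, smul_cusp] at h; exact absurd h (by simp)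

theorem mem_nhds_smul_cusp_iff {σ : SL(2, ℤ)} {U : Set HStar} :
    U ∈ 𝓝 (σ • cusp OnePoint.infty) ↔ ∃ C : ℝ, horoball σ C ⊆ U := by
  constructor
  · intro h
    obtain ⟨V, hVU, hV, hσ⟩ := mem_nhds_iff.mp h
    obtain ⟨C, hC⟩ := hV.2 σ hσ
    refine ⟨C, ?_⟩
    rintro _ (rfl | ⟨z, hz, rfl⟩)
    · exact hVU hσ
    · exact hVU (hC z hz)
  · rintro ⟨C, hC⟩
    exact mem_of_superset ((isOpen_horoball σ C).mem_nhds (smul_cusp_mem_horoball σ C)) hC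

theorem mem_nhds_smul_cusp_iff' {σ : SL(2, ℤ)} {U : Set HStar} :
    U ∈ 𝓝 (σ • cusp OnePoint.infty) ↔
      σ • cusp OnePoint.infty ∈ U ∧ ∀ᶠ z in atImInfty, σ • point z ∈ U := by
  rw [mem_nhds_smul_cusp_iff]
  constructor
  · rintro ⟨C, hC⟩
    refine ⟨hC (smul_cusp_mem_horoball σ C), (atImInfty_mem _).mpr ⟨C + 1, fun z hz => ?_⟩⟩
    exact hC (smul_point_mem_horoball.mpr (by linarith))
  · rintro ⟨h, hz⟩
    obtain ⟨C, hC⟩ := (atImInfty_mem _).mp hz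
    refine ⟨C, ?_⟩
    rintro _ (rfl | ⟨z, hz, rfl⟩)
    · exact h
    · exact hC z hz.le

theorem tendsto_smul_point_atImInfty (σ : SL(2, ℤ)) :
    Tendsto (fun z => σ • point z) atImInfty (𝓝 (σ • cusp OnePoint.infty)) :=
  fun _ hU => (mem_nhds_smul_cusp_iff'.mp hU).2

theorem continuousAt_smul_cusp_iff {Y : Type*} [TopologicalSpace Y] {σ : SL(2, ℤ)}
    {f : HStar → Y} : ContinuousAt f (σ • cusp OnePoint.infty) ↔
      Tendsto (fun z => f (σ • point z)) atImInfty (𝓝 (f (σ • cusp OnePoint.infty))) := by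
  refine ⟨fun h => h.tendsto.comp (tendsto_smul_point_atImInfty σ), fun h U hU => ?_⟩
  exact mem_nhds_smul_cusp_iff'.mpr ⟨mem_of_mem_nhds (x := f (σ • cusp OnePoint.infty)) hU, h hU⟩

theorem continuousAt_point_iff {Y : Type*} [TopologicalSpace Y] {z : ℍ} {f : HStar → Y} :
    ContinuousAt f (point z) ↔ ContinuousAt (f ∘ point) z :=
  isOpenEmbedding_point.continuousAt_iff.symm

/-- Continuity on `ℍ*`, tested on `ℍ` and along `σ z` with `Im z → ∞` at each cusp `σ ∞`. -/
theorem continuous_of_tendsto {Y : Type*} [TopologicalSpace Y] {f : HStar → Y}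
    (h : Continuous (f ∘ point)) (h' : ∀ σ : SL(2, ℤ),
      Tendsto (fun z => f (σ • point z)) atImInfty (𝓝 (f (σ • cusp OnePoint.infty)))) :
    Continuous f := by
  refine continuous_iff_continuousAt.mpr fun p => ?_
  rcases p with z | c
  · exact continuousAt_point_iff.mpr h.continuousAt
  · obtain ⟨σ, hσ⟩ := exists_smul_cusp_infty c
    rw [← hσ]
    exact continuousAt_smul_cusp_iff.mpr (h' σ)

theorem dense_range_point : DenseRange point := by
  rintro (z | c)
  · exact subset_closure ⟨z, rfl⟩
  · obtain ⟨σ, hσ⟩ := exists_smul_cusp_infty c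
    rw [← hσ]
    exact mem_closure_of_tendsto (tendsto_smul_point_atImInfty σ) (.of_forall fun z => ⟨σ • z, rfl⟩)

/-- The fundamental domain of `SL(2, ℤ)` together with the cusp `∞` is compact. -/
theorem isCompact_insert_cusp_fd :
    IsCompact (insert (cusp OnePoint.infty) (point '' ModularGroup.fd)) := by
  rw [isCompact_iff_ultrafilter_le_nhds]
  intro f hf
  rw [le_principal_iff] at hf
  by_cases h : ∃ C : ℝ, point '' ModularGroup.truncatedFundamentalDomain C ∈ f
  · obtain ⟨C, hC⟩ := h
    obtain ⟨p, ⟨z, hz, rfl⟩, hp⟩ := isCompact_iff_ultrafilter_le_nhds.mp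
      ((ModularGroup.isCompact_truncatedFundamentalDomain C).image continuous_point) f
      (le_principal_iff.mpr hC)
    exact ⟨_, Or.inr ⟨z, hz.1, rfl⟩, hp⟩
  · push Not at h
    refine ⟨cusp OnePoint.infty, Or.inl rfl, fun U hU => ?_⟩
    rw [← one_smul SL(2, ℤ) (cusp OnePoint.infty)] at hU
    obtain ⟨C, hC⟩ := mem_nhds_smul_cusp_iff.mp hU
    filter_upwards [hf, Ultrafilter.compl_mem_iff_notMem.mpr (h C)] with p hp hp'
    apply hC
    rcases hp with rfl | ⟨z, hz, rfl⟩
    · exact Or.inl (one_smul _ _).symm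
    · refine Or.inr ⟨z, not_le.mp fun hle => hp' ⟨z, ⟨hz, hle⟩, rfl⟩, (one_smul _ _).symm⟩

theorem exists_smul_mem_insert_cusp_fd (p : HStar) :
    ∃ g : SL(2, ℤ), g • p ∈ insert (cusp OnePoint.infty) (point '' ModularGroup.fd) := by
  rcases p with z | c
  · obtain ⟨g, hg⟩ := ModularGroup.exists_smul_mem_fd z
    exact ⟨g, Or.inr ⟨_, hg, rfl⟩⟩
  · obtain ⟨σ, hσ⟩ := exists_smul_cusp_infty c
    exact ⟨σ⁻¹, Or.inl (by rw [← hσ, inv_smul_smul])⟩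

/-- Every point of `ℍ` has a neighbourhood that meets none of its translates except those by the
stabiliser. -/
theorem exists_nhds_smul_eq_self (z : ℍ) : ∃ U ∈ 𝓝 z, ∀ γ : SL(2, ℤ), ∀ w ∈ U, γ • w ∈ U →
    γ • z = z := by
  obtain ⟨U, hU, h⟩ := ProperlyDiscontinuousSMul.exists_nhds_image_smul_eq_self 𝒮ℒ z
  exact ⟨U, hU, fun γ w hw hγ => h ⟨_, γ, rfl⟩ ⟨_, ⟨w, hw, rfl⟩, hγ⟩⟩

theorem finite_setOf_smul_eq_self (z : ℍ) : {γ : SL(2, ℤ) | γ • z = z}.Finite := by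
  have h := ProperlyDiscontinuousSMul.finite_stabilizer' 𝒮ℒ z
  have hinj : Function.Injective
      fun γ : SL(2, ℤ) => (⟨Matrix.SpecialLinearGroup.mapGL ℝ γ, γ, rfl⟩ : 𝒮ℒ) := by
    intro a b hab
    exact Matrix.SpecialLinearGroup.mapGL_injective (congrArg Subtype.val hab)
  exact (h.preimage hinj.injOn).subset fun γ hγ => hγ

/-- Two points of `ℍ` that are not equivalent under `Γ` have neighbourhoods without equivalent
points. -/
theorem exists_nhds_smul_ne (Γ : Subgroup SL(2, ℤ)) {z w : ℍ} (h : ∀ γ ∈ Γ, γ • z ≠ w) :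
    ∃ U ∈ 𝓝 z, ∃ V ∈ 𝓝 w, ∀ γ ∈ Γ, ∀ u ∈ U, γ • u ∉ V := by
  obtain ⟨K, hK, hKz⟩ := exists_compact_mem_nhds z
  obtain ⟨L, hL, hLw⟩ := exists_compact_mem_nhds w
  have hfin : {γ : SL(2, ℤ) | ((γ • ·) '' K ∩ L).Nonempty}.Finite := by
    have h1 := ProperlyDiscontinuousSMul.finite_disjoint_inter_image (Γ := 𝒮ℒ) hK hL
    have hinj : Function.Injective
        fun γ : SL(2, ℤ) => (⟨Matrix.SpecialLinearGroup.mapGL ℝ γ, γ, rfl⟩ : 𝒮ℒ) := by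
      intro a b hab
      exact Matrix.SpecialLinearGroup.mapGL_injective (congrArg Subtype.val hab)
    exact (h1.preimage hinj.injOn).subset fun γ hγ => hγ
  have hsep : ∀ γ : SL(2, ℤ), ∃ A ∈ 𝓝 z, ∃ B ∈ 𝓝 w, γ ∈ Γ → ∀ u ∈ A, γ • u ∉ B := by
    intro γ
    by_cases hγ : γ ∈ Γ
    · obtain ⟨A, B, hA, hB, hAB⟩ := t2_separation_nhds (h γ hγ)
      refine ⟨(γ • ·) ⁻¹' A, (continuous_const_smul γ).continuousAt hA, B, hB, fun _ u hu hu' => ?_⟩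
      exact hAB.le_bot ⟨hu, hu'⟩
    · exact ⟨Set.univ, univ_mem, Set.univ, univ_mem, fun h => absurd h hγ⟩
  choose A hA B hB hAB using hsep
  refine ⟨K ∩ ⋂ γ ∈ {γ : SL(2, ℤ) | ((γ • ·) '' K ∩ L).Nonempty}, A γ,
    inter_mem hKz ((biInter_mem hfin).mpr fun γ _ => hA γ),
    L ∩ ⋂ γ ∈ {γ : SL(2, ℤ) | ((γ • ·) '' K ∩ L).Nonempty}, B γ,
    inter_mem hLw ((biInter_mem hfin).mpr fun γ _ => hB γ), fun γ hγ u hu hu' => ?_⟩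
  have hmem : γ ∈ {γ : SL(2, ℤ) | ((γ • ·) '' K ∩ L).Nonempty} := ⟨_, ⟨u, hu.1, rfl⟩, hu'.1⟩
  exact hAB γ hγ u (Set.mem_iInter₂.mp hu.2 γ hmem) (Set.mem_iInter₂.mp hu'.2 γ hmem)

end HStar

/-! ### The modular curve `X(Γ)` is compact and Hausdorff -/

namespace ModularCurve

open HStar

variable {Γ : Subgroup SL(2, ℤ)}

theorem isOpenQuotientMap_mk : IsOpenQuotientMap (mk : HStar → ModularCurve Γ) :=
  have : ContinuousConstSMul Γ HStar := ⟨fun γ => continuous_const_smul (γ : SL(2, ℤ))⟩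
  MulAction.isOpenQuotientMap_quotientMk

theorem continuous_mk : Continuous (mk : HStar → ModularCurve Γ) :=
  isOpenQuotientMap_mk.continuous

theorem mk_eq_mk_iff {p q : HStar} : (mk p : ModularCurve Γ) = mk q ↔ ∃ γ ∈ Γ, γ • q = p := by
  refine (Quotient.eq (r := MulAction.orbitRel Γ HStar)).trans ?_
  rw [MulAction.orbitRel_apply, MulAction.mem_orbit_iff]
  constructor
  · rintro ⟨γ, h⟩; exact ⟨γ, γ.2, h⟩
  · rintro ⟨γ, hγ, h⟩; exact ⟨⟨γ, hγ⟩, h⟩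

theorem mk_smul {γ : SL(2, ℤ)} (hγ : γ ∈ Γ) (p : HStar) : (mk (γ • p) : ModularCurve Γ) = mk p :=
  mk_eq_mk_iff.mpr ⟨γ, hγ, rfl⟩

instance : ConnectedSpace (ModularCurve Γ) :=
  have h : DenseRange ((mk : HStar → ModularCurve Γ) ∘ point) :=
    isOpenQuotientMap_mk.surjective.denseRange.comp dense_range_point continuous_mk
  have := h.preconnectedSpace (continuous_mk.comp continuous_point)
  { toNonempty := ⟨mk (cusp OnePoint.infty)⟩ }

instance [Γ.FiniteIndex] : CompactSpace (ModularCurve Γ) := by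
  refine ⟨?_⟩
  have h : (Set.univ : Set (ModularCurve Γ)) = ⋃ r : SL(2, ℤ) ⧸ Γ,
      (fun p => mk (r.out⁻¹ • p)) '' insert (cusp OnePoint.infty) (point '' ModularGroup.fd) := by
    refine (Set.eq_univ_of_forall fun x => ?_).symm
    obtain ⟨p, rfl⟩ := isOpenQuotientMap_mk.surjective x
    obtain ⟨g, hg⟩ := exists_smul_mem_insert_cusp_fd p
    refine Set.mem_iUnion.mpr ⟨(g : SL(2, ℤ) ⧸ Γ), g • p, hg, ?_⟩
    have hγ : (g : SL(2, ℤ) ⧸ Γ).out⁻¹ * g ∈ Γ :=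
      QuotientGroup.eq.mp (QuotientGroup.out_eq' (g : SL(2, ℤ) ⧸ Γ))
    simp only [← mul_smul]
    exact mk_smul hγ p
  rw [h]
  exact isCompact_iUnion fun r =>
    isCompact_insert_cusp_fd.image (continuous_mk.comp (continuous_const_smul _))

/-- Separation of points of `X(Γ)`, in terms of representatives. -/
theorem exists_disjoint_nhds_mk {p q : HStar} {U V : Set HStar} (hU : U ∈ 𝓝 p) (hV : V ∈ 𝓝 q)
    (h : ∀ γ ∈ Γ, ∀ u ∈ U, γ • u ∉ V) : Disjoint (𝓝 (mk p : ModularCurve Γ)) (𝓝 (mk q)) := by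
  refine Filter.disjoint_iff.mpr ⟨mk '' U, isOpenQuotientMap_mk.isOpenMap.image_mem_nhds hU,
    mk '' V, isOpenQuotientMap_mk.isOpenMap.image_mem_nhds hV, ?_⟩
  rw [Set.disjoint_left]
  rintro _ ⟨u, hu, rfl⟩ ⟨v, hv, hvu⟩
  obtain ⟨γ, hγ, rfl⟩ := mk_eq_mk_iff.mp hvu
  exact h γ hγ u hu hv

theorem disjoint_nhds_point_cusp (z : ℍ) (σ : SL(2, ℤ)) :
    Disjoint (𝓝 (mk (point z) : ModularCurve Γ)) (𝓝 (mk (σ • cusp OnePoint.infty))) := by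
  obtain ⟨K, hK, hKz⟩ := exists_compact_mem_nhds z
  obtain ⟨C, hC⟩ : ∃ C, ∀ w ∈ K, max w.im w.im⁻¹ ≤ C := by
    have := hK.bddAbove_image (f := fun w : ℍ => max w.im w.im⁻¹)
      (continuous_im.max (continuous_im.inv₀ fun w => w.im_pos.ne')).continuousOn
    obtain ⟨C, hC⟩ := this
    exact ⟨C, fun w hw => hC ⟨w, hw, rfl⟩⟩
  refine exists_disjoint_nhds_mk (isOpenMap_point.image_mem_nhds hKz)
    ((isOpen_horoball σ C).mem_nhds (smul_cusp_mem_horoball σ C)) ?_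
  rintro γ - _ ⟨w, hw, rfl⟩ h
  have h1 : γ • point w = σ • point ((σ⁻¹ * γ) • w) := by
    rw [← smul_point, ← mul_smul, mul_inv_cancel_left]
  rw [h1, smul_point_mem_horoball] at h
  have h2 := hC w hw
  by_cases hc : (σ⁻¹ * γ) 1 0 = 0
  · rw [ModularGroup.im_smul_eq_of_c_eq_zero hc] at h
    exact absurd ((le_max_left _ _).trans h2) (not_le.mpr h)
  · have := ModularGroup.im_smul_le_inv_im hc w
    exact absurd (this.trans ((le_max_right _ _).trans h2)) (not_le.mpr h)

/-- An element of `SL(2, ℤ)` that maps a point of height `> 1` to a point of height `> 1` fixes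
the cusp `∞`. -/
theorem c_eq_zero_of_one_lt_im {g : SL(2, ℤ)} {z : ℍ} (hz : 1 < z.im) (hg : 1 < (g • z).im) :
    g 1 0 = 0 := by
  by_contra hc
  have := ModularGroup.im_smul_le_inv_im hc z
  have h2 : z.im⁻¹ < 1 := inv_lt_one_of_one_lt₀ hz
  linarith

instance : T2Space (ModularCurve Γ) := by
  refine t2Space_iff_disjoint_nhds.mpr fun x y hxy => ?_
  obtain ⟨p, rfl⟩ := isOpenQuotientMap_mk.surjective x
  obtain ⟨q, rfl⟩ := isOpenQuotientMap_mk.surjective y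
  rcases p with z | c <;> rcases q with w | d
  · obtain ⟨U, hU, V, hV, h⟩ := exists_nhds_smul_ne Γ (z := z) (w := w) fun γ hγ h =>
      hxy (mk_eq_mk_iff.mpr ⟨γ, hγ, congrArg point h⟩).symm
    refine exists_disjoint_nhds_mk (isOpenMap_point.image_mem_nhds hU)
      (isOpenMap_point.image_mem_nhds hV) ?_
    rintro γ hγ _ ⟨u, hu, rfl⟩ ⟨v, hv, huv⟩
    rw [smul_point] at huv
    exact h γ hγ u hu (injective_point huv ▸ hv)
  · obtain ⟨σ, hσ⟩ := exists_smul_cusp_infty d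
    rw [← hσ]
    exact disjoint_nhds_point_cusp z σ
  · obtain ⟨σ, hσ⟩ := exists_smul_cusp_infty c
    rw [← hσ]
    exact (disjoint_nhds_point_cusp w σ).symm
  · obtain ⟨σ, hσ⟩ := exists_smul_cusp_infty c
    obtain ⟨τ, hτ⟩ := exists_smul_cusp_infty d
    rw [← hσ, ← hτ] at hxy ⊢
    refine exists_disjoint_nhds_mk ((isOpen_horoball σ 1).mem_nhds (smul_cusp_mem_horoball σ 1))
      ((isOpen_horoball τ 1).mem_nhds (smul_cusp_mem_horoball τ 1)) ?_
    rintro γ hγ _ (rfl | ⟨z, hz, rfl⟩) (h | ⟨w, hw, h⟩)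
    · exact hxy (mk_eq_mk_iff.mpr ⟨γ, hγ, h⟩).symm
    · simp [smul_cusp, smul_point] at h
    · simp [smul_cusp, smul_point] at h
    · have h1 : w = (τ⁻¹ * (γ * σ)) • z := by
        apply injective_point
        rw [← smul_point, mul_smul, mul_smul, h, inv_smul_smul]
      rw [h1] at hw
      have h2 := smul_cusp_infty_eq_iff.mpr (c_eq_zero_of_one_lt_im hz hw)
      exact hxy (mk_eq_mk_iff.mpr ⟨γ, hγ, by rw [h2, mul_smul]⟩).symm

end ModularCurve

/-! ### Coordinates on `X(Γ)` -/

/-- The inverse of an injective holomorphic function is holomorphic: it is differentiable off the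
isolated critical points, and it is continuous. -/
theorem OpenPartialHomeomorph.differentiableOn_symm {e : OpenPartialHomeomorph ℂ ℂ}
    (he : DifferentiableOn ℂ e e.source) : DifferentiableOn ℂ e.symm e.target := by
  have hreg : ∀ c ∈ e.target, deriv e (e.symm c) ≠ 0 → DifferentiableAt ℂ e.symm c := by
    intro c hc h
    exact (e.hasDerivAt_symm hc h ((he.differentiableAt
      (e.open_source.mem_nhds (e.map_target hc))).hasDerivAt)).differentiableAt
  intro c hc
  refine DifferentiableAt.differentiableWithinAt ?_
  have ha : e.symm c ∈ e.source := e.map_target hc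
  have han : AnalyticAt ℂ e (e.symm c) := he.analyticAt (e.open_source.mem_nhds ha)
  refine (Complex.analyticAt_of_differentiable_on_punctured_nhds_of_continuousAt ?_
    (e.symm.continuousAt hc)).differentiableAt
  rcases han.deriv.eventually_eq_zero_or_eventually_ne_zero with h | h
  · -- a vanishing derivative would make `e` locally constant, against injectivity
    exfalso
    obtain ⟨r, hr, hball⟩ := Metric.eventually_nhds_iff_ball.mp
      (h.and (e.open_source.eventually_mem ha))
    have hconst : ∀ x ∈ Metric.ball (e.symm c) r, e x = e (e.symm c) := by
      intro x hx
      refine (convex_ball (e.symm c) r).is_const_of_fderivWithin_eq_zero (𝕜 := ℂ) (f := e)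
        (fun y hy => (he y (hball y hy).2).mono fun z hz => (hball z hz).2) (fun y hy => ?_) hx
        (Metric.mem_ball_self hr)
      rw [fderivWithin_of_isOpen Metric.isOpen_ball hy]
      ext
      simpa using (hball y hy).1
    have hev : ∀ᶠ x in 𝓝[≠] (e.symm c), x ∈ Metric.ball (e.symm c) r :=
      mem_nhdsWithin_of_mem_nhds (Metric.ball_mem_nhds _ hr)
    obtain ⟨x, hx, hne⟩ := (hev.and self_mem_nhdsWithin).exists
    exact hne (e.injOn (hball x hx).2 ha (hconst x hx))
  · have h1 : Tendsto e.symm (𝓝[≠] c) (𝓝[≠] (e.symm c)) := by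
      refine tendsto_nhdsWithin_of_tendsto_nhds_of_eventually_within _
        ((e.symm.continuousAt hc).tendsto.mono_left nhdsWithin_le_nhds) ?_
      filter_upwards [self_mem_nhdsWithin,
        mem_nhdsWithin_of_mem_nhds (e.open_target.mem_nhds hc)] with x hx hxt h
      exact hx (e.symm.injOn hxt hc h)
    filter_upwards [h1.eventually h,
      mem_nhdsWithin_of_mem_nhds (e.open_target.mem_nhds hc)] with x hx hxt
    exact hreg x hxt hx

/-- The open mapping theorem on the upper half plane. -/
theorem UpperHalfPlane.isOpenMap_of_mdifferentiable {f : ℍ → ℂ} (hf : MDifferentiable 𝓘(ℂ) 𝓘(ℂ) f)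
    (h : ∃ z w, f z ≠ f w) : IsOpenMap f := by
  have han := (UpperHalfPlane.mdifferentiable_iff.mp hf).analyticOnNhd isOpen_upperHalfPlaneSet
  have hconn : IsPreconnected {z : ℂ | 0 < z.im} :=
    (Complex.isConnected_of_upperHalfPlane subset_rfl (by grind)).isPreconnected
  intro U hU
  rcases han.is_constant_or_isOpen hconn with ⟨c, hc⟩ | hopen
  · obtain ⟨z, w, hzw⟩ := h
    have hz := hc z z.im_pos
    have hw := hc w w.im_pos
    simp only [Function.comp_apply, ofComplex_apply] at hz hw
    exact absurd (hz.trans hw.symm) hzw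
  · have := hopen ((↑) '' U) (by rintro _ ⟨z, -, rfl⟩; exact z.im_pos)
      (isOpenEmbedding_coe.isOpenMap U hU)
    rw [Set.image_image] at this
    simpa using this

namespace ModularCurve

open HStar

variable {Γ : Subgroup SL(2, ℤ)}

/-- A continuous open function on an open part of `ℍ*` that separates exactly the orbits induces a
coordinate on `X(Γ)`. -/
theorem exists_openPartialHomeomorph {V : Set HStar} (hV : IsOpen V) {ψ : HStar → ℂ}
    (hc : ∀ p ∈ V, ContinuousAt ψ p) (ho : ∀ W ⊆ V, IsOpen W → IsOpen (ψ '' W))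
    (hinj : ∀ p ∈ V, ∀ q ∈ V, ψ p = ψ q ↔ (mk p : ModularCurve Γ) = mk q) :
    ∃ e : OpenPartialHomeomorph (ModularCurve Γ) ℂ, e.source = mk '' V ∧
      ∀ p ∈ V, e (mk p) = ψ p := by
  classical
  let E : ModularCurve Γ → ℂ := fun x => if h : ∃ p ∈ V, mk p = x then ψ h.choose else 0
  have hE : ∀ p ∈ V, E (mk p) = ψ p := by
    intro p hp
    have h : ∃ q ∈ V, (mk q : ModularCurve Γ) = mk p := ⟨p, hp, rfl⟩
    simp only [E, dif_pos h]
    exact (hinj _ h.choose_spec.1 _ hp).mpr h.choose_spec.2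
  have hEinj : Set.InjOn E (mk '' V) := by
    rintro _ ⟨p, hp, rfl⟩ _ ⟨q, hq, rfl⟩ h
    rw [hE p hp, hE q hq] at h
    exact (hinj p hp q hq).mp h
  have : Nonempty (ModularCurve Γ) := ⟨mk (cusp OnePoint.infty)⟩
  have hopen : IsOpen ((mk : HStar → ModularCurve Γ) '' V) :=
    isOpenQuotientMap_mk.isOpenMap V hV
  refine ⟨OpenPartialHomeomorph.ofContinuousOpenRestrict (hEinj.toPartialEquiv E (mk '' V)) ?_ ?_
    hopen, rfl, hE⟩
  · rintro _ ⟨p, hp, rfl⟩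
    refine ContinuousAt.continuousWithinAt ?_
    refine (isOpenQuotientMap_mk.continuousAt_comp_iff (g := E)).mp ((hc p hp).congr ?_)
    filter_upwards [hV.mem_nhds hp] with q hq
    exact (hE q hq).symm
  · rintro _ ⟨O, hO, rfl⟩
    have : ((mk '' V).domRestrict E) '' (Subtype.val ⁻¹' O) = ψ '' (V ∩ mk ⁻¹' O) := by
      ext c
      constructor
      · rintro ⟨⟨_, p, hp, rfl⟩, hpO, rfl⟩
        exact ⟨p, ⟨hp, hpO⟩, (hE p hp).symm⟩
      · rintro ⟨p, ⟨hp, hpO⟩, rfl⟩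
        exact ⟨⟨_, p, hp, rfl⟩, hpO, hE p hp⟩
    change IsOpen (((mk '' V).domRestrict E) '' (Subtype.val ⁻¹' O))
    rw [this]
    exact ho _ Set.inter_subset_left (hV.inter (hO.preimage continuous_mk))

/-- A chart `e` around `x` in the holomorphic atlas is a uniformizer at `x` if the projection
`ℍ → X(Γ)`, read in `e`, has nonvanishing derivative somewhere over each point other than `x`. -/
structure IsUniformizer (e : OpenPartialHomeomorph (ModularCurve Γ) ℂ) (x : ModularCurve Γ) :
    Prop where
  mem_atlas : e ∈ holomorphicAtlas Γ
  mem_source : x ∈ e.source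
  deriv_ne_zero : ∀ y ∈ e.source, y ≠ x → ∃ z : ℍ, mk (.point z) = y ∧
    deriv (fun w : ℂ => e (mk (.point (ofComplex w)))) z ≠ 0

/-- A coordinate induced by a holomorphic function `ψ` whose derivative vanishes at most at `p₀`
is a uniformizer at `[p₀]`. -/
theorem exists_isUniformizer {V : Set HStar} (hV : IsOpen V) {ψ : HStar → ℂ}
    (hc : ∀ p ∈ V, ContinuousAt ψ p) (ho : ∀ W ⊆ V, IsOpen W → IsOpen (ψ '' W))
    (hinj : ∀ p ∈ V, ∀ q ∈ V, ψ p = ψ q ↔ (mk p : ModularCurve Γ) = mk q) {p₀ : HStar}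
    (hp₀ : p₀ ∈ V) (hd : ∀ z : ℍ, point z ∈ V →
      DifferentiableAt ℂ (fun w : ℂ => ψ (point (ofComplex w))) z)
    (hd' : ∀ p ∈ V, p ≠ p₀ → ∃ z : ℍ, p = point z ∧
      deriv (fun w : ℂ => ψ (point (ofComplex w))) z ≠ 0) :
    ∃ e : OpenPartialHomeomorph (ModularCurve Γ) ℂ, IsUniformizer e (mk p₀) ∧
      ∀ p ∈ V, e (mk p) = ψ p := by
  obtain ⟨e, hes, heV⟩ := exists_openPartialHomeomorph hV hc ho hinj
  have hev : ∀ z : ℍ, point z ∈ V → (fun w : ℂ => e (mk (point (ofComplex w)))) =ᶠ[𝓝 (z : ℂ)]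
      fun w : ℂ => ψ (point (ofComplex w)) := by
    intro z hz
    rw [← isOpenEmbedding_coe.map_nhds_eq, EventuallyEq, eventually_map]
    filter_upwards [(hV.preimage continuous_point).mem_nhds hz] with w hw
    rw [ofComplex_apply]
    exact heV _ hw
  refine ⟨e, ⟨fun z hz => ?_, hes ▸ ⟨p₀, hp₀, rfl⟩, ?_⟩, heV⟩
  · rw [hes] at hz
    obtain ⟨p, hp, hpz⟩ := hz
    obtain ⟨γ, hγ, rfl⟩ := mk_eq_mk_iff.mp hpz
    rw [smul_point] at hp
    have h1 : MDifferentiableAt 𝓘(ℂ) 𝓘(ℂ) (fun w : ℍ => e (mk (.point w))) (γ • z) := by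
      rw [UpperHalfPlane.mdifferentiableAt_iff]
      exact (hd _ hp).congr_of_eventuallyEq (hev _ hp)
    have h2 : MDifferentiable 𝓘(ℂ) 𝓘(ℂ) (fun w : ℍ => γ • w) :=
      mdifferentiable_smul (g := Matrix.SpecialLinearGroup.mapGL ℝ γ) (by simp)
    refine (h1.comp z (h2 z)).congr_of_eventuallyEq (.of_forall fun w => ?_)
    change _ = e (mk (point (γ • w)))
    rw [← smul_point, mk_smul hγ]
  · rw [hes]
    rintro _ ⟨p, hp, rfl⟩ hne
    obtain ⟨z, rfl, hz⟩ := hd' p hp fun h => hne (h ▸ rfl)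
    exact ⟨z, rfl, by rwa [(hev z hp).deriv_eq]⟩

/-! ### Charts around points of the upper half plane -/

/-- The Cayley coordinate `(z - z₀) / (z - z̄₀)`, which vanishes at `z₀` only. -/
noncomputable def cayley (z₀ z : ℍ) : ℂ := (z - z₀) / (z - (starRingEnd ℂ) z₀)

theorem sub_conj_ne_zero (z₀ : ℍ) {w : ℂ} (hw : 0 < w.im) : w - (starRingEnd ℂ) z₀ ≠ 0 := by
  intro h
  have := congrArg Complex.im h
  simp at this
  linarith [z₀.im_pos]

theorem cayley_injective (z₀ : ℍ) : Function.Injective (cayley z₀) := by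
  intro z w h
  have hz := sub_conj_ne_zero z₀ z.im_pos
  have hw := sub_conj_ne_zero z₀ w.im_pos
  have h0 := sub_conj_ne_zero z₀ z₀.im_pos
  rw [cayley, cayley, div_eq_div_iff hz hw] at h
  apply UpperHalfPlane.ext
  have : (z₀ - (starRingEnd ℂ) (z₀ : ℂ)) * ((z : ℂ) - w) = 0 := by linear_combination h
  exact sub_eq_zero.mp ((mul_eq_zero.mp this).resolve_left h0)

theorem cayley_self (z₀ : ℍ) : cayley z₀ z₀ = 0 := by simp [cayley]

theorem cayley_eq_zero_iff {z₀ z : ℍ} : cayley z₀ z = 0 ↔ z = z₀ :=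
  ⟨fun h => cayley_injective z₀ (h.trans (cayley_self z₀).symm), fun h => h ▸ cayley_self z₀⟩

theorem hasDerivAt_cayley (z₀ z : ℍ) : HasDerivAt (fun w : ℂ => cayley z₀ (ofComplex w))
    ((z₀ - (starRingEnd ℂ) z₀) / (z - (starRingEnd ℂ) z₀) ^ 2) z := by
  have h : HasDerivAt (fun w : ℂ => (w - z₀) / (w - (starRingEnd ℂ) z₀))
      ((z₀ - (starRingEnd ℂ) z₀) / (z - (starRingEnd ℂ) z₀) ^ 2) z := by
    refine (((hasDerivAt_id' (z : ℂ)).sub_const (z₀ : ℂ)).fun_div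
      ((hasDerivAt_id' (z : ℂ)).sub_const ((starRingEnd ℂ) z₀))
      (sub_conj_ne_zero z₀ z.im_pos)).congr_deriv ?_
    congr 1
    ring
  refine h.congr_of_eventuallyEq ?_
  filter_upwards [isOpen_upperHalfPlaneSet.mem_nhds z.im_pos] with w hw
  rw [cayley, ofComplex_apply_of_im_pos hw]

/-- In the Cayley coordinate at `z₀`, the stabiliser of `z₀` acts by multiplication with
constants. -/
theorem exists_cayley_smul {z₀ : ℍ} {γ : SL(2, ℤ)} (h : γ • z₀ = z₀) :
    ∃ ζ : ℂ, ∀ z, cayley z₀ (γ • z) = ζ * cayley z₀ z := by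
  have hden : ∀ z : ℍ, ((γ 1 0 : ℤ) : ℂ) * z + (γ 1 1 : ℤ) ≠ 0 := fun z => by
    simpa [denom] using denom_ne_zero (Matrix.SpecialLinearGroup.mapGL ℝ γ) z
  have hcoe : ∀ z : ℍ, ((γ • z : ℍ) : ℂ) * (((γ 1 0 : ℤ) : ℂ) * z + (γ 1 1 : ℤ)) =
      ((γ 0 0 : ℤ) : ℂ) * z + (γ 0 1 : ℤ) := by
    intro z
    rw [coe_specialLinearGroup_apply]
    simp only [algebraMap_int_eq, eq_intCast, Complex.ofReal_intCast]
    exact div_mul_cancel₀ _ (hden z)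
  have h0 := hcoe z₀
  rw [h] at h0
  have h1 := congrArg (starRingEnd ℂ) h0
  simp only [map_add, map_mul, map_intCast] at h1
  have hdet : ((γ 0 0 : ℤ) : ℂ) * (γ 1 1 : ℤ) - (γ 0 1 : ℤ) * (γ 1 0 : ℤ) = 1 := by
    have : γ 0 0 * γ 1 1 - γ 0 1 * γ 1 0 = 1 := by
      rw [← Matrix.det_fin_two]; exact γ.det_coe
    exact_mod_cast this
  have hne : ((γ 0 0 : ℤ) : ℂ) - (γ 1 0 : ℤ) * (starRingEnd ℂ) (z₀ : ℂ) ≠ 0 := by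
    intro h2
    have : (((γ 0 0 : ℤ) : ℂ) - (γ 1 0 : ℤ) * (starRingEnd ℂ) (z₀ : ℂ)) *
      (((γ 1 0 : ℤ) : ℂ) * (starRingEnd ℂ) (z₀ : ℂ) + (γ 1 1 : ℤ)) = 1 := by
        linear_combination hdet - (γ 1 0 : ℂ) * h1
    rw [h2, zero_mul] at this
    exact zero_ne_one this
  refine ⟨(((γ 0 0 : ℤ) : ℂ) - (γ 1 0 : ℤ) * z₀) /
    (((γ 0 0 : ℤ) : ℂ) - (γ 1 0 : ℤ) * (starRingEnd ℂ) (z₀ : ℂ)), fun z => ?_⟩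
  have hz := sub_conj_ne_zero z₀ z.im_pos
  have hz' := sub_conj_ne_zero z₀ (γ • z).im_pos
  rw [cayley, cayley, div_mul_div_comm, div_eq_div_iff hz' (mul_ne_zero hne hz)]
  apply mul_right_cancel₀ (hden z)
  have h2 := hcoe z
  generalize ((γ • z : ℍ) : ℂ) = u at h2
  generalize (starRingEnd ℂ) (z₀ : ℂ) = v at h1 ⊢
  generalize (z₀ : ℂ) = x at h0 ⊢
  generalize (z : ℂ) = y at h2 ⊢
  generalize ((γ 0 0 : ℤ) : ℂ) = a at *
  generalize ((γ 0 1 : ℤ) : ℂ) = b at *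
  generalize ((γ 1 0 : ℤ) : ℂ) = c at *
  generalize ((γ 1 1 : ℤ) : ℂ) = d at *
  have e1 : (u - x) * (c * y + d) = (a - c * x) * (y - x) := by linear_combination h2 - h0
  have e2 : (u - v) * (c * y + d) = (a - c * v) * (y - v) := by linear_combination h2 - h1
  linear_combination (a - c * v) * (y - v) * e1 - (a - c * x) * (y - x) * e2

/-- Around `[z₀]`, the `k`-th power of the Cayley coordinate is a coordinate, where `k` is the order
of the group of rotations by which the stabiliser of `z₀` acts. -/
theorem exists_isUniformizer_point (z₀ : ℍ) :
    ∃ e : OpenPartialHomeomorph (ModularCurve Γ) ℂ, IsUniformizer e (mk (point z₀)) := by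
  -- the rotations by which the stabiliser of `z₀` acts in the Cayley coordinate
  let G : Subgroup ℂˣ :=
    { carrier := {u | ∃ γ ∈ Γ, γ • z₀ = z₀ ∧ ∀ z, cayley z₀ (γ • z) = u * cayley z₀ z}
      mul_mem' := by
        rintro u v ⟨γ, hγ, hγ0, hu⟩ ⟨δ, hδ, hδ0, hv⟩
        refine ⟨γ * δ, Γ.mul_mem hγ hδ, by rw [mul_smul, hδ0, hγ0], fun z => ?_⟩
        rw [mul_smul, hu, hv, Units.val_mul, mul_assoc]
      one_mem' := ⟨1, Γ.one_mem, one_smul _ _, fun z => by simp⟩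
      inv_mem' := by
        rintro u ⟨γ, hγ, hγ0, hu⟩
        refine ⟨γ⁻¹, Γ.inv_mem hγ, by rw [inv_smul_eq_iff, hγ0], fun z => ?_⟩
        have := hu (γ⁻¹ • z)
        rw [smul_inv_smul] at this
        rw [this, Units.inv_mul_cancel_left] }
  obtain ⟨z₁, hz₁⟩ : ∃ z₁ : ℍ, z₁ ≠ z₀ := exists_ne z₀
  have hz₁' : cayley z₀ z₁ ≠ 0 := fun h => hz₁ (cayley_eq_zero_iff.mp h)
  have hGmem : ∀ γ ∈ Γ, γ • z₀ = z₀ → ∃ u ∈ G, ∀ z, cayley z₀ (γ • z) = u * cayley z₀ z := by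
    intro γ hγ h0
    obtain ⟨ζ, hζ⟩ := exists_cayley_smul h0
    have hζ0 : ζ ≠ 0 := by
      rintro rfl
      have := hζ z₁
      rw [zero_mul, cayley_eq_zero_iff] at this
      exact hz₁ (smul_left_cancel γ (this.trans h0.symm))
    exact ⟨Units.mk0 ζ hζ0, ⟨γ, hγ, h0, hζ⟩, hζ⟩
  have hfin : Finite G := by
    have := (finite_setOf_smul_eq_self z₀).to_subtype
    choose! F hF using fun u : G => u.2
    refine Finite.of_injective (fun u : G => (⟨F u, (hF u).2.1⟩ : {γ : SL(2, ℤ) | γ • z₀ = z₀})) ?_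
    intro u v huv
    have huv' : F u = F v := congrArg Subtype.val huv
    have h1 := (hF u).2.2 z₁
    rw [huv', (hF v).2.2 z₁] at h1
    exact Subtype.ext (Units.ext (mul_right_cancel₀ hz₁' h1)).symm
  set k := Nat.card G with hk
  have hk0 : k ≠ 0 := Nat.card_pos.ne'
  have : NeZero k := ⟨hk0⟩
  have hG : G = rootsOfUnity k ℂ := by
    refine Subgroup.eq_of_le_of_card_ge (fun u hu => ?_) (card_rootsOfUnity ℂ k)
    rw [mem_rootsOfUnity]
    have := pow_card_eq_one' (x := (⟨u, hu⟩ : G))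
    exact congrArg Subtype.val this
  obtain ⟨U₀, hU₀, hstab⟩ := exists_nhds_smul_eq_self z₀
  obtain ⟨U, hUU₀, hU, hz₀U⟩ := mem_nhds_iff.mp hU₀
  -- the coordinate at `[z₀]` is the `k`-th power of the Cayley coordinate
  let φ : ℍ → ℂ := fun z => cayley z₀ z ^ k
  have hφd : ∀ z : ℍ, HasDerivAt (fun w : ℂ => φ (ofComplex w)) (k * cayley z₀ z ^ (k - 1) *
      ((z₀ - (starRingEnd ℂ) z₀) / (z - (starRingEnd ℂ) z₀) ^ 2)) z := by
    intro z
    simpa using! (hasDerivAt_cayley z₀ z).pow k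
  have hφm : MDifferentiable 𝓘(ℂ) 𝓘(ℂ) φ := fun z =>
    UpperHalfPlane.mdifferentiableAt_iff.mpr (hφd z).differentiableAt
  have hφo : IsOpenMap φ := isOpenMap_of_mdifferentiable hφm ⟨z₁, z₀, by
    simp only [φ, cayley_self, zero_pow hk0]
    exact pow_ne_zero _ hz₁'⟩
  let ψ : HStar → ℂ
    | point z => φ z
    | cusp _ => 0
  refine (exists_isUniformizer (Γ := Γ) (V := point '' U) (isOpenMap_point U hU)
    (ψ := ψ) ?_ ?_ ?_ (p₀ := point z₀) ⟨z₀, hz₀U, rfl⟩ ?_ ?_).imp fun e he => he.1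
  · rintro _ ⟨z, -, rfl⟩
    exact continuousAt_point_iff.mpr (hφm.continuous.continuousAt)
  · intro W hW hWo
    have : ψ '' W = φ '' (point ⁻¹' W) := by
      ext c
      constructor
      · rintro ⟨p, hp, rfl⟩
        obtain ⟨z, -, rfl⟩ := hW hp
        exact ⟨z, hp, rfl⟩
      · rintro ⟨z, hz, rfl⟩
        exact ⟨point z, hz, rfl⟩
    rw [this]
    exact hφo _ (hWo.preimage continuous_point)
  · rintro _ ⟨z, hz, rfl⟩ _ ⟨w, hw, rfl⟩
    change cayley z₀ z ^ k = cayley z₀ w ^ k ↔ _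
    constructor
    · intro h
      by_cases hw0 : cayley z₀ w = 0
      · rw [hw0, zero_pow hk0, pow_eq_zero_iff hk0] at h
        rw [cayley_eq_zero_iff.mp h, cayley_eq_zero_iff.mp hw0]
      · have hz0 : cayley z₀ z ≠ 0 := by
          intro h0
          rw [h0, zero_pow hk0] at h
          exact hw0 (pow_eq_zero_iff hk0 |>.mp h.symm)
        have hu : Units.mk0 _ (div_ne_zero hz0 hw0) ∈ G := by
          rw [hG, mem_rootsOfUnity]
          apply Units.ext
          rw [Units.val_pow_eq_pow_val, Units.val_mk0, div_pow, h, div_self (pow_ne_zero _ hw0),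
            Units.val_one]
        obtain ⟨γ, hγ, -, hu⟩ := hu
        refine mk_eq_mk_iff.mpr ⟨γ, hγ, ?_⟩
        rw [smul_point]
        congr 1
        apply cayley_injective z₀
        rw [hu, Units.val_mk0, div_mul_cancel₀ _ hw0]
    · intro h
      obtain ⟨γ, hγ, hγw⟩ := mk_eq_mk_iff.mp h
      rw [smul_point] at hγw
      have hγw := injective_point hγw
      have h0 := hstab γ w (hUU₀ hw) (hγw ▸ hUU₀ hz)
      obtain ⟨u, hu, hu'⟩ := hGmem γ hγ h0
      rw [hG, mem_rootsOfUnity] at hu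
      have hu1 : (u : ℂ) ^ k = 1 := by rw [← Units.val_pow_eq_pow_val, hu, Units.val_one]
      rw [← hγw, hu', mul_pow, hu1, one_mul]
  · intro z _
    exact (hφd z).differentiableAt
  · rintro _ ⟨z, hz, rfl⟩ hne
    refine ⟨z, rfl, ?_⟩
    change deriv (fun w : ℂ => φ (ofComplex w)) z ≠ 0
    rw [(hφd z).deriv]
    refine mul_ne_zero (mul_ne_zero (Nat.cast_ne_zero.mpr hk0) (pow_ne_zero _ fun h => ?_))
      (div_ne_zero (sub_conj_ne_zero z₀ z₀.im_pos) (pow_ne_zero _ (sub_conj_ne_zero z₀ z.im_pos)))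
    exact hne (congrArg point (cayley_eq_zero_iff.mp h))

end ModularCurve

namespace ModularCurve

open HStar

variable {Γ : Subgroup SL(2, ℤ)}

/-! ### Charts around the cusps -/

/-- The width of the cusp `σ ∞`: the translations in `σ⁻¹ (± Γ) σ` are the powers of `T ^ h`. -/
theorem exists_cusp_width [Γ.FiniteIndex] (σ : SL(2, ℤ)) : ∃ h : ℕ, h ≠ 0 ∧ ∀ n : ℤ,
    (∃ γ ∈ Γ, ∀ z : ℍ, γ • σ • z = σ • ModularGroup.T ^ n • z) ↔ (h : ℤ) ∣ n := by
  let H : AddSubgroup ℤ :=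
    { carrier := {n | ∃ γ ∈ Γ, ∀ z : ℍ, γ • σ • z = σ • ModularGroup.T ^ n • z}
      zero_mem' := ⟨1, Γ.one_mem, fun z => by simp⟩
      add_mem' := by
        rintro m n ⟨γ, hγ, h⟩ ⟨δ, hδ, h'⟩
        refine ⟨γ * δ, Γ.mul_mem hγ hδ, fun z => ?_⟩
        rw [mul_smul, h', h, zpow_add, mul_smul]
      neg_mem' := by
        rintro n ⟨γ, hγ, h⟩
        refine ⟨γ⁻¹, Γ.inv_mem hγ, fun z => ?_⟩
        rw [inv_smul_eq_iff, h, ← mul_smul (ModularGroup.T ^ n), zpow_neg, mul_inv_cancel,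
          one_smul] }
  obtain ⟨a, ha⟩ := Int.subgroup_cyclic H
  obtain ⟨m, hm0, -, hm⟩ := Subgroup.exists_pow_mem_of_index_ne_zero
    (Subgroup.FiniteIndex.index_ne_zero (H := Γ)) (σ * ModularGroup.T * σ⁻¹)
  have hmH : (m : ℤ) ∈ H := by
    refine ⟨_, hm, fun z => ?_⟩
    rw [conj_pow, ← mul_smul, inv_mul_cancel_right, mul_smul, zpow_natCast]
  have hmem : ∀ n, n ∈ H ↔ a ∣ n := fun n => by
    rw [ha, AddSubgroup.mem_closure_singleton]
    simp only [smul_eq_mul]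
    exact ⟨fun ⟨k, hk⟩ => ⟨k, by rw [← hk, mul_comm]⟩, fun ⟨k, hk⟩ => ⟨k, by rw [hk, mul_comm]⟩⟩
  refine ⟨a.natAbs, ?_, fun n => ?_⟩
  · rw [Int.natAbs_ne_zero]
    rintro rfl
    have := (hmem m).mp hmH
    rw [zero_dvd_iff] at this
    omega
  · rw [Int.natAbs_dvd, ← hmem]
    rfl

theorem det_mapGL_pos (γ : SL(2, ℤ)) :
    0 < (Matrix.SpecialLinearGroup.mapGL ℝ γ).val.det := by
  rw [← Matrix.GeneralLinearGroup.val_det_apply]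
  simp

theorem hasDerivAt_qParam (h : ℝ) (z : ℂ) : HasDerivAt (Function.Periodic.qParam h)
    (Function.Periodic.qParam h z * (2 * Real.pi * Complex.I / h)) z := by
  have h1 : HasDerivAt (fun w : ℂ => 2 * Real.pi * Complex.I * w / h)
      (2 * Real.pi * Complex.I / h) z := by
    simpa using ((hasDerivAt_id' z).const_mul (2 * Real.pi * Complex.I)).div_const (h : ℂ)
  exact h1.cexp

/-- Around the cusp `σ ∞` of width `h`, the function `σ z ↦ exp (2 π i z / h)` is a coordinate. -/
theorem exists_isUniformizer_cusp [Γ.FiniteIndex] (σ : SL(2, ℤ)) :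
    ∃ (e : OpenPartialHomeomorph (ModularCurve Γ) ℂ) (h : ℕ), h ≠ 0 ∧
      IsUniformizer e (mk (σ • cusp OnePoint.infty)) ∧ e (mk (σ • cusp OnePoint.infty)) = 0 ∧
      ∀ z : ℍ, 1 < z.im → e (mk (σ • point z)) = Function.Periodic.qParam h z := by
  obtain ⟨h, hh, hdvd⟩ := exists_cusp_width (Γ := Γ) σ
  have hhR : (0 : ℝ) < h := Nat.cast_pos.mpr (Nat.pos_of_ne_zero hh)
  have hhC : (h : ℂ) ≠ 0 := Nat.cast_ne_zero.mpr hh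
  let q : ℍ → ℂ := fun z => Function.Periodic.qParam h z
  have hqc : Continuous q := Function.Periodic.continuous_qParam.comp continuous_coe
  have hqo : IsOpenMap q := by
    refine isOpenMap_of_mdifferentiable (fun z => ?_) ?_
    · rw [UpperHalfPlane.mdifferentiableAt_iff]
      refine (hasDerivAt_qParam h z).differentiableAt.congr_of_eventuallyEq ?_
      filter_upwards [isOpen_upperHalfPlaneSet.mem_nhds z.im_pos] with w hw
      simp only [Function.comp_apply, q, ofComplex_apply_of_im_pos hw]
    · refine ⟨⟨Complex.I, by simp⟩, ⟨2 * Complex.I, by simp⟩, fun heq => ?_⟩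
      have := congrArg norm heq
      simp only [q, Function.Periodic.norm_qParam, Real.exp_eq_exp] at this
      simp at this
      field_simp at this
      norm_num at this
  have hq0 : ∀ z, q z ≠ 0 := fun z => Function.Periodic.qParam_ne_zero _
  let ψ₀ : HStar → ℂ
    | point z => q z
    | cusp _ => 0
  let ψ : HStar → ℂ := fun p => ψ₀ (σ⁻¹ • p)
  have hψz : ∀ z, ψ (σ • point z) = q z := fun z => by simp only [ψ, inv_smul_smul]; rfl
  have hψc : ψ (σ • cusp OnePoint.infty) = 0 := by simp only [ψ, inv_smul_smul]; rfl
  have hψd : ∀ z : ℍ, HasDerivAt (fun w : ℂ => ψ (point (ofComplex w)))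
      (Function.Periodic.qParam h (σ⁻¹ • z : ℍ) * (2 * Real.pi * Complex.I / (h : ℝ)) *
        deriv (fun w ↦ ↑(Matrix.SpecialLinearGroup.mapGL ℝ σ⁻¹ • ofComplex w) : ℂ → ℂ) z) z := by
    intro z
    have h2 := (hasStrictDerivAt_smul (det_mapGL_pos σ⁻¹) z).hasDerivAt.differentiableAt.hasDerivAt
    have h1 := hasDerivAt_qParam h (Matrix.SpecialLinearGroup.mapGL ℝ σ⁻¹ • ofComplex (z : ℂ) : ℍ)
    have := h1.comp (z : ℂ) h2
    rw [ofComplex_apply] at this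
    exact this
  obtain ⟨e, he, heV⟩ : ∃ e : OpenPartialHomeomorph (ModularCurve Γ) ℂ,
      IsUniformizer e (mk (σ • cusp OnePoint.infty)) ∧ ∀ p ∈ horoball σ 1, e (mk p) = ψ p := by
    refine exists_isUniformizer (isOpen_horoball σ 1) ?_ ?_ ?_ (smul_cusp_mem_horoball σ 1) ?_ ?_
    · rintro _ (rfl | ⟨z, -, rfl⟩)
      · rw [continuousAt_smul_cusp_iff, hψc]
        exact (qParam_tendsto_atImInfty hhR).congr fun z => (hψz z).symm
      · refine continuousAt_point_iff.mpr (Continuous.continuousAt ?_)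
        exact hqc.comp (continuous_const_smul σ⁻¹)
    · intro W hW hWo
      rw [isOpen_iff_mem_nhds]
      rintro _ ⟨p, hp, rfl⟩
      rcases hW hp with rfl | ⟨z, hz, rfl⟩
      · obtain ⟨C, hC⟩ := mem_nhds_smul_cusp_iff.mp (hWo.mem_nhds hp)
        rw [hψc]
        refine mem_of_superset
          (Metric.ball_mem_nhds 0 (Real.exp_pos (-2 * Real.pi * max C 0 / h))) fun c hc => ?_
        by_cases hc0 : c = 0
        · exact ⟨_, hp, hψc.trans hc0.symm⟩
        · have hqr := Function.Periodic.qParam_right_inv hhR.ne' hc0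
          rw [mem_ball_zero_iff, ← hqr] at hc
          have him := (Function.Periodic.norm_qParam_lt_iff hhR _ _).mp hc
          refine ⟨σ • point ⟨Function.Periodic.invQParam h c, (le_max_right C 0).trans_lt him⟩,
            hC (smul_point_mem_horoball.mpr ((le_max_left C 0).trans_lt him)), ?_⟩
          rw [hψz]
          exact hqr
      · have h1 : IsOpen (q '' ((fun w => σ • point w) ⁻¹' W)) := hqo _
          (hWo.preimage ((continuous_const_smul σ).comp continuous_point))
        rw [hψz]
        refine mem_of_superset (h1.mem_nhds ⟨z, hp, rfl⟩) ?_
        rintro _ ⟨w, hw, rfl⟩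
        exact ⟨_, hw, hψz w⟩
    · have hne : ∀ z : ℍ, (mk (σ • cusp OnePoint.infty) : ModularCurve Γ) ≠ mk (σ • point z) := by
        intro z heq
        obtain ⟨γ, -, h⟩ := mk_eq_mk_iff.mp heq
        simp [smul_point, smul_cusp] at h
      rintro _ (rfl | ⟨z, hz, rfl⟩) _ (rfl | ⟨w, hw, rfl⟩)
      · simp
      · rw [hψc, hψz]
        exact iff_of_false (hq0 w).symm (hne w)
      · rw [hψc, hψz]
        exact iff_of_false (hq0 z) (hne z).symm
      · rw [hψz, hψz]
        have hqT : q z = q w ↔ ∃ n : ℤ, (h : ℤ) ∣ n ∧ z = ModularGroup.T ^ n • w := by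
          simp only [q, Function.Periodic.qParam, Complex.exp_eq_exp_iff_exists_int]
          have h2pi : (2 * Real.pi * Complex.I : ℂ) ≠ 0 := Complex.two_pi_I_ne_zero
          constructor
          · rintro ⟨n, hn⟩
            refine ⟨h * n, ⟨n, rfl⟩, UpperHalfPlane.ext ?_⟩
            rw [ModularGroup.coe_T_zpow_smul_eq]
            push_cast at hn ⊢
            field_simp at hn
            linear_combination hn
          · rintro ⟨_, ⟨n, rfl⟩, rfl⟩
            refine ⟨n, ?_⟩
            rw [ModularGroup.coe_T_zpow_smul_eq]
            push_cast
            field_simp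
        rw [hqT, mk_eq_mk_iff]
        constructor
        · rintro ⟨n, hn, rfl⟩
          obtain ⟨γ, hγ, h⟩ := (hdvd n).mpr hn
          exact ⟨γ, hγ, congrArg point (h w)⟩
        · rintro ⟨γ, hγ, hγw⟩
          have h1 : (σ⁻¹ * (γ * σ)) • w = z := by
            rw [mul_smul, mul_smul, inv_smul_eq_iff]
            exact injective_point hγw
          have hc := c_eq_zero_of_one_lt_im hw (h1 ▸ hz)
          obtain ⟨n, hn⟩ := ModularGroup.exists_eq_T_zpow_of_c_eq_zero hc
          refine ⟨n, (hdvd n).mp ⟨γ, hγ, fun u => ?_⟩, ?_⟩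
          · rw [← hn, mul_smul, mul_smul, smul_inv_smul]
          · rw [← hn, h1]
    · exact fun z _ => (hψd z).differentiableAt
    · rintro _ (rfl | ⟨z, -, rfl⟩) hne
      · exact absurd rfl hne
      · refine ⟨σ • z, rfl, ?_⟩
        rw [(hψd _).deriv]
        refine mul_ne_zero (mul_ne_zero (Function.Periodic.qParam_ne_zero _)
          (div_ne_zero Complex.two_pi_I_ne_zero (Complex.ofReal_ne_zero.mpr hhR.ne')))
          (deriv_smul_ne_zero (det_mapGL_pos σ⁻¹) _)
  refine ⟨e, h, hh, he, ?_, fun z hz => ?_⟩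
  · rw [heV _ (smul_cusp_mem_horoball σ 1), hψc]
  · rw [heV _ (smul_point_mem_horoball.mpr hz), hψz]

theorem exists_isUniformizer_at [Γ.FiniteIndex] (x : ModularCurve Γ) :
    ∃ e : OpenPartialHomeomorph (ModularCurve Γ) ℂ, IsUniformizer e x := by
  obtain ⟨p, rfl⟩ := isOpenQuotientMap_mk.surjective x
  rcases p with z | c
  · exact exists_isUniformizer_point z
  · obtain ⟨σ, hσ⟩ := exists_smul_cusp_infty c
    rw [← hσ]
    obtain ⟨e, -, -, he, -⟩ := exists_isUniformizer_cusp (Γ := Γ) σ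
    exact ⟨e, he⟩

/-! ### Holomorphic functions on `X(Γ)` -/

/-- A continuous function on an open part of `X(Γ)` which is holomorphic as a function on `ℍ` is
holomorphic in each uniformizer `e` around `x`: away from `x` the inverse of `e` lifts to a
holomorphic map into `ℍ`, and at `x` the singularity is removable. -/
theorem differentiableAt_comp_symm_of_isUniformizer {e : OpenPartialHomeomorph (ModularCurve Γ) ℂ}
    {x : ModularCurve Γ} (he : IsUniformizer e x) {V : Set (ModularCurve Γ)} (hV : IsOpen V)
    {G : ModularCurve Γ → ℂ} (hG : ContinuousOn G V)
    (hG' : ∀ z : ℍ, mk (.point z) ∈ V →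
      MDifferentiableAt 𝓘(ℂ) 𝓘(ℂ) (fun w : ℍ => G (mk (.point w))) z)
    {y : ModularCurve Γ} (hy : y ∈ V) (hye : y ∈ e.source) :
    DifferentiableAt ℂ (G ∘ e.symm) (e y) := by
  have hreg : ∀ y ∈ V, y ∈ e.source → y ≠ x → DifferentiableAt ℂ (G ∘ e.symm) (e y) := by
    intro y hy hye hyx
    obtain ⟨z, rfl, hz⟩ := he.deriv_ne_zero y hye hyx
    set u : ℂ → ℂ := fun w => e (mk (.point (ofComplex w))) with hu
    have huz : u z = e (mk (.point z)) := by simp only [hu, ofComplex_apply]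
    have hπ : ContinuousAt (fun w : ℂ => (mk (.point (ofComplex w)) : ModularCurve Γ)) z := by
      refine (continuous_mk.comp continuous_point).continuousAt.comp ?_
      exact (mdifferentiableAt_ofComplex z.im_pos).continuousAt
    have hsrc : ∀ᶠ w in 𝓝 (z : ℂ), mk (.point (ofComplex w)) ∈ e.source := by
      refine hπ.eventually_mem (e.open_source.mem_nhds ?_)
      rwa [ofComplex_apply]
    have hud : ∀ᶠ w in 𝓝 (z : ℂ), DifferentiableAt ℂ u w := by
      filter_upwards [hsrc, isOpen_upperHalfPlaneSet.mem_nhds z.im_pos] with w hw hw'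
      have h1 := he.mem_atlas (ofComplex w) hw
      rw [UpperHalfPlane.mdifferentiableAt_iff, ofComplex_apply_of_im_pos hw'] at h1
      exact h1
    have hstrict : HasStrictDerivAt u (deriv u z) z :=
      (Complex.analyticAt_iff_eventually_differentiableAt.mpr hud).hasStrictDerivAt
    set v := hstrict.localInverse u _ _ hz with hv
    have hvd : HasStrictDerivAt v (deriv u z)⁻¹ (u z) := hstrict.to_localInverse hz
    have hvz : v (u z) = z := HasStrictFDerivAt.localInverse_apply_image
      (hstrict.hasStrictFDerivAt_equiv hz)
    have huv : ∀ᶠ c in 𝓝 (u z), u (v c) = c := HasStrictFDerivAt.eventually_right_inverse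
      (hstrict.hasStrictFDerivAt_equiv hz)
    have hvc : Tendsto v (𝓝 (u z)) (𝓝 z) := by
      have := hvd.hasDerivAt.continuousAt.tendsto
      rwa [hvz] at this
    rw [← huz]
    have hGd : DifferentiableAt ℂ (fun w : ℂ => G (mk (.point (ofComplex w)))) (v (u z)) := by
      rw [hvz]
      exact UpperHalfPlane.mdifferentiableAt_iff.mp (hG' z hy)
    refine (hGd.comp _ hvd.hasDerivAt.differentiableAt).congr_of_eventuallyEq ?_
    filter_upwards [huv, hvc.eventually hsrc] with c hc hcs
    change G (e.symm c) = G (mk (.point (ofComplex (v c))))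
    rw [← e.left_inv hcs]
    exact congrArg (fun a => G (e.symm a)) hc.symm
  by_cases hyx : y = x
  swap
  · exact hreg y hy hye hyx
  refine (Complex.analyticAt_of_differentiable_on_punctured_nhds_of_continuousAt ?_
    ?_).differentiableAt
  · have h1 : ∀ᶠ c in 𝓝 (e y), c ∈ e.target ∧ e.symm c ∈ V := by
      refine (e.open_target.eventually_mem (e.map_source hye)).and ?_
      refine (e.symm.continuousAt (e.map_source hye)).eventually_mem (hV.mem_nhds ?_)
      rwa [e.left_inv hye]
    filter_upwards [mem_nhdsWithin_of_mem_nhds h1, self_mem_nhdsWithin] with c hc hcy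
    have h2 := hreg (e.symm c) hc.2 (e.map_target hc.1) fun h => hcy ?_
    · rwa [e.right_inv hc.1] at h2
    · rw [Set.mem_singleton_iff, hyx, ← h, e.right_inv hc.1]
  · refine ContinuousAt.comp ?_ (e.symm.continuousAt (e.map_source hye))
    rw [e.left_inv hye]
    exact hG.continuousAt (hV.mem_nhds hy)

theorem differentiableOn_transition {x : ModularCurve Γ}
    {s e : OpenPartialHomeomorph (ModularCurve Γ) ℂ} (hs : IsUniformizer s x)
    (he : e ∈ holomorphicAtlas Γ) :
    DifferentiableOn ℂ (s.symm.trans e) (s.symm.trans e).source := by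
  intro c hc
  have h1 : c ∈ s.target := hc.1
  have h2 : s.symm c ∈ e.source := hc.2
  have := differentiableAt_comp_symm_of_isUniformizer hs e.open_source e.continuousOn he h2
    (s.map_target h1)
  rw [s.right_inv h1] at this
  exact this.differentiableWithinAt

/-- The charts of the holomorphic atlas are compatible: both are holomorphic in a uniformizer, and
the inverse of a holomorphic change of coordinates is holomorphic. -/
theorem contDiffOn_transition [Γ.FiniteIndex]
    {e e' : OpenPartialHomeomorph (ModularCurve Γ) ℂ} (he : e ∈ holomorphicAtlas Γ)
    (he' : e' ∈ holomorphicAtlas Γ) :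
    ContDiffOn ℂ ω (e.symm.trans e') (e.symm.trans e').source := by
  have hd : DifferentiableOn ℂ (e.symm.trans e') (e.symm.trans e').source := by
    intro c hc
    have hct : c ∈ e.target := hc.1
    have hcs : e.symm c ∈ e'.source := hc.2
    obtain ⟨s, hs⟩ := exists_isUniformizer_at (e.symm c)
    -- factor through a uniformizer `s` at the point in question
    have h1 := (s.symm.trans e).differentiableOn_symm (differentiableOn_transition hs he)
    have h2 := differentiableOn_transition hs he'
    have hc1 : c ∈ (s.symm.trans e).target := by
      simp only [OpenPartialHomeomorph.trans_target, OpenPartialHomeomorph.symm_target]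
      exact ⟨hct, hs.mem_source⟩
    have hc2 : s (e.symm c) ∈ (s.symm.trans e').source := by
      refine ⟨s.map_source hs.mem_source, ?_⟩
      change s.symm (s (e.symm c)) ∈ e'.source
      rwa [s.left_inv hs.mem_source]
    have h3 : DifferentiableAt ℂ (s.symm.trans e').toFun ((s.symm.trans e).symm c) :=
      h2.differentiableAt ((s.symm.trans e').open_source.mem_nhds hc2)
    have h4 : DifferentiableAt ℂ (s.symm.trans e).symm c :=
      h1.differentiableAt ((s.symm.trans e).open_target.mem_nhds hc1)
    refine ((h3.comp c h4).congr_of_eventuallyEq ?_).differentiableWithinAt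
    filter_upwards [(s.symm.trans e).open_target.mem_nhds hc1] with a ha
    simp only [OpenPartialHomeomorph.trans_target, OpenPartialHomeomorph.symm_target] at ha
    change e' (e.symm a) = e' (s.symm (s (e.symm a)))
    rw [s.left_inv ha.2]
  exact (hd.analyticOnNhd (e.symm.trans e').open_source).contDiffOn
    (e.symm.trans e').open_source.uniqueDiffOn

/-- The chart at `x` is a chosen uniformizer at `x`. -/
noncomputable scoped instance [Γ.FiniteIndex] : ChartedSpace ℂ (ModularCurve Γ) where
  atlas := holomorphicAtlas Γ
  chartAt x := (exists_isUniformizer_at x).choose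
  mem_chart_source x := (exists_isUniformizer_at x).choose_spec.mem_source
  chart_mem_atlas x := (exists_isUniformizer_at x).choose_spec.mem_atlas

theorem isUniformizer_chartAt [Γ.FiniteIndex] (x : ModularCurve Γ) :
    IsUniformizer (chartAt ℂ x) x :=
  (exists_isUniformizer_at x).choose_spec

scoped instance [Γ.FiniteIndex] : IsManifold 𝓘(ℂ) ω (ModularCurve Γ) :=
  isManifold_of_contDiffOn _ _ _ fun e e' he he' => by
    simpa using! contDiffOn_transition he he'

noncomputable scoped instance riemannSurface [Γ.FiniteIndex] : RiemannSurface (ModularCurve Γ) where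

/-- The projection `ℍ → X(Γ)` is holomorphic. -/
theorem mdifferentiable_mk_point [Γ.FiniteIndex] :
    MDifferentiable 𝓘(ℂ) 𝓘(ℂ) (fun z : ℍ => (mk (.point z) : ModularCurve Γ)) := by
  intro z
  rw [mdifferentiableAt_iff_target]
  refine ⟨(continuous_mk.comp continuous_point).continuousAt, ?_⟩
  simpa using! (isUniformizer_chartAt (Γ := Γ) (mk (.point z))).mem_atlas z
    (mem_chart_source ℂ (mk (.point z) : ModularCurve Γ))

/-- A continuous map on `X(Γ)` is holomorphic if its lift to `ℍ` is. -/
theorem mdifferentiable_of_comp_mk [Γ.FiniteIndex] {M : Type*} [TopologicalSpace M]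
    [ChartedSpace ℂ M] [IsManifold 𝓘(ℂ) ω M] {F : ModularCurve Γ → M} (hF : Continuous F)
    (hF' : MDifferentiable 𝓘(ℂ) 𝓘(ℂ) (fun z : ℍ => F (mk (.point z)))) :
    MDifferentiable 𝓘(ℂ) 𝓘(ℂ) F := by
  intro x
  rw [_root_.mdifferentiableAt_iff]
  refine ⟨hF.continuousAt, ?_⟩
  have h := differentiableAt_comp_symm_of_isUniformizer (isUniformizer_chartAt x)
    (V := F ⁻¹' (chartAt ℂ (F x)).source) ((chartAt ℂ (F x)).open_source.preimage hF)
    (G := chartAt ℂ (F x) ∘ F)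
    ((chartAt ℂ (F x)).continuousOn.comp hF.continuousOn fun _ h => h) (fun z hz => ?_)
    (mem_chart_source ℂ (F x)) (mem_chart_source ℂ x)
  · simpa [writtenInExtChartAt, Function.comp_def] using! h.differentiableWithinAt
  · have h1 : MDifferentiableAt 𝓘(ℂ) 𝓘(ℂ) (chartAt ℂ (F x)) (F (mk (.point z))) :=
      mdifferentiableAt_atlas (chart_mem_atlas ℂ (F x)) hz
    exact h1.comp z (hF' z)

end ModularCurve

/-! ### The `j`-function -/

namespace ModularForm

/-- A holomorphic function which is invariant of weight `k` under `SL(2, ℤ)` and bounded at `i∞`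
is a modular form of level one. -/
theorem exists_coe_eq {k : ℤ} {f : ℍ → ℂ} (hf : MDifferentiable 𝓘(ℂ) 𝓘(ℂ) f)
    (hk : ∀ γ : SL(2, ℤ), f ∣[k] γ = f) (hb : IsBoundedAtImInfty f) :
    ∃ F : ModularForm 𝒮ℒ k, ⇑F = f :=
  ⟨{ toFun := f
     slash_action_eq' := fun _ ⟨γ, hγ⟩ => hγ ▸ hk γ
     holo' := hf
     bdd_at_cusps' := fun {c} hc => by
      rw [Subgroup.IsArithmetic.isCusp_iff_isCusp_SL2Z] at hc
      rw [OnePoint.isBoundedAt_iff_forall_SL2Z hc]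
      intro γ _
      rw [hk γ]
      exact hb }, rfl⟩

theorem tendsto_E_atImInfty {k : ℕ} (hk : 3 ≤ k) (hk2 : Even k) :
    Tendsto (E hk) atImInfty (𝓝 1) := by
  have hper := SlashInvariantFormClass.periodic_comp_ofComplex (E hk)
    one_mem_strictPeriods_SL
  have hbdd := ModularFormClass.bdd_at_infty (E hk)
  have h1 := exp_decay_sub_atImInfty one_pos hper (ModularFormClass.holo (E hk)) hbdd
  have h2 : valueAtInfty (E hk) = 1 := by
    rw [← qExpansion_coeff_zero one_pos
      (ModularFormClass.analyticAt_cuspFunction_zero _ one_pos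
        one_mem_strictPeriods_SL) hper]
    exact EisensteinSeries.E_qExpansion_coeff_zero hk hk2
  rw [h2] at h1
  have h3 : Tendsto (fun z : ℍ => Real.exp (-2 * Real.pi * z.im / 1)) atImInfty (𝓝 0) := by
    have := (qParam_tendsto_atImInfty one_pos).norm
    simpa [Function.Periodic.norm_qParam] using this
  have h4 := (h1.trans_tendsto h3).add_const 1
  simpa using h4

theorem tendsto_discriminant_div_qParam :
    Tendsto (fun z : ℍ => discriminant z / Function.Periodic.qParam 1 z) atImInfty (𝓝 1) := by
  refine tendsto_atImInfty_tprod_one_sub_eta_q_pow.congr fun z => ?_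
  rw [discriminant_eq_q_prod, mul_div_cancel_left₀ _ (Function.Periodic.qParam_ne_zero _)]

end ModularForm

open ModularForm

theorem mdifferentiable_jFunction : MDifferentiable 𝓘(ℂ) 𝓘(ℂ) jFunction :=
  (ModularForm.E₄.holo'.pow 3).div CuspForm.discriminant.holo' discriminant_ne_zero

/-- The leading term of `j` at `i∞` is `q⁻¹`. -/
theorem tendsto_jFunction_mul_qParam :
    Tendsto (fun z : ℍ => jFunction z * Function.Periodic.qParam 1 z) atImInfty (𝓝 1) := by
  have h := ((tendsto_E_atImInfty (by norm_num : 3 ≤ 4) ⟨2, rfl⟩).pow 3).div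
    tendsto_discriminant_div_qParam one_ne_zero
  simp only [one_pow, div_one] at h
  refine h.congr fun z => ?_
  have := discriminant_ne_zero z
  have := Function.Periodic.qParam_ne_zero (h := 1) z
  simp only [jFunction, Pi.div_apply]
  field_simp

theorem tendsto_norm_jFunction : Tendsto (fun z : ℍ => ‖jFunction z‖) atImInfty atTop := by
  have h1 := tendsto_jFunction_mul_qParam.norm
  have h2 : Tendsto (fun z : ℍ => ‖Function.Periodic.qParam 1 z‖⁻¹) atImInfty atTop := by
    refine Tendsto.inv_tendsto_nhdsGT_zero ?_
    refine tendsto_nhdsWithin_iff.mpr ⟨?_, .of_forall fun z => ?_⟩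
    · simpa using (qParam_tendsto_atImInfty one_pos).norm
    · exact norm_pos_iff.mpr (Function.Periodic.qParam_ne_zero _)
  rw [norm_one] at h1
  refine (h1.pos_mul_atTop one_pos h2).congr fun z => ?_
  rw [norm_mul, mul_assoc, mul_inv_cancel₀ (norm_ne_zero_iff.mpr
    (Function.Periodic.qParam_ne_zero _)), mul_one]

theorem exists_jFunction_ne : ∃ z w, jFunction z ≠ jFunction w := by
  by_contra! h
  obtain ⟨z, hz⟩ := (tendsto_norm_jFunction.eventually_gt_atTop ‖jFunction I‖).exists
  rw [h z I] at hz
  exact lt_irrefl _ hz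

/-- `f` grows at most exponentially as `Im z → ∞`. -/
def HasExpGrowth (f : ℍ → ℂ) : Prop :=
  ∃ A : ℝ, f =O[atImInfty] fun z => Real.exp (A * z.im)

namespace HasExpGrowth

theorem mono_exp {f : ℍ → ℂ} {A B : ℝ} (h : A ≤ B)
    (hf : f =O[atImInfty] fun z => Real.exp (A * z.im)) :
    f =O[atImInfty] fun z => Real.exp (B * z.im) := by
  refine hf.trans (Asymptotics.IsBigO.of_bound 1 (.of_forall fun z => ?_))
  rw [one_mul, Real.norm_of_nonneg (Real.exp_pos _).le, Real.norm_of_nonneg (Real.exp_pos _).le]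
  exact Real.exp_le_exp.mpr (mul_le_mul_of_nonneg_right h z.im_pos.le)

theorem const (c : ℂ) : HasExpGrowth fun _ => c :=
  ⟨0, by simpa using Asymptotics.isBigO_const_const c (one_ne_zero : (1 : ℝ) ≠ 0) atImInfty⟩

theorem add {f g : ℍ → ℂ} (hf : HasExpGrowth f) (hg : HasExpGrowth g) : HasExpGrowth (f + g) := by
  obtain ⟨A, hA⟩ := hf
  obtain ⟨B, hB⟩ := hg
  exact ⟨max A B, (mono_exp (le_max_left _ _) hA).add (mono_exp (le_max_right _ _) hB)⟩

theorem mul {f g : ℍ → ℂ} (hf : HasExpGrowth f) (hg : HasExpGrowth g) : HasExpGrowth (f * g) := by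
  obtain ⟨A, hA⟩ := hf
  obtain ⟨B, hB⟩ := hg
  refine ⟨A + B, (hA.mul hB).congr_right fun z => ?_⟩
  rw [← Real.exp_add, add_mul]

end HasExpGrowth

theorem jFunction_isBigO :
    jFunction =O[atImInfty] fun z : ℍ => Real.exp (2 * Real.pi * z.im) := by
  have h1 := (tendsto_jFunction_mul_qParam.isBigO_one ℂ).mul
    (Asymptotics.isBigO_refl (fun z : ℍ => (Function.Periodic.qParam 1 z)⁻¹) atImInfty)
  refine (h1.congr_left fun z => ?_).trans (Asymptotics.IsBigO.of_bound 1 (.of_forall fun z => ?_))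
  · exact mul_inv_cancel_right₀ (Function.Periodic.qParam_ne_zero _) _
  · rw [one_mul, one_mul, norm_inv, Function.Periodic.norm_qParam, ← Real.exp_neg,
      Real.norm_of_nonneg (Real.exp_pos _).le]
    simp

theorem discriminant_isBigO :
    discriminant =O[atImInfty] fun z : ℍ => Real.exp (-(2 * Real.pi) * z.im) := by
  have h1 := (tendsto_discriminant_div_qParam.isBigO_one ℂ).mul
    (Asymptotics.isBigO_refl (fun z : ℍ => (Function.Periodic.qParam 1 z)) atImInfty)
  refine (h1.congr_left fun z => ?_).trans (Asymptotics.IsBigO.of_bound 1 (.of_forall fun z => ?_))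
  · exact div_mul_cancel₀ _ (Function.Periodic.qParam_ne_zero _)
  · rw [one_mul, one_mul, Function.Periodic.norm_qParam, Real.norm_of_nonneg (Real.exp_pos _).le]
    simp

/-- A level one modular form of weight `12 m` is `Δ ^ m` times a polynomial in `j`. -/
theorem exists_eq_eval_jFunction_mul (m : ℕ) (F : ModularForm 𝒮ℒ (12 * m)) :
    ∃ P : Polynomial ℂ, ∀ z, F z = P.eval (jFunction z) * discriminant z ^ m := by
  induction m with
  | zero =>
    obtain ⟨c, hc⟩ := ModularFormClass.levelOne_weight_zero_const
      (ModularForm.mcast (b := 0) (by simp) F)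
    refine ⟨.C c, fun z => ?_⟩
    have := congrFun hc z
    simpa using this
  | succ m ih =>
    -- subtract a multiple of `E₄ ^ (3 (m + 1))` to kill the constant term, then divide by `Δ`
    let G : ModularForm 𝒮ℒ (12 * (m + 1 : ℕ)) :=
      ModularForm.mcast (by push_cast; ring) (ModularForm.E₄.pow (3 * (m + 1)))
    have hGz : ∀ z, G z = ModularForm.E₄ z ^ (3 * (m + 1)) := fun z =>
      congrFun (ModularForm.coe_pow E₄ (3 * (m + 1))) z
    have hG : (qExpansion 1 G).coeff 0 = 1 := by
      have h1 : qExpansion 1 G = qExpansion 1 E₄ ^ (3 * (m + 1)) :=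
        ModularForm.qExpansion_pow one_pos one_mem_strictPeriods_SL E₄ (3 * (m + 1))
      have h2 := EisensteinSeries.E_qExpansion_coeff_zero (by norm_num : 3 ≤ 4) ⟨2, rfl⟩
      rw [PowerSeries.coeff_zero_eq_constantCoeff_apply] at h2
      rw [h1, PowerSeries.coeff_zero_eq_constantCoeff_apply, map_pow]
      exact (congrArg (· ^ (3 * (m + 1))) h2).trans (one_pow _)
    obtain ⟨H, hH⟩ := ModularForm.sub_smul_isCuspForm F G hG
    set a := (qExpansion 1 F).coeff 0
    obtain ⟨P, hP⟩ := ih (ModularForm.mcast (by push_cast; ring) (CuspForm.discriminantEquiv H))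
    refine ⟨P + .C a * .X ^ (m + 1), fun z => ?_⟩
    have h1 := hP z
    rw [ModularForm.mcast_apply, CuspForm.discriminantEquiv_apply] at h1
    have h2 : H z = F z - a * G z := by
      have := congrArg (fun f : ModularForm 𝒮ℒ (12 * (m + 1 : ℕ)) => f z) hH
      simpa using this
    have hΔ := discriminant_ne_zero z
    rw [div_eq_iff hΔ, h2, hGz, sub_eq_iff_eq_add] at h1
    rw [h1]
    simp only [Polynomial.eval_add, Polynomial.eval_mul, Polynomial.eval_C, Polynomial.eval_pow,
      Polynomial.eval_X]
    have h3 : jFunction z ^ (m + 1) * discriminant z ^ (m + 1) =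
        ModularForm.E₄ z ^ (3 * (m + 1)) := by
      rw [← mul_pow, jFunction, div_mul_cancel₀ _ hΔ, pow_mul]
    linear_combination -a * h3

/-- An `SL(2, ℤ)`-invariant holomorphic function on `ℍ` of at most exponential growth at `i∞` is a
polynomial in `j`. -/
theorem exists_eq_eval_jFunction {f : ℍ → ℂ} (hf : MDifferentiable 𝓘(ℂ) 𝓘(ℂ) f)
    (hinv : ∀ (γ : SL(2, ℤ)) (z : ℍ), f (γ • z) = f z) (hg : HasExpGrowth f) :
    ∃ P : Polynomial ℂ, ∀ z, f z = P.eval (jFunction z) := by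
  obtain ⟨A, hA⟩ := hg
  obtain ⟨m, hm⟩ := exists_nat_ge (A / (2 * Real.pi))
  have hm' : A ≤ m * (2 * Real.pi) := (div_le_iff₀ Real.two_pi_pos).mp hm
  obtain ⟨F, hF⟩ : ∃ F : ModularForm 𝒮ℒ (12 * m), ⇑F = f * discriminant ^ m := by
    refine ModularForm.exists_coe_eq ?_ (fun γ => ?_) ?_
    · exact hf.mul (CuspForm.discriminant.holo'.pow m)
    · have hΔ : ∀ γ : SL(2, ℤ), ∀ z : ℍ,
          discriminant (γ • z) = denom γ z ^ 12 * discriminant z := by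
        intro γ z
        have h := SlashInvariantForm.slash_action_eqn'' CuspForm.discriminant
          (⟨γ, rfl⟩ : Matrix.SpecialLinearGroup.mapGL ℝ γ ∈ 𝒮ℒ) z
        exact h
      ext z
      rw [SL_slash_apply]
      simp only [Pi.mul_apply, Pi.pow_apply, hinv, hΔ]
      have := denom_ne_zero (γ : GL (Fin 2) ℝ) z
      rw [mul_pow, ← pow_mul, zpow_neg, show (12 * m : ℤ) = ((12 * m : ℕ) : ℤ) by push_cast; ring,
        zpow_natCast]
      field_simp
    · have h1 := (HasExpGrowth.mono_exp hm' hA).mul (discriminant_isBigO.pow m)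
      refine h1.congr_right fun z => ?_
      rw [← Real.exp_nat_mul, ← Real.exp_add]
      simp only [Pi.one_apply]
      rw [Real.exp_eq_one_iff]
      ring
  obtain ⟨P, hP⟩ := exists_eq_eval_jFunction_mul m F
  refine ⟨P, fun z => ?_⟩
  have h1 := hP z
  rw [hF] at h1
  exact mul_right_cancel₀ (pow_ne_zero m (discriminant_ne_zero z)) h1

/-- Cauchy's estimate: the derivative of `j` is `O(exp (2π Im z))`. -/
theorem deriv_jFunction_isBigO : (fun z : ℍ => deriv (jFunction ∘ ofComplex) z) =O[atImInfty]
    fun z : ℍ => Real.exp (2 * Real.pi * z.im) := by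
  obtain ⟨C, hC⟩ := jFunction_isBigO.bound
  obtain ⟨A, hA⟩ := (atImInfty_mem _).mp hC
  refine Asymptotics.IsBigO.of_bound (2 * C * Real.exp Real.pi) ((atImInfty_mem _).mpr
    ⟨max A 0 + 1, fun z hz => ?_⟩)
  have hA0 : A ≤ max A 0 := le_max_left _ _
  have h00 : 0 ≤ max A 0 := le_max_right _ _
  have him : ∀ w ∈ Metric.closedBall (z : ℂ) (1 / 2),
      z.im - 1 / 2 ≤ w.im ∧ w.im ≤ z.im + 1 / 2 := by
    intro w hw
    have h1 : |(w - z).im| ≤ 1 / 2 :=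
      (Complex.abs_im_le_norm _).trans (mem_closedBall_iff_norm.mp hw)
    rw [Complex.sub_im, coe_im, abs_le] at h1
    constructor <;> linarith [h1.1, h1.2]
  have hCnn : 0 ≤ C := by
    have h1 := hA z (by linarith)
    rw [Set.mem_ofPred_eq, Real.norm_of_nonneg (Real.exp_pos _).le] at h1
    exact nonneg_of_mul_nonneg_left ((norm_nonneg _).trans h1) (Real.exp_pos _)
  have hd : DiffContOnCl ℂ (jFunction ∘ ofComplex) (Metric.ball (z : ℂ) (1 / 2)) := by
    refine DifferentiableOn.diffContOnCl ?_
    rw [closure_ball _ (by norm_num)]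
    exact (UpperHalfPlane.mdifferentiable_iff.mp mdifferentiable_jFunction).mono fun w hw =>
      show 0 < w.im by linarith [(him w hw).1]
  have h := Complex.norm_deriv_le_of_forall_mem_sphere_norm_le (C := C * Real.exp Real.pi *
    Real.exp (2 * Real.pi * z.im)) (by norm_num : (0 : ℝ) < 1 / 2) hd (fun w hw => ?_)
  · rw [Set.mem_ofPred_eq, Real.norm_of_nonneg (Real.exp_pos _).le]
    calc _ ≤ _ := h
      _ = _ := by ring
  · have hw' := him w (Metric.sphere_subset_closedBall hw)
    have hw0 : 0 < w.im := by linarith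
    have h1 := hA ⟨w, hw0⟩ (show A ≤ w.im by linarith)
    rw [Set.mem_ofPred_eq, Real.norm_of_nonneg (Real.exp_pos _).le] at h1
    rw [Function.comp_apply, ofComplex_apply_of_im_pos hw0]
    refine h1.trans ?_
    rw [mul_assoc C, ← Real.exp_add]
    refine mul_le_mul_of_nonneg_left (Real.exp_le_exp.mpr ?_) hCnn
    change 2 * Real.pi * w.im ≤ _
    nlinarith [Real.pi_pos, hw'.2]

/-- `j' Δ` has weight `14`, hence is a multiple of `E₄² E₆`. -/
theorem exists_deriv_jFunction_eq : ∃ c : ℂ, c ≠ 0 ∧ ∀ z : ℍ,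
    deriv (jFunction ∘ ofComplex) z * discriminant z = c * (E₄ z ^ 2 * E₆ z) := by
  have hslash0 : ∀ γ : SL(2, ℤ), jFunction ∣[(0 : ℤ)] γ = jFunction := fun γ => by
    ext z
    rw [SL_slash_apply, jFunction_smul]
    simp
  have hslash : ∀ γ : SL(2, ℤ), Derivative.normalizedDerivOfComplex jFunction ∣[(2 : ℤ)] γ =
      Derivative.normalizedDerivOfComplex jFunction := fun γ => by
    have := Derivative.normalizedDerivOfComplex_SL_slash (k := 0) mdifferentiable_jFunction (γ := γ)
    rw [hslash0] at this
    refine Eq.trans ?_ this.symm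
    ext z
    simp
  obtain ⟨F, hF⟩ : ∃ F : ModularForm 𝒮ℒ 14,
      ⇑F = Derivative.normalizedDerivOfComplex jFunction * discriminant := by
    refine ModularForm.exists_coe_eq ?_ (fun γ => ?_) ?_
    · exact (Derivative.normalizedDerivOfComplex_mdifferentiable mdifferentiable_jFunction).mul
        CuspForm.discriminant.holo'
    · rw [show (14 : ℤ) = 2 + 12 by norm_num, mul_slash_SL2, hslash]
      congr 1
      exact CuspForm.discriminant.slash_action_eq' _ ⟨γ, rfl⟩
    · have h1 := (deriv_jFunction_isBigO.const_mul_left (2 * Real.pi * Complex.I)⁻¹).mul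
        discriminant_isBigO
      refine h1.congr_right fun z => ?_
      rw [← Real.exp_add]
      simp
  let G : ModularForm 𝒮ℒ 14 := ModularForm.mcast (by norm_num) ((E₄.pow 2).mul E₆)
  have hGz : ∀ z, G z = E₄ z ^ 2 * E₆ z := fun z =>
    congrArg (· * E₆ z) (congrFun (ModularForm.coe_pow E₄ 2) z)
  have hG0 : G ≠ 0 := by
    intro h0
    have h1 := ((tendsto_E_atImInfty (by norm_num : 3 ≤ 4) ⟨2, rfl⟩).pow 2).mul
      (tendsto_E_atImInfty (by norm_num : 3 ≤ 6) ⟨3, rfl⟩)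
    have h2 : Tendsto (fun _ : ℍ => (0 : ℂ)) atImInfty (𝓝 (1 ^ 2 * 1)) := by
      refine h1.congr fun z => ?_
      rw [← hGz z, h0]
      rfl
    have := tendsto_nhds_unique h2 tendsto_const_nhds
    norm_num at this
  have hrank : Module.finrank ℂ (ModularForm 𝒮ℒ 14) = 1 := by
    have := ModularForm.dimension_level_one 14 (by decide)
    rw [Nat.cast_ofNat] at this
    refine Module.rank_eq_one_iff_finrank_eq_one.mp (this.trans ?_)
    simp [Nat.ModEq]
  obtain ⟨c, hc⟩ := (finrank_eq_one_iff_of_nonzero' G hG0).mp hrank F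
  have hpi : (2 * Real.pi * Complex.I : ℂ) ≠ 0 := Complex.two_pi_I_ne_zero
  have hmain : ∀ z : ℍ, deriv (jFunction ∘ ofComplex) z * discriminant z =
      2 * Real.pi * Complex.I * c * (E₄ z ^ 2 * E₆ z) := by
    intro z
    have h1 : F z = c * G z := by rw [← hc]; rfl
    rw [hF, hGz, Pi.mul_apply, Derivative.normalizedDerivOfComplex, mul_assoc,
      inv_mul_eq_iff_eq_mul₀ hpi] at h1
    rw [h1]
    ring
  refine ⟨_, fun h0 => ?_, hmain⟩
  -- otherwise `j` would be constant
  obtain ⟨z, w, hzw⟩ := exists_jFunction_ne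
  have hder : ∀ z : ℂ, 0 < z.im → deriv (jFunction ∘ ofComplex) z = 0 := by
    intro z hz
    have := hmain ⟨z, hz⟩
    rw [h0, zero_mul] at this
    exact (mul_eq_zero.mp this).resolve_right (discriminant_ne_zero _)
  have hd := UpperHalfPlane.mdifferentiable_iff.mp mdifferentiable_jFunction
  have hconv : Convex ℝ {z : ℂ | 0 < z.im} := convex_halfSpace_im_gt 0
  have := hconv.is_const_of_fderivWithin_eq_zero (𝕜 := ℂ) hd (fun u hu => ?_) z.im_pos w.im_pos
  · rw [Function.comp_apply, Function.comp_apply, ofComplex_apply, ofComplex_apply] at this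
    exact hzw this
  · rw [fderivWithin_of_isOpen isOpen_upperHalfPlaneSet hu]
    ext
    simpa using hder u hu

/-- The critical values of `j` are among `0` and `1728`. -/
theorem jFunction_eq_of_deriv_eq_zero {z : ℍ} (hz : deriv (jFunction ∘ ofComplex) z = 0) :
    jFunction z = 0 ∨ jFunction z = 1728 := by
  obtain ⟨c, hc, h⟩ := exists_deriv_jFunction_eq
  have h1 := h z
  rw [hz, zero_mul] at h1
  have h2 := (mul_eq_zero.mp h1.symm).resolve_left hc
  have hΔ := discriminant_ne_zero z
  rcases mul_eq_zero.mp h2 with h3 | h3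
  · left
    rw [jFunction, pow_eq_zero_iff two_ne_zero |>.mp h3]
    simp
  · right
    have h4 := discriminant_eq_E₄_cube_sub_E₆_sq z
    rw [h3] at h4
    rw [jFunction, div_eq_iff hΔ]
    linear_combination -1728 * h4

/-! ### The Fricke involution -/

section Fricke

variable (N : ℕ) [NeZero N]

theorem coe_S_smul_scale (z : ℍ) : ((ModularGroup.S • scale N z : ℍ) : ℂ) = -1 / (N * z) := by
  rw [modular_S_smul]
  simp [scale, neg_div]

/-- The matrix of `z ↦ -1 / (N z)`, used by `frickeStar`. -/
noncomputable def frickeMatrix : GL (Fin 2) ℚ :=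
  Matrix.GeneralLinearGroup.mkOfDetNeZero !![(0 : ℚ), -1; (N : ℚ), 0] (by simp [NeZero.ne N])

theorem map_frickeMatrix_smul (z : ℍ) :
    (frickeMatrix N).map (algebraMap ℚ ℝ) • z = ModularGroup.S • scale N z := by
  have hN : (0 : ℝ) < N := Nat.cast_pos.mpr (NeZero.pos N)
  have hdet : 0 < ((frickeMatrix N).map (algebraMap ℚ ℝ)).det.val := by
    rw [Matrix.GeneralLinearGroup.val_det_apply, Matrix.det_fin_two]
    simpa [frickeMatrix, Matrix.GeneralLinearGroup.mkOfDetNeZero] using hN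
  apply UpperHalfPlane.ext
  rw [coe_smul_of_det_pos hdet, coe_S_smul_scale]
  simp [num, denom, frickeMatrix, Matrix.GeneralLinearGroup.mkOfDetNeZero]

/-- For `σ` in `SL(2, ℤ)`, the transformation `z ↦ -1 / (N z)` composed with `σ` is an element of
`SL(2, ℤ)` composed with an affine map. -/
theorem exists_frickeStar_smul (σ : SL(2, ℤ)) :
    ∃ (δ : SL(2, ℤ)) (α : {x : ℝ // 0 < x}) (β : ℝ),
      frickeStar N (σ • .cusp OnePoint.infty) = δ • .cusp OnePoint.infty ∧
      ∀ z : ℍ, ModularGroup.S • scale N (σ • z) = δ • (β +ᵥ α • z) := by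
  obtain ⟨δ, hδ⟩ := OnePoint.exists_mem_SL2 ℤ
    ((frickeMatrix N * Matrix.SpecialLinearGroup.mapGL ℚ σ) • (OnePoint.infty : OnePoint ℚ))
  set U : GL (Fin 2) ℚ := (Matrix.SpecialLinearGroup.mapGL ℚ δ)⁻¹ *
    (frickeMatrix N * Matrix.SpecialLinearGroup.mapGL ℚ σ) with hU
  have hU0 : U 1 0 = 0 := by
    rw [← OnePoint.smul_infty_eq_self_iff, hU, mul_smul, ← hδ, inv_smul_smul]
  have hmap : ∀ γ : SL(2, ℤ), (Matrix.SpecialLinearGroup.mapGL ℚ γ).map (algebraMap ℚ ℝ) =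
      Matrix.SpecialLinearGroup.mapGL ℝ γ := fun γ => by
    ext i j
    simp
  have hUz : ∀ z : ℍ, U.map (algebraMap ℚ ℝ) • z = δ⁻¹ • ModularGroup.S • scale N (σ • z) := by
    intro z
    rw [hU, map_mul, map_mul, map_inv, hmap, hmap, mul_smul, mul_smul, map_frickeMatrix_smul,
      ← map_inv]
    rfl
  have hdet : 0 < U.val.det := by
    have h : (frickeMatrix N).val.det = N := by
      simp [frickeMatrix, Matrix.GeneralLinearGroup.mkOfDetNeZero]
    have h1 : ∀ γ : SL(2, ℤ), (Matrix.SpecialLinearGroup.mapGL ℚ γ).val.det = 1 := fun γ => by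
      rw [← Matrix.GeneralLinearGroup.val_det_apply]
      simp
    rw [hU, ← map_inv, Units.val_mul, Units.val_mul, Matrix.det_mul, Matrix.det_mul, h1, h1, h]
    simpa using NeZero.pos N
  have hdet' : 0 < (U.map (algebraMap ℚ ℝ)).det.val := by
    rw [Matrix.GeneralLinearGroup.val_det_apply]
    have : (U.map (algebraMap ℚ ℝ)).val.det = ((U.val.det : ℚ) : ℝ) :=
      ((algebraMap ℚ ℝ).map_det U.val).symm
    rw [this]
    exact_mod_cast hdet
  rw [Matrix.det_fin_two, hU0, mul_zero, sub_zero] at hdet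
  have h11 : U 1 1 ≠ 0 := fun h => by rw [h, mul_zero] at hdet; exact lt_irrefl _ hdet
  have hα : (0 : ℝ) < ((U 0 0 / U 1 1 : ℚ) : ℝ) := by
    have : 0 < U 0 0 / U 1 1 := by
      rw [show U 0 0 / U 1 1 = U 0 0 * U 1 1 / (U 1 1) ^ 2 by field_simp]
      positivity
    exact_mod_cast this
  refine ⟨δ, ⟨_, hα⟩, ((U 0 1 / U 1 1 : ℚ) : ℝ), ?_, fun z => ?_⟩
  · rw [HStar.smul_cusp, HStar.smul_cusp, hδ, mul_smul]
    rfl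
  · rw [← inv_smul_eq_iff, ← hUz]
    apply UpperHalfPlane.ext
    rw [coe_smul_of_det_pos hdet', coe_vadd, coe_pos_real_smul]
    simp only [num, denom, Matrix.GeneralLinearGroup.map_apply, hU0]
    simp only [eq_ratCast, Complex.real_smul]
    push_cast
    rw [zero_mul, zero_add, add_div]
    ring

/-- The map `z ↦ -1 / (N z)` is holomorphic on `ℍ`. -/
theorem mdifferentiable_S_smul_scale :
    MDifferentiable 𝓘(ℂ) 𝓘(ℂ) (fun z : ℍ => ModularGroup.S • scale N z) := by
  have hN : (0 : ℝ) < N := Nat.cast_pos.mpr (NeZero.pos N)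
  have hdet : 0 < ((frickeMatrix N).map (algebraMap ℚ ℝ)).val.det := by
    rw [Matrix.det_fin_two]
    simpa [frickeMatrix, Matrix.GeneralLinearGroup.mkOfDetNeZero] using hN
  simpa only [← map_frickeMatrix_smul] using! UpperHalfPlane.mdifferentiable_smul hdet

theorem tendsto_vadd_smul_atImInfty (α : {x : ℝ // 0 < x}) (β : ℝ) :
    Tendsto (fun z : ℍ => β +ᵥ α • z) atImInfty atImInfty := by
  rw [atImInfty, tendsto_comap_iff]
  have h : (UpperHalfPlane.im ∘ fun z : ℍ => β +ᵥ α • z) = fun z : ℍ => α * z.im := by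
    ext z
    simp
  rw [h]
  exact tendsto_comap.const_mul_atTop α.2

theorem continuous_frickeStar : Continuous (frickeStar N) := by
  refine HStar.continuous_of_tendsto ?_ fun σ => ?_
  · exact HStar.continuous_point.comp (mdifferentiable_S_smul_scale N).continuous
  · obtain ⟨δ, α, β, h, h'⟩ := exists_frickeStar_smul N σ
    rw [h]
    refine ((HStar.tendsto_smul_point_atImInfty δ).comp
      (tendsto_vadd_smul_atImInfty α β)).congr fun z => ?_
    exact congrArg HStar.point (h' z).symm

theorem S_smul_scale_S_smul_scale (z : ℍ) :
    ModularGroup.S • scale N (ModularGroup.S • scale N z) = z := by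
  apply UpperHalfPlane.ext
  rw [coe_S_smul_scale, coe_S_smul_scale]
  have := z.ne_zero
  have hN : (N : ℂ) ≠ 0 := Nat.cast_ne_zero.mpr (NeZero.ne N)
  field_simp

/-- The Fricke matrix normalises `Γ₀(N)`. -/
theorem exists_S_smul_scale_smul {γ : SL(2, ℤ)} (hγ : γ ∈ CongruenceSubgroup.Gamma0 N) :
    ∃ γ' ∈ CongruenceSubgroup.Gamma0 N, ∀ z : ℍ,
      ModularGroup.S • scale N (γ • z) = γ' • ModularGroup.S • scale N z := by
  rw [CongruenceSubgroup.Gamma0_mem, ZMod.intCast_zmod_eq_zero_iff_dvd] at hγ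
  obtain ⟨c, hc⟩ := hγ
  have hdet : γ 0 0 * γ 1 1 - γ 0 1 * γ 1 0 = 1 := by
    rw [← Matrix.det_fin_two]; exact γ.det_coe
  obtain ⟨δ, h00, h01, h10, h11⟩ : ∃ δ : SL(2, ℤ),
      δ 0 0 = γ 1 1 ∧ δ 0 1 = -c ∧ δ 1 0 = -(N * γ 0 1) ∧ δ 1 1 = γ 0 0 := by
    refine ⟨⟨!![γ 1 1, -c; -(N * γ 0 1), γ 0 0], ?_⟩, rfl, rfl, rfl, rfl⟩
    rw [Matrix.det_fin_two_of]
    rw [hc] at hdet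
    linear_combination hdet
  refine ⟨δ, ?_, fun z => UpperHalfPlane.ext ?_⟩
  · rw [CongruenceSubgroup.Gamma0_mem, ZMod.intCast_zmod_eq_zero_iff_dvd, h10]
    exact (dvd_mul_right _ _).neg_right
  have hcC : ((γ 1 0 : ℤ) : ℂ) = N * c := by rw [hc]; push_cast; ring
  have hN : (N : ℂ) ≠ 0 := Nat.cast_ne_zero.mpr (NeZero.ne N)
  have hz := z.ne_zero
  have h1 : ((γ 1 0 : ℤ) : ℂ) * z + (γ 1 1 : ℤ) ≠ 0 := by
    simpa [denom] using denom_ne_zero (Matrix.SpecialLinearGroup.mapGL ℝ γ) z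
  have h2 : ((γ 0 0 : ℤ) : ℂ) * z + (γ 0 1 : ℤ) ≠ 0 := by
    have h := (γ • z).ne_zero
    rw [coe_specialLinearGroup_apply] at h
    simpa using left_ne_zero_of_mul (div_eq_mul_inv _ (_ : ℂ) ▸ h)
  rw [coe_S_smul_scale, coe_specialLinearGroup_apply, coe_specialLinearGroup_apply,
    coe_S_smul_scale, h00, h01, h10, h11]
  simp only [algebraMap_int_eq, eq_intCast, Complex.ofReal_intCast]
  rw [hcC] at h1 ⊢
  push_cast
  have h3 : -((N : ℂ) * ((γ 0 1 : ℤ) : ℂ)) * (-1 / (N * z)) + ((γ 0 0 : ℤ) : ℂ) =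
      (((γ 0 0 : ℤ) : ℂ) * z + (γ 0 1 : ℤ)) / z := by
    field_simp
    ring
  rw [h3]
  field_simp
  ring

namespace ModularCurve

theorem denseRange_mk_point {Γ : Subgroup SL(2, ℤ)} :
    DenseRange fun z : ℍ => (mk (.point z) : ModularCurve Γ) :=
  isOpenQuotientMap_mk.surjective.denseRange.comp HStar.dense_range_point continuous_mk

theorem mk_frickeStar_smul {γ : SL(2, ℤ)} (hγ : γ ∈ CongruenceSubgroup.Gamma0 N) (p : HStar) :
    (mk (frickeStar N (γ • p)) : X₀ N) = mk (frickeStar N p) := by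
  have h : (fun p => (mk (frickeStar N (γ • p)) : X₀ N)) = fun p => mk (frickeStar N p) := by
    refine HStar.dense_range_point.equalizer
      ((continuous_mk.comp (continuous_frickeStar N)).comp (continuous_const_smul γ))
      (continuous_mk.comp (continuous_frickeStar N)) ?_
    ext z
    obtain ⟨γ', hγ', h⟩ := exists_S_smul_scale_smul N hγ
    exact (congrArg (fun p => (mk (.point p) : X₀ N)) (h z)).trans (mk_smul hγ' (.point _))
  exact congrFun h p

/-- The Fricke involution of `X₀(N)`. -/
noncomputable def fricke : X₀ N → X₀ N :=
  Quotient.lift (s := MulAction.orbitRel (CongruenceSubgroup.Gamma0 N) HStar)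
    (fun p => mk (frickeStar N p)) (by
      rintro _ b ⟨⟨γ, hγ⟩, rfl⟩
      exact mk_frickeStar_smul N hγ b)

theorem fricke_mk (p : HStar) : fricke N (mk p) = mk (frickeStar N p) := rfl

theorem continuous_fricke : Continuous (fricke N) :=
  isOpenQuotientMap_mk.isQuotientMap.continuous_iff.mpr
    (continuous_mk.comp (continuous_frickeStar N))

theorem involutive_fricke : Function.Involutive (fricke N) := by
  have h : fricke N ∘ fricke N = id := by
    refine denseRange_mk_point.equalizer ((continuous_fricke N).comp (continuous_fricke N))
      continuous_id ?_
    ext z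
    exact congrArg (fun z => (mk (.point z) : X₀ N)) (S_smul_scale_S_smul_scale N z)
  exact congrFun h

theorem mdifferentiable_fricke : MDifferentiable 𝓘(ℂ) 𝓘(ℂ) (fricke N) :=
  mdifferentiable_of_comp_mk (continuous_fricke N)
    (mdifferentiable_mk_point.comp (mdifferentiable_S_smul_scale N))

end ModularCurve

end Fricke

/-! ### Belyi functions -/

namespace RiemannSphere

theorem mdifferentiable_coe : MDifferentiable 𝓘(ℂ) 𝓘(ℂ) ((↑) : ℂ → OnePoint ℂ) := fun z =>
  mdifferentiableAt_atlas_symm (I := 𝓘(ℂ)) (e := chartZero) (Or.inl rfl)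
    (by simp [chartZero])

theorem mdifferentiableAt_chartZero (z : ℂ) :
    MDifferentiableAt 𝓘(ℂ) 𝓘(ℂ) chartZero (z : OnePoint ℂ) :=
  mdifferentiableAt_atlas (I := 𝓘(ℂ)) (e := chartZero) (Or.inl rfl) (by simp [chartZero_source])

theorem tendsto_coe_of_norm {α : Type*} {l : Filter α} {f : α → ℂ}
    (h : Tendsto (fun x => ‖f x‖) l atTop) :
    Tendsto (fun x => (f x : OnePoint ℂ)) l (𝓝 OnePoint.infty) := by
  refine OnePoint.tendsto_coe_infty.comp ?_
  rw [coclosedCompact_eq_cocompact, ← Metric.cobounded_eq_cocompact]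
  exact tendsto_norm_atTop_iff_cobounded.mp h

end RiemannSphere

namespace ModularCurve

section

variable (N : ℕ)

theorem belyiF_mk_point (z : ℍ) :
    belyiF N (mk (.point z)) = ((jFunction z / 1728 : ℂ) : OnePoint ℂ) := rfl

theorem belyiF_mk_smul_cusp (σ : SL(2, ℤ)) :
    belyiF N (mk (σ • .cusp OnePoint.infty)) = OnePoint.infty := rfl

theorem mdifferentiable_belyiF_mk :
    MDifferentiable 𝓘(ℂ) 𝓘(ℂ) (fun z : ℍ => belyiF N (mk (.point z))) :=
  RiemannSphere.mdifferentiable_coe.comp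
    (mdifferentiable_jFunction.mul (mdifferentiable_const (c := (1728 : ℂ)⁻¹)))

theorem continuous_belyiF : Continuous (belyiF N) := by
  refine isOpenQuotientMap_mk.isQuotientMap.continuous_iff.mpr
    (HStar.continuous_of_tendsto (mdifferentiable_belyiF_mk N).continuous fun σ => ?_)
  have h : Tendsto (fun z : ℍ => ‖jFunction z / 1728‖) atImInfty atTop := by
    simp only [norm_div]
    exact tendsto_norm_jFunction.atTop_div_const (by simp)
  refine (RiemannSphere.tendsto_coe_of_norm h).congr fun z => ?_
  rw [← jFunction_smul σ]
  rfl

/-- The ramification values of `f`: at the points of `ℍ` the derivative of `f` is read off from that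
of `j`, and at the cusps `f` takes the value `∞`. -/
theorem mfderiv_belyiF [NeZero N] (x : X₀ N) (hx : mfderiv 𝓘(ℂ) 𝓘(ℂ) (belyiF N) x = 0) :
    belyiF N x = ((0 : ℂ) : OnePoint ℂ) ∨ belyiF N x = ((1 : ℂ) : OnePoint ℂ) ∨
      belyiF N x = OnePoint.infty := by
  obtain ⟨p, rfl⟩ := isOpenQuotientMap_mk.surjective x
  rcases p with z | c
  · have hF : MDifferentiable 𝓘(ℂ) 𝓘(ℂ) (belyiF N) :=
      mdifferentiable_of_comp_mk (continuous_belyiF N) (mdifferentiable_belyiF_mk N)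
    have h1 : HasMFDerivAt 𝓘(ℂ) 𝓘(ℂ) (belyiF N) (mk (.point z)) 0 :=
      hx ▸ (hF _).hasMFDerivAt
    have h2 := (RiemannSphere.mdifferentiableAt_chartZero (jFunction z / 1728)).hasMFDerivAt
    have h3 := (mdifferentiable_mk_point (Γ := CongruenceSubgroup.Gamma0 N) z).hasMFDerivAt
    have h4 : MDifferentiableAt 𝓘(ℂ) 𝓘(ℂ) ofComplex (z : ℂ) :=
      mdifferentiableAt_ofComplex z.im_pos
    have h0 : HasMFDerivAt 𝓘(ℂ) 𝓘(ℂ) (belyiF N ∘ fun z : ℍ => (mk (.point z) : X₀ N)) z 0 := by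
      have := h1.comp z h3
      simpa using! this
    have h5 : HasMFDerivAt 𝓘(ℂ) 𝓘(ℂ) (RiemannSphere.chartZero ∘ (belyiF N ∘
        fun z : ℍ => (mk (.point z) : X₀ N))) z 0 := by
      have := HasMFDerivAt.comp z h2 h0
      convert this using 1
      exact (ContinuousLinearMap.comp_zero _).symm
    have h6 : HasFDerivAt (fun w : ℂ => jFunction (ofComplex w) / 1728) (0 : ℂ →L[ℂ] ℂ) z := by
      rw [← ofComplex_apply z] at h5
      have := HasMFDerivAt.comp (z : ℂ) h5 h4.hasMFDerivAt
      rw [hasMFDerivAt_iff_hasFDerivAt] at this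
      refine HasFDerivAt.congr_of_eventuallyEq (f := (RiemannSphere.chartZero ∘ (belyiF N ∘
        fun z : ℍ => (mk (.point z) : X₀ N))) ∘ ofComplex) ?_
        (.of_forall fun w => (RiemannSphere.chartZero_coe _).symm)
      simpa using! this
    have h7 : deriv (jFunction ∘ ofComplex) (z : ℂ) = 0 := by
      have h8 := h6.hasDerivAt.mul_const (1728 : ℂ)
      simp only [div_mul_cancel₀ _ (show (1728 : ℂ) ≠ 0 by norm_num)] at h8
      simpa using! h8.deriv
    rcases jFunction_eq_of_deriv_eq_zero h7 with h | h
    · left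
      rw [belyiF_mk_point, h, zero_div]
    · right; left
      rw [belyiF_mk_point, h, div_self (by norm_num)]
  · exact Or.inr (Or.inr rfl)

theorem isBelyiFunction_belyiF [NeZero N] : IsBelyiFunction (belyiF N) where
  holomorphic := mdifferentiable_of_comp_mk (continuous_belyiF N) (mdifferentiable_belyiF_mk N)
  nonconstant := by
    rintro ⟨c, hc⟩
    have h1 := hc (mk (.point I))
    rw [← hc (mk (.cusp OnePoint.infty))] at h1
    exact OnePoint.coe_ne_infty _ h1
  ramification := mfderiv_belyiF N

variable [NeZero N]

theorem belyiF_comp_fricke : belyiF N ∘ fricke N = belyiG N := by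
  ext x
  obtain ⟨p, rfl⟩ := isOpenQuotientMap_mk.surjective x
  rcases p with z | c
  · change ((jFunction (ModularGroup.S • scale N z) / 1728 : ℂ) : OnePoint ℂ) = _
    rw [jFunction_smul]
    rfl
  · rfl

theorem belyiG_comp_fricke : belyiG N ∘ fricke N = belyiF N := by
  rw [← belyiF_comp_fricke, Function.comp_assoc, (involutive_fricke N).comp_self, Function.comp_id]

theorem isBelyiFunction_belyiG : IsBelyiFunction (belyiG N) where
  holomorphic := by
    rw [← belyiF_comp_fricke]
    exact (isBelyiFunction_belyiF N).holomorphic.comp (mdifferentiable_fricke N)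
  nonconstant := by
    rintro ⟨c, hc⟩
    exact (isBelyiFunction_belyiF N).nonconstant ⟨c, fun x => by
      rw [← belyiG_comp_fricke]
      exact hc _⟩
  ramification x hx := by
    have hG : MDifferentiable 𝓘(ℂ) 𝓘(ℂ) (belyiG N) := by
      rw [← belyiF_comp_fricke]
      exact (isBelyiFunction_belyiF N).holomorphic.comp (mdifferentiable_fricke N)
    have h1 : HasMFDerivAt 𝓘(ℂ) 𝓘(ℂ) (belyiG N) x 0 := hx ▸ (hG x).hasMFDerivAt
    rw [← involutive_fricke N x] at h1
    have h2 : HasMFDerivAt 𝓘(ℂ) 𝓘(ℂ) (belyiG N ∘ fricke N) (fricke N x) 0 := by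
      have := h1.comp _ (mdifferentiable_fricke N (fricke N x)).hasMFDerivAt
      simpa using! this
    rw [belyiG_comp_fricke] at h2
    have h3 := mfderiv_belyiF N _ h2.mfderiv
    have h4 : belyiF N (fricke N x) = belyiG N x := congrFun (belyiF_comp_fricke N) x
    rwa [h4] at h3

end

end ModularCurve

/-! ### Holomorphic functions of exponential growth at the cusps -/

theorem mdifferentiable_SL_smul (σ : SL(2, ℤ)) :
    MDifferentiable 𝓘(ℂ) 𝓘(ℂ) (fun z : ℍ => σ • z) :=
  UpperHalfPlane.mdifferentiable_smul (ModularCurve.det_mapGL_pos σ)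

/-- The algebra of the holomorphic functions on `ℍ` which grow at most exponentially at each
cusp. -/
noncomputable def cuspAlgebra : Subalgebra ℂ (ℍ → ℂ) where
  carrier := {f | MDifferentiable 𝓘(ℂ) 𝓘(ℂ) f ∧ ∀ σ : SL(2, ℤ), HasExpGrowth fun z => f (σ • z)}
  mul_mem' := fun ha hb => ⟨ha.1.mul hb.1, fun σ => (ha.2 σ).mul (hb.2 σ)⟩
  add_mem' := fun ha hb => ⟨ha.1.add hb.1, fun σ => (ha.2 σ).add (hb.2 σ)⟩
  algebraMap_mem' c := ⟨mdifferentiable_const, fun _ => HasExpGrowth.const c⟩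

namespace cuspAlgebra

theorem mdifferentiable (f : cuspAlgebra) : MDifferentiable 𝓘(ℂ) 𝓘(ℂ) f.1 := f.2.1

theorem ext_apply {f g : cuspAlgebra} (h : ∀ z, f.1 z = g.1 z) : f = g := Subtype.ext (funext h)

instance : IsDomain cuspAlgebra :=
  have : NoZeroDivisors cuspAlgebra := ⟨fun {a b} h => by
    have h1 : a.1 * b.1 = 0 := congrArg Subtype.val h
    exact ((UpperHalfPlane.mul_eq_zero_iff a.2.1 b.2.1).mp h1).imp Subtype.ext Subtype.ext⟩
  NoZeroDivisors.to_isDomain _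

/-- Evaluation at `z`. -/
noncomputable def eval (z : ℍ) : cuspAlgebra →ₐ[ℂ] ℂ := (Pi.evalAlgHom ℂ _ z).comp cuspAlgebra.val

@[simp] theorem eval_apply (z : ℍ) (f : cuspAlgebra) : eval z f = f.1 z := rfl

/-- Composition with `σ⁻¹`. -/
noncomputable def shift (σ : SL(2, ℤ)) : cuspAlgebra →ₐ[ℂ] cuspAlgebra where
  toFun f := ⟨fun z => f.1 (σ⁻¹ • z), f.2.1.comp (mdifferentiable_SL_smul σ⁻¹), fun τ => by
    simpa only [mul_smul] using f.2.2 (σ⁻¹ * τ)⟩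
  map_one' := rfl
  map_mul' _ _ := rfl
  map_zero' := rfl
  map_add' _ _ := rfl
  commutes' _ := rfl

@[simp] theorem shift_apply (σ : SL(2, ℤ)) (f : cuspAlgebra) (z : ℍ) :
    (shift σ f).1 z = f.1 (σ⁻¹ • z) := rfl

/-- The function `j`. -/
noncomputable def j : cuspAlgebra :=
  ⟨jFunction, mdifferentiable_jFunction, fun σ => by
    simpa only [jFunction_smul] using! ⟨_, jFunction_isBigO⟩⟩

@[simp] theorem j_apply (z : ℍ) : j.1 z = jFunction z := rfl

theorem aeval_apply (f : cuspAlgebra) (P : Polynomial ℂ) (z : ℍ) :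
    (Polynomial.aeval f P).1 z = P.eval (f.1 z) := by
  rw [← eval_apply, ← Polynomial.aeval_algHom_apply, eval_apply, Polynomial.coe_aeval_eq_eval]

/-- The function `j` is transcendental, because it takes arbitrarily large values. -/
theorem aeval_j_injective : Function.Injective (Polynomial.aeval j : Polynomial ℂ →ₐ[ℂ] _) := by
  rw [injective_iff_map_eq_zero]
  intro P hP
  refine Polynomial.eq_zero_of_infinite_isRoot P fun hfin => ?_
  obtain ⟨C, hC⟩ := (hfin.image norm).bddAbove
  obtain ⟨z, hz⟩ := (tendsto_norm_jFunction.eventually_gt_atTop C).exists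
  refine hz.not_ge (hC ⟨jFunction z, ?_, rfl⟩)
  change P.eval (jFunction z) = 0
  rw [← j_apply, ← aeval_apply, hP]
  rfl

theorem exists_aeval_j_eq {f : cuspAlgebra} (hf : ∀ (τ : SL(2, ℤ)) (z : ℍ), f.1 (τ • z) = f.1 z) :
    f ∈ Set.range (Polynomial.aeval j : Polynomial ℂ →ₐ[ℂ] cuspAlgebra) := by
  obtain ⟨P, hP⟩ := exists_eq_eval_jFunction f.2.1 hf (by simpa using f.2.2 1)
  exact ⟨P, ext_apply fun z => by rw [aeval_apply, hP]; rfl⟩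

/-- The value at `(j, g)` of a polynomial in two variables. -/
noncomputable abbrev evalPair (g : cuspAlgebra) : Polynomial (Polynomial ℂ) →+* cuspAlgebra :=
  Polynomial.eval₂RingHom (Polynomial.aeval j).toRingHom g

theorem evalPair_apply (g : cuspAlgebra) (P : Polynomial (Polynomial ℂ)) (z : ℍ) :
    (evalPair g P).1 z = P.evalEval (jFunction z) (g.1 z) := by
  have h : ((eval z : cuspAlgebra →+* ℂ).comp (evalPair g)) =
      Polynomial.evalEvalRingHom (jFunction z) (g.1 z) := by
    refine Polynomial.ringHom_ext' (Polynomial.ringHom_ext' ?_ ?_) ?_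
    · ext c
      simp
    · simp
    · simp
  exact congrArg (fun f => f P) h

theorem shift_evalPair (σ : SL(2, ℤ)) (g : cuspAlgebra) (P : Polynomial (Polynomial ℂ)) :
    shift σ (evalPair g P) = evalPair (shift σ g) P :=
  ext_apply fun z => by
    rw [shift_apply, evalPair_apply, evalPair_apply, jFunction_smul, shift_apply]

/-- A polynomial over the algebra whose value at `z` depends only on the `SL(2, ℤ)`-orbit of `z`
has its coefficients in `ℂ[j]`. -/
theorem mem_lifts {H : Polynomial cuspAlgebra}
    (hH : ∀ (τ : SL(2, ℤ)) (z : ℍ), H.map (eval (τ • z)).toRingHom = H.map (eval z).toRingHom) :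
    H ∈ Polynomial.lifts (Polynomial.aeval j : Polynomial ℂ →ₐ[ℂ] cuspAlgebra).toRingHom := by
  rw [Polynomial.lifts_iff_coeff_lifts]
  intro n
  refine exists_aeval_j_eq fun τ z => ?_
  have := congrArg (fun P => Polynomial.coeff P n) (hH τ z)
  simpa using this

section Conjugates

variable {Γ : Subgroup SL(2, ℤ)}

/-- The conjugate `z ↦ f (σ⁻¹ z)` of a function invariant under `Γ`, for a coset `σ Γ`. -/
noncomputable def conjugate (f : cuspAlgebra) (q : SL(2, ℤ) ⧸ Γ) : cuspAlgebra := shift q.out f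

variable {f g : cuspAlgebra}

theorem conjugate_mk (hf : ∀ γ ∈ Γ, ∀ z : ℍ, f.1 (γ • z) = f.1 z) (σ : SL(2, ℤ)) :
    conjugate f (σ : SL(2, ℤ) ⧸ Γ) = shift σ f := by
  obtain ⟨γ, hγ⟩ := QuotientGroup.mk_out_eq_mul Γ σ
  refine ext_apply fun z => ?_
  rw [conjugate, hγ, shift_apply, shift_apply, mul_inv_rev, mul_smul]
  exact hf _ (Γ.inv_mem γ.2) _

theorem conjugate_one (hf : ∀ γ ∈ Γ, ∀ z : ℍ, f.1 (γ • z) = f.1 z) :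
    conjugate f ((1 : SL(2, ℤ)) : SL(2, ℤ) ⧸ Γ) = f := by
  rw [conjugate_mk hf]
  exact ext_apply fun z => by simp

theorem conjugate_smul (hf : ∀ γ ∈ Γ, ∀ z : ℍ, f.1 (γ • z) = f.1 z)
    (τ : SL(2, ℤ)) (q : SL(2, ℤ) ⧸ Γ) (z : ℍ) :
    (conjugate f q).1 (τ • z) = (conjugate f (τ⁻¹ • q)).1 z := by
  induction q using QuotientGroup.induction_on with
  | _ σ =>
    rw [MulAction.Quotient.smul_coe, smul_eq_mul, conjugate_mk hf, conjugate_mk hf, shift_apply,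
      shift_apply, mul_inv_rev, inv_inv, mul_smul]

variable [Γ.FiniteIndex]

/-- If the conjugates of `g` are distinct, then they are the roots of a monic polynomial over
`ℂ[j]` which generates the ideal of relations between `j` and `g`. -/
theorem exists_monic_evalPair_eq_zero_iff (hg : ∀ γ ∈ Γ, ∀ z : ℍ, g.1 (γ • z) = g.1 z)
    (hinj : Function.Injective (conjugate g : SL(2, ℤ) ⧸ Γ → cuspAlgebra)) :
    ∃ Φ : Polynomial (Polynomial ℂ), Φ.Monic ∧
    ∀ P, evalPair g P = 0 ↔ Φ ∣ P := by
  classical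
  let _ : Fintype (SL(2, ℤ) ⧸ Γ) := Fintype.ofFinite _
  set H : Polynomial cuspAlgebra :=
    ∏ q : SL(2, ℤ) ⧸ Γ, (Polynomial.X - Polynomial.C (conjugate g q)) with hHdef
  have hHm : H.Monic := Polynomial.monic_prod_of_monic _ _ fun _ _ => Polynomial.monic_X_sub_C _
  obtain ⟨Φ, hΦ, hdeg, hmon⟩ := Polynomial.lifts_and_natDegree_eq_and_monic
    (mem_lifts (H := H) fun τ z => by
      simp only [hHdef, Polynomial.map_prod, Polynomial.map_sub, Polynomial.map_X, Polynomial.map_C]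
      refine (Fintype.prod_equiv (MulAction.toPerm τ⁻¹) _ _ fun q => ?_)
      congr 2
      exact conjugate_smul hg τ q z) hHm
  refine ⟨Φ, hmon, fun P => ⟨fun hP => ?_, ?_⟩⟩
  · -- the remainder of `P` has more roots than its degree
    rw [← Polynomial.modByMonic_eq_zero_iff_dvd hmon]
    have hΦq : ∀ q : SL(2, ℤ) ⧸ Γ, evalPair (conjugate g q) Φ = 0 := fun q => by
      rw [evalPair, Polynomial.coe_eval₂RingHom, ← Polynomial.eval_map, hΦ, Polynomial.eval_prod]
      exact Finset.prod_eq_zero (Finset.mem_univ q) (by simp)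
    have hR : ∀ q : SL(2, ℤ) ⧸ Γ, evalPair (conjugate g q) (P %ₘ Φ) = 0 := fun q => by
      have h1 := congrArg (evalPair (conjugate g q)) (Polynomial.modByMonic_add_div P Φ)
      rw [map_add, map_mul, hΦq, zero_mul, add_zero] at h1
      rw [h1, conjugate, ← shift_evalPair, hP, map_zero]
    refine Polynomial.map_injective (Polynomial.aeval j : Polynomial ℂ →ₐ[ℂ] _).toRingHom
      aeval_j_injective ?_
    rw [Polynomial.map_zero]
    by_cases h1 : Φ = 1
    · rw [h1, Polynomial.modByMonic_one, Polynomial.map_zero]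
    refine Polynomial.eq_zero_of_natDegree_lt_card_of_eval_eq_zero _ hinj (fun q => ?_) ?_
    · rw [Polynomial.eval_map]
      exact hR q
    · refine Polynomial.natDegree_map_le.trans_lt
        ((Polynomial.natDegree_modByMonic_lt P hmon h1).trans_eq ?_)
      rw [hdeg, hHdef, Polynomial.natDegree_prod_of_monic _ _
        fun _ _ => Polynomial.monic_X_sub_C _]
      simp
  · rintro ⟨Q, rfl⟩
    have h1 : evalPair g Φ = 0 := by
      rw [evalPair, Polynomial.coe_eval₂RingHom, ← Polynomial.eval_map, hΦ, Polynomial.eval_prod]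
      refine Finset.prod_eq_zero (Finset.mem_univ ((1 : SL(2, ℤ)) : SL(2, ℤ) ⧸ Γ)) ?_
      rw [conjugate_one hg]
      simp
    rw [map_mul, h1, zero_mul]

/-- Lagrange interpolation: if the conjugates of `g` are distinct, then every invariant function is
the quotient of two polynomials in `j` and `g`; the denominator can be chosen independently of the
function. -/
theorem exists_evalPair_eq_mul (hg : ∀ γ ∈ Γ, ∀ z : ℍ, g.1 (γ • z) = g.1 z)
    (hinj : Function.Injective (conjugate g : SL(2, ℤ) ⧸ Γ → cuspAlgebra)) :
    ∃ δ : cuspAlgebra, δ ≠ 0 ∧ ∀ f : cuspAlgebra,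
    (∀ γ ∈ Γ, ∀ z : ℍ, f.1 (γ • z) = f.1 z) → ∃ L, evalPair g L = f * δ := by
  classical
  let _ : Fintype (SL(2, ℤ) ⧸ Γ) := Fintype.ofFinite _
  set o : SL(2, ℤ) ⧸ Γ := ((1 : SL(2, ℤ)) : SL(2, ℤ) ⧸ Γ) with ho
  refine ⟨∏ k ∈ Finset.univ.erase o, (g - conjugate g k), ?_, fun f hf => ?_⟩
  · refine Finset.prod_ne_zero_iff.mpr fun k hk => sub_ne_zero.mpr fun h => ?_
    refine Finset.ne_of_mem_erase hk (hinj ?_)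
    rw [← h, ho, conjugate_one hg]
  · set H : Polynomial cuspAlgebra := ∑ q : SL(2, ℤ) ⧸ Γ, Polynomial.C (conjugate f q) *
      ∏ k ∈ Finset.univ.erase q, (Polynomial.X - Polynomial.C (conjugate g k)) with hHdef
    obtain ⟨L, hL⟩ := (Polynomial.mem_lifts _).mp (mem_lifts (H := H) fun τ z => by
      simp only [hHdef, Polynomial.map_sum, Polynomial.map_mul, Polynomial.map_prod,
        Polynomial.map_sub, Polynomial.map_X, Polynomial.map_C]
      refine (Fintype.sum_equiv (MulAction.toPerm τ⁻¹) _ _ fun q => ?_)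
      congr 1
      · congr 1
        exact conjugate_smul hf τ q z
      · refine Finset.prod_equiv (MulAction.toPerm τ⁻¹) (by simp) fun k _ => ?_
        congr 2
        exact conjugate_smul hg τ k z)
    refine ⟨L, ?_⟩
    rw [evalPair, Polynomial.coe_eval₂RingHom, ← Polynomial.eval_map, hL, hHdef,
      Polynomial.eval_finsetSum, Finset.sum_eq_single o]
    · rw [Polynomial.eval_mul, Polynomial.eval_C, Polynomial.eval_prod, ho, conjugate_one hf]
      simp
    · intro q _ hq
      rw [Polynomial.eval_mul, Polynomial.eval_prod]
      refine mul_eq_zero_of_right _ (Finset.prod_eq_zero (i := o) (by simp [hq.symm]) ?_)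
      rw [ho, conjugate_one hg]
      simp
    · simp

end Conjugates

end cuspAlgebra

/-! ### The conjugates of `j(N z)` -/

/-- The behaviour of `j` at `i∞` shows that the only affine maps under which `j` is invariant are
the integral translations. -/
theorem eq_one_of_jFunction_vadd_smul {α : {x : ℝ // 0 < x}} {β : ℝ}
    (h : ∀ z : ℍ, jFunction (β +ᵥ α • z) = jFunction z) : (α : ℝ) = 1 ∧ ∃ n : ℤ, β = n := by
  have h1 := tendsto_jFunction_mul_qParam
  have h2 := h1.comp (tendsto_vadd_smul_atImInfty α β)
  have h3 : Tendsto (fun z : ℍ => Complex.exp (2 * Real.pi * Complex.I * (β + (α - 1) * z)))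
      atImInfty (𝓝 1) := by
    have h4 := h2.div h1 one_ne_zero
    rw [div_one] at h4
    have hne : ∀ᶠ z : ℍ in atImInfty, jFunction z ≠ 0 := by
      filter_upwards [tendsto_norm_jFunction.eventually_gt_atTop 0] with z hz
      exact norm_pos_iff.mp hz
    refine h4.congr' ?_
    filter_upwards [hne] with z hz
    simp only [Function.comp_apply, Pi.div_apply]
    rw [h, mul_div_mul_left _ _ hz, Function.Periodic.qParam, Function.Periodic.qParam,
      ← Complex.exp_sub]
    congr 1
    rw [coe_vadd, coe_pos_real_smul, Complex.real_smul]
    push_cast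
    ring
  have hα : (α : ℝ) = 1 := by
    have h5 : Tendsto (fun z : ℍ => -(2 * Real.pi * ((α : ℝ) - 1)) * z.im) atImInfty (𝓝 0) := by
      have h6 := (Real.continuousAt_log (by simp : ‖(1 : ℂ)‖ ≠ 0)).tendsto.comp h3.norm
      rw [norm_one, Real.log_one] at h6
      refine h6.congr fun z => ?_
      rw [Function.comp_apply, Complex.norm_exp, Real.log_exp]
      simp
      ring
    by_contra hne
    have h7 : -(2 * Real.pi * ((α : ℝ) - 1)) ≠ 0 :=
      neg_ne_zero.mpr (mul_ne_zero Real.two_pi_pos.ne' (sub_ne_zero.mpr hne))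
    have h8 := h5.const_mul (-(2 * Real.pi * ((α : ℝ) - 1)))⁻¹
    rw [mul_zero] at h8
    have h9 : Tendsto (fun z : ℍ => z.im) atImInfty (𝓝 0) := by
      refine h8.congr fun z => ?_
      rw [inv_mul_cancel_left₀ h7]
    exact not_tendsto_nhds_of_tendsto_atTop (f := UpperHalfPlane.im) (l := atImInfty)
      tendsto_comap 0 h9
  refine ⟨hα, ?_⟩
  rw [hα] at h3
  simp only [Complex.ofReal_one, sub_self, zero_mul, add_zero] at h3
  have h10 := tendsto_nhds_unique h3 tendsto_const_nhds
  obtain ⟨n, hn⟩ := Complex.exp_eq_one_iff.mp h10.symm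
  refine ⟨n, ?_⟩
  have h11 : (β : ℂ) = n := by
    refine mul_left_cancel₀ Complex.two_pi_I_ne_zero ?_
    rw [hn]
    ring
  exact_mod_cast h11

section Scale

variable (N : ℕ) [NeZero N]

/-- `N` as a positive real number. -/
def natPos : {x : ℝ // 0 < x} := ⟨N, Nat.cast_pos.mpr (NeZero.pos N)⟩

theorem scale_eq_smul (z : ℍ) : scale N z = natPos N • z := by
  apply UpperHalfPlane.ext
  simp [scale, natPos]

theorem mdifferentiable_scale : MDifferentiable 𝓘(ℂ) 𝓘(ℂ) (scale N) := by
  have h := (mdifferentiable_SL_smul ModularGroup.S⁻¹).comp (mdifferentiable_S_smul_scale N)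
  simpa only [Function.comp_def, inv_smul_smul] using! h

theorem jFunction_scale_smul {γ : SL(2, ℤ)} (hγ : γ ∈ CongruenceSubgroup.Gamma0 N) (z : ℍ) :
    jFunction (scale N (γ • z)) = jFunction (scale N z) := by
  obtain ⟨δ, hδ⟩ := exists_scale_smul N hγ z
  rw [hδ, jFunction_smul]

/-- The stabiliser of `j(N z)` in `SL(2, ℤ)` is `Γ₀(N)`. Invariance under `γ` makes `z ↦ N (γ z)`
equal to `z ↦ δ' (N z)` with `δ'` in `SL(2, ℤ)`, and a comparison of the imaginary parts shows that
`N` divides the lower left entry of `γ`. -/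
theorem mem_Gamma0_of_jFunction_scale_smul {γ : SL(2, ℤ)}
    (h : ∀ z, jFunction (scale N (γ • z)) = jFunction (scale N z)) :
    γ ∈ CongruenceSubgroup.Gamma0 N := by
  obtain ⟨δ, α, β, -, hγ⟩ := exists_frickeStar_smul N γ
  have hj : ∀ z : ℍ, jFunction (β +ᵥ (α * (natPos N)⁻¹) • z) = jFunction z := fun z => by
    have h1 := h ((natPos N)⁻¹ • z)
    rw [scale_eq_smul N ((natPos N)⁻¹ • z), smul_inv_smul, ← jFunction_smul ModularGroup.S, hγ,
      jFunction_smul, smul_smul] at h1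
    exact h1
  obtain ⟨hα, n, rfl⟩ := eq_one_of_jFunction_vadd_smul hj
  have hα' : α = natPos N := mul_inv_eq_one.mp (Subtype.ext hα)
  obtain ⟨δ', hδ'⟩ : ∃ δ' : SL(2, ℤ), ∀ z, scale N (γ • z) = δ' • scale N z := by
    refine ⟨ModularGroup.S⁻¹ * (δ * ModularGroup.T ^ n), fun z => ?_⟩
    rw [mul_smul, mul_smul, modular_T_zpow_smul, eq_inv_smul_iff, hγ, hα', scale_eq_smul]
  -- compare imaginary parts
  have him : ∀ z : ℍ, Complex.normSq (γ 1 0 * (z : ℂ) + γ 1 1) =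
      Complex.normSq (δ' 1 0 * (N * (z : ℂ)) + δ' 1 1) := by
    intro z
    have h1 := congrArg UpperHalfPlane.im (hδ' z)
    have h2 : (scale N (γ • z)).im = N * (γ • z).im := by
      rw [scale_eq_smul, pos_real_im]; rfl
    have h3 : (scale N z).im = N * z.im := by
      rw [scale_eq_smul, pos_real_im]; rfl
    rw [h2, ModularGroup.im_smul_eq_div_normSq, ModularGroup.im_smul_eq_div_normSq, h3,
      ← mul_div_assoc] at h1
    have hne : (N : ℝ) * z.im ≠ 0 :=
      mul_ne_zero (Nat.cast_ne_zero.mpr (NeZero.ne N)) z.im_pos.ne'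
    have h4 : Complex.normSq (denom (Matrix.SpecialLinearGroup.mapGL ℝ γ) z) =
        Complex.normSq (denom (Matrix.SpecialLinearGroup.mapGL ℝ δ') (scale N z)) := by
      have := inv_injective (mul_left_cancel₀ hne (by simpa only [div_eq_mul_inv] using! h1))
      exact this
    simpa [denom, scale] using h4
  have h1 := him I
  have h2 := him ⟨2 * Complex.I, by simp⟩
  simp [Complex.normSq_apply] at h1 h2
  have h3 : (γ 1 0) ^ 2 = (N * δ' 1 0) ^ 2 := by
    have : ((γ 1 0 : ℤ) : ℝ) ^ 2 = (N * (δ' 1 0 : ℤ)) ^ 2 := by linear_combination (h2 - h1) / 3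
    exact_mod_cast this
  rw [CongruenceSubgroup.Gamma0_mem, ZMod.intCast_zmod_eq_zero_iff_dvd]
  rcases sq_eq_sq_iff_eq_or_eq_neg.mp h3 with h4 | h4
  · exact ⟨_, h4⟩
  · rw [h4]; exact (dvd_mul_right _ _).neg_right

theorem eq_one_of_jFunction_scale (h : ∀ z, jFunction (scale N z) = jFunction z) : N = 1 := by
  have h1 : ∀ z : ℍ, jFunction ((0 : ℝ) +ᵥ natPos N • z) = jFunction z := fun z => by
    rw [zero_vadd, ← scale_eq_smul, h]
  have h2 := (eq_one_of_jFunction_vadd_smul h1).1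
  exact (Nat.cast_eq_one (R := ℝ)).mp h2

namespace cuspAlgebra

/-- The function `z ↦ j(N z)`. -/
noncomputable def jScale : cuspAlgebra :=
  ⟨fun z => jFunction (scale N z), mdifferentiable_jFunction.comp (mdifferentiable_scale N),
    fun σ => by
      obtain ⟨δ, α, β, -, hσ⟩ := exists_frickeStar_smul N σ
      have h : ∀ z : ℍ, jFunction (scale N (σ • z)) = jFunction (β +ᵥ α • z) := fun z => by
        rw [← jFunction_smul ModularGroup.S, hσ, jFunction_smul]
      simp only [h]
      refine ⟨2 * Real.pi * α, ?_⟩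
      refine (jFunction_isBigO.comp_tendsto (tendsto_vadd_smul_atImInfty α β)).congr_right
        fun z => ?_
      simp [mul_assoc]⟩

@[simp] theorem jScale_apply (z : ℍ) : (jScale N).1 z = jFunction (scale N z) := rfl

theorem jScale_smul : ∀ γ ∈ CongruenceSubgroup.Gamma0 N, ∀ z : ℍ,
    (jScale N).1 (γ • z) = (jScale N).1 z :=
  fun _ hγ z => jFunction_scale_smul N hγ z

/-- The conjugates of `j(N z)` are pairwise distinct. -/
theorem conjugate_jScale_injective : Function.Injective
    (conjugate (jScale N) : SL(2, ℤ) ⧸ CongruenceSubgroup.Gamma0 N → cuspAlgebra) := by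
  intro p q hpq
  induction p using QuotientGroup.induction_on with | _ σ => ?_
  induction q using QuotientGroup.induction_on with | _ τ => ?_
  rw [conjugate_mk (jScale_smul N), conjugate_mk (jScale_smul N)] at hpq
  rw [QuotientGroup.eq]
  have h : ∀ z, jFunction (scale N ((σ⁻¹ * τ) • z)) = jFunction (scale N z) := fun z => by
    have := congrArg (fun f : cuspAlgebra => f.1 (τ • z)) hpq
    simpa [mul_smul] using this
  exact mem_Gamma0_of_jFunction_scale_smul N h

end cuspAlgebra

end Scale

/-! ### Meromorphic functions on Riemann surfaces -/

namespace RiemannSurface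

variable {X : Type*} [TopologicalSpace X] [RiemannSurface X]

theorem analyticAt_comp_chartAt_symm {M : Type*} [TopologicalSpace M] [ChartedSpace ℂ M]
    [IsManifold 𝓘(ℂ) ω M] {F : X → M} (hF : MDifferentiable 𝓘(ℂ) 𝓘(ℂ) F)
    {e : OpenPartialHomeomorph M ℂ} (he : e ∈ atlas ℂ M) {x : X} (hx : F x ∈ e.source) :
    AnalyticAt ℂ (e ∘ F ∘ (chartAt ℂ x).symm) (chartAt ℂ x x) := by
  rw [Complex.analyticAt_iff_eventually_differentiableAt]
  have hxt := mem_chart_target ℂ x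
  have hc : ContinuousAt (F ∘ (chartAt ℂ x).symm) (chartAt ℂ x x) := by
    refine ContinuousAt.comp ?_ ((chartAt ℂ x).continuousAt_symm hxt)
    exact (hF _).continuousAt
  have h1 : (F ∘ (chartAt ℂ x).symm) (chartAt ℂ x x) ∈ e.source := by
    rwa [Function.comp_apply, (chartAt ℂ x).left_inv (mem_chart_source ℂ x)]
  filter_upwards [(chartAt ℂ x).open_target.mem_nhds hxt,
    hc.preimage_mem_nhds (e.open_source.mem_nhds h1)] with w hw hw'
  rw [← mdifferentiableAt_iff_differentiableAt]
  have h2 := mdifferentiableAt_atlas (I := 𝓘(ℂ)) he hw'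
  have h3 := (hF ((chartAt ℂ x).symm w)).comp w
    (mdifferentiableAt_atlas_symm (I := 𝓘(ℂ)) (chart_mem_atlas ℂ x) hw)
  exact MDifferentiableAt.comp w h2 h3

/-- A holomorphic map to the sphere whose poles are isolated is an element of the function
field. -/
theorem exists_represents {F : X → OnePoint ℂ} (hF : MDifferentiable 𝓘(ℂ) 𝓘(ℂ) F)
    (hF' : ∀ᶠ x in codiscrete X, F x ≠ OnePoint.infty) :
    ∃ φ : FunctionField X, φ.Represents F := by
  have hmer : IsMeromorphic (RiemannSphere.chartZero ∘ F) := by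
    intro x
    by_cases hx : F x = OnePoint.infty
    · have h1 := analyticAt_comp_chartAt_symm hF (e := RiemannSphere.chartInfty) (Or.inr rfl)
        (x := x) (by rw [hx, RiemannSphere.mem_chartInfty_source]; exact ⟨0, rfl⟩)
      refine h1.meromorphicAt.inv.congr ?_
      refine (eventually_comp_symm x fun y => (RiemannSphere.chartInfty (F y))⁻¹ =
        RiemannSphere.chartZero (F y)).mpr ?_
      have h0 : ∀ᶠ y in 𝓝 x, F y ≠ ((0 : ℂ) : OnePoint ℂ) :=
        hF.continuous.continuousAt.eventually_ne (by rw [hx]; exact OnePoint.infty_ne_coe 0)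
      filter_upwards [mem_codiscrete_iff.mp hF' x, h0.filter_mono nhdsWithin_le_nhds] with y hy hy0
      obtain ⟨c, hc⟩ := OnePoint.ne_infty_iff_exists.mp hy
      rw [← hc] at hy0 ⊢
      have hc0 : c ≠ 0 := fun h => hy0 (by rw [h])
      rw [RiemannSphere.chartInfty_apply, RiemannSphere.inversion_coe hc0,
        RiemannSphere.chartZero_coe, RiemannSphere.chartZero_coe, inv_inv]
    · exact (analyticAt_comp_chartAt_symm hF (e := RiemannSphere.chartZero) (Or.inl rfl)
        (by rw [RiemannSphere.chartZero_source]
            exact OnePoint.ne_infty_iff_exists.mp hx)).meromorphicAt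
  refine ⟨⟨_, _, hmer, rfl⟩, _, ?_, rfl⟩
  filter_upwards [hF'] with x hx
  obtain ⟨c, hc⟩ := OnePoint.ne_infty_iff_exists.mp hx
  rw [Function.comp_apply, ← hc, RiemannSphere.chartZero_coe]

/-- A pole is compensated by a sufficiently high power of a function vanishing there. -/
theorem exists_pow_mul_isBigO {h v : ℂ → ℂ} {t : ℂ} (hh : MeromorphicAt h t)
    (hv : DifferentiableAt ℂ v t) :
    ∃ n : ℕ, (fun w => (v w - v t) ^ n * h w) =O[𝓝[≠] t] fun _ => (1 : ℂ) := by
  obtain ⟨n, hn⟩ := hh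
  refine ⟨n, ?_⟩
  have h1 : (fun w => (v w - v t) ^ n) =O[𝓝[≠] t] fun w => (w - t) ^ n :=
    (hv.isBigO_sub.mono nhdsWithin_le_nhds).pow n
  have h2 : (fun w => (w - t) ^ n • h w) =O[𝓝[≠] t] fun _ => (1 : ℂ) :=
    (hn.continuousAt.tendsto.mono_left nhdsWithin_le_nhds).isBigO_one ℂ
  exact (h1.mul (Asymptotics.isBigO_refl h _)).trans h2

theorem IsMeromorphic.exists_pow_mul_isBigO {h : X → ℂ} (hh : IsMeromorphic h) {M : Type*}
    [TopologicalSpace M] [ChartedSpace ℂ M] [IsManifold 𝓘(ℂ) ω M] {F : X → M}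
    (hF : MDifferentiable 𝓘(ℂ) 𝓘(ℂ) F) {e : OpenPartialHomeomorph M ℂ} (he : e ∈ atlas ℂ M)
    {x : X} (hx : F x ∈ e.source) :
    ∃ n : ℕ, (fun y => (e (F y) - e (F x)) ^ n * h y) =O[𝓝[≠] x] fun _ => (1 : ℂ) := by
  obtain ⟨n, hn⟩ := RiemannSurface.exists_pow_mul_isBigO (hh x)
    (analyticAt_comp_chartAt_symm hF he hx).differentiableAt
  refine ⟨n, ?_⟩
  obtain ⟨C, hC⟩ := hn.bound
  refine Asymptotics.IsBigO.of_bound C ((eventually_comp_symm x _).mp ?_)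
  filter_upwards [hC] with w hw
  simpa [(chartAt ℂ x).left_inv (mem_chart_source ℂ x)] using hw

theorem IsMeromorphic.eventually_continuousAt {h : X → ℂ} (hh : IsMeromorphic h) (x : X) :
    ∀ᶠ y in 𝓝[≠] x, ContinuousAt h y := by
  rw [← eventually_comp_symm]
  filter_upwards [(hh x).eventually_analyticAt, mem_nhdsWithin_of_mem_nhds
    ((chartAt ℂ x).open_target.mem_nhds (mem_chart_target ℂ x))] with w hw hwt
  have h1 : ContinuousAt ((h ∘ (chartAt ℂ x).symm) ∘ chartAt ℂ x) ((chartAt ℂ x).symm w) := by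
    refine ContinuousAt.comp ?_ ((chartAt ℂ x).continuousAt ((chartAt ℂ x).map_target hwt))
    rw [(chartAt ℂ x).right_inv hwt]
    exact hw.continuousAt
  refine h1.congr ?_
  filter_upwards [(chartAt ℂ x).open_source.mem_nhds ((chartAt ℂ x).map_target hwt)] with y hy
  simp [(chartAt ℂ x).left_inv hy]

end RiemannSurface

/-! ### Pulling back meromorphic functions to the upper half plane -/

namespace ModularCurve

open RiemannSurface

section

variable {Γ : Subgroup SL(2, ℤ)}

theorem tendsto_mk_point_nhdsNE (z : ℍ) :
    Tendsto (fun w : ℍ => (mk (.point w) : ModularCurve Γ)) (𝓝[≠] z) (𝓝[≠] (mk (.point z))) := by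
  refine tendsto_nhdsWithin_iff.mpr
    ⟨((continuous_mk.comp HStar.continuous_point).tendsto z).mono_left nhdsWithin_le_nhds, ?_⟩
  obtain ⟨U, hU, h⟩ := HStar.exists_nhds_smul_eq_self z
  filter_upwards [mem_nhdsWithin_of_mem_nhds hU, self_mem_nhdsWithin] with w hw hwz heq
  obtain ⟨γ, -, hγ⟩ := mk_eq_mk_iff.mp heq
  have h1 : γ • z = w := HStar.injective_point hγ
  exact hwz (h1.symm.trans (h γ z (mem_of_mem_nhds hU) (by rwa [h1])))

theorem tendsto_mk_point_codiscrete : Tendsto (fun w : ℍ => (mk (.point w) : ModularCurve Γ))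
    (codiscrete ℍ) (codiscrete (ModularCurve Γ)) := fun _ hs =>
  mem_codiscrete_iff.mpr fun z => tendsto_mk_point_nhdsNE z (mem_codiscrete_iff.mp hs _)

theorem tendsto_mk_smul_point_nhdsNE (σ : SL(2, ℤ)) :
    Tendsto (fun z : ℍ => (mk (σ • .point z) : ModularCurve Γ)) atImInfty
      (𝓝[≠] (mk (σ • .cusp OnePoint.infty))) := by
  refine tendsto_nhdsWithin_iff.mpr ⟨(continuous_mk.tendsto _).comp
    (HStar.tendsto_smul_point_atImInfty σ), .of_forall fun z heq => ?_⟩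
  obtain ⟨γ, -, hγ⟩ := mk_eq_mk_iff.mp heq
  rw [← mul_smul, HStar.smul_cusp, HStar.smul_point] at hγ
  exact absurd hγ (by simp)

/-- The cusps are isolated. -/
theorem eventually_exists_mk_point_eq :
    ∀ᶠ x in codiscrete (ModularCurve Γ), ∃ z : ℍ, mk (.point z) = x := by
  refine mem_codiscrete_iff.mpr fun x => ?_
  obtain ⟨p, rfl⟩ := isOpenQuotientMap_mk.surjective x
  rcases p with z | c
  · refine mem_nhdsWithin_of_mem_nhds ?_
    have : Set.range (mk ∘ HStar.point : ℍ → ModularCurve Γ) ∈ 𝓝 (mk (.point z)) :=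
      (isOpenQuotientMap_mk.isOpenMap.comp HStar.isOpenMap_point).isOpen_range.mem_nhds ⟨z, rfl⟩
    exact this
  · obtain ⟨σ, hσ⟩ := HStar.exists_smul_cusp_infty c
    rw [← hσ]
    have h1 : (mk '' HStar.horoball σ 0 : Set (ModularCurve Γ)) ∈
        𝓝 (mk (σ • .cusp OnePoint.infty)) :=
      isOpenQuotientMap_mk.isOpenMap.image_mem_nhds
        ((HStar.isOpen_horoball σ 0).mem_nhds (HStar.smul_cusp_mem_horoball σ 0))
    filter_upwards [mem_nhdsWithin_of_mem_nhds h1, self_mem_nhdsWithin] with y hy hne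
    obtain ⟨p, rfl | ⟨z, -, rfl⟩, rfl⟩ := hy
    · exact absurd rfl hne
    · exact ⟨σ • z, rfl⟩

variable [Γ.FiniteIndex]

theorem meromorphicAt_comp_mk {h : ModularCurve Γ → ℂ} (hh : IsMeromorphic h) (z : ℍ) :
    MeromorphicAt (fun w : ℂ => h (mk (.point (ofComplex w)))) z := by
  set x : ModularCurve Γ := mk (.point z)
  have hc : ContinuousAt (fun w : ℂ => (mk (.point (ofComplex w)) : ModularCurve Γ)) (z : ℂ) := by
    have h4 : MDifferentiableAt 𝓘(ℂ) 𝓘(ℂ) ofComplex (z : ℂ) := mdifferentiableAt_ofComplex z.im_pos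
    exact (continuous_mk.comp HStar.continuous_point).continuousAt.comp h4.continuousAt
  have hs : ∀ᶠ w : ℂ in 𝓝 (z : ℂ), mk (.point (ofComplex w)) ∈ (chartAt ℂ x).source := by
    refine hc.preimage_mem_nhds ((chartAt ℂ x).open_source.mem_nhds ?_)
    rw [ofComplex_apply]
    exact mem_chart_source ℂ x
  have ha : AnalyticAt ℂ (fun w : ℂ => chartAt ℂ x (mk (.point (ofComplex w)))) z := by
    rw [Complex.analyticAt_iff_eventually_differentiableAt]
    filter_upwards [hs, isOpen_upperHalfPlaneSet.mem_nhds z.im_pos] with w hw hw0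
    rw [← mdifferentiableAt_iff_differentiableAt]
    have h1 := mdifferentiableAt_atlas (I := 𝓘(ℂ)) (chart_mem_atlas ℂ x) hw
    exact MDifferentiableAt.comp w h1 ((mdifferentiable_mk_point _).comp w
      (mdifferentiableAt_ofComplex hw0))
  have hm := hh x
  have he : chartAt ℂ x (mk (.point (ofComplex (z : ℂ)))) = chartAt ℂ x x := by
    rw [ofComplex_apply]
  rw [← he] at hm
  refine (MeromorphicAt.comp_analyticAt
    (g := fun w : ℂ => chartAt ℂ x (mk (.point (ofComplex w)))) hm ha).congr ?_
  filter_upwards [hs.filter_mono nhdsWithin_le_nhds] with w hw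
  simp [(chartAt ℂ x).left_inv hw]

end

end ModularCurve

/-- A meromorphic function on `ℍ` which is locally bounded extends holomorphically. -/
theorem UpperHalfPlane.exists_mdifferentiable_of_isBigO {K : ℍ → ℂ}
    (hK : ∀ z : ℍ, MeromorphicAt (fun w : ℂ => K (ofComplex w)) z)
    (hb : ∀ z : ℍ, K =O[𝓝[≠] z] fun _ => (1 : ℂ)) :
    ∃ p : ℍ → ℂ, MDifferentiable 𝓘(ℂ) 𝓘(ℂ) p ∧ ∀ z : ℍ, p =ᶠ[𝓝[≠] z] K := by
  have hmer : MeromorphicOn (fun w : ℂ => K (ofComplex w)) {w : ℂ | 0 < w.im} :=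
    fun w hw => hK ⟨w, hw⟩
  have hmap : ∀ z : ℍ, Tendsto ofComplex (𝓝[≠] (z : ℂ)) (𝓝[≠] z) := fun z => by
    have h4 : MDifferentiableAt 𝓘(ℂ) 𝓘(ℂ) ofComplex (z : ℂ) := mdifferentiableAt_ofComplex z.im_pos
    have h5 := h4.continuousAt.tendsto
    rw [ofComplex_apply] at h5
    refine tendsto_nhdsWithin_iff.mpr ⟨h5.mono_left nhdsWithin_le_nhds, ?_⟩
    filter_upwards [mem_nhdsWithin_of_mem_nhds (isOpen_upperHalfPlaneSet.mem_nhds z.im_pos),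
      self_mem_nhdsWithin] with w hw hne heq
    rw [ofComplex_apply_of_im_pos hw] at heq
    exact hne (congrArg UpperHalfPlane.coe heq)
  refine ⟨fun z => toMeromorphicNFOn (fun w : ℂ => K (ofComplex w)) {w : ℂ | 0 < w.im} z, ?_,
    fun z => ?_⟩
  · rw [UpperHalfPlane.mdifferentiable_iff]
    have han : ∀ w ∈ {w : ℂ | 0 < w.im}, AnalyticAt ℂ
        (toMeromorphicNFOn (fun w : ℂ => K (ofComplex w)) {w : ℂ | 0 < w.im}) w := by
      intro w hw
      rw [← (meromorphicNFOn_toMeromorphicNFOn _ _ hw).meromorphicOrderAt_nonneg_iff_analyticAt,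
        meromorphicOrderAt_toMeromorphicNFOn hmer hw]
      by_contra hneg
      have h1 := tendsto_norm_atTop_iff_cobounded.mpr
        (tendsto_cobounded_of_meromorphicOrderAt_neg (not_le.mp hneg))
      have h2 := ((hb ⟨w, hw⟩).comp_tendsto (hmap ⟨w, hw⟩)).bound
      obtain ⟨C, hC⟩ := h2
      obtain ⟨u, hu1, hu2⟩ := ((h1.eventually_gt_atTop C).and hC).exists
      simp only [Function.comp_apply, norm_one, mul_one] at hu2
      exact hu1.not_ge hu2
    refine DifferentiableOn.congr (fun w hw => (han w hw).differentiableAt.differentiableWithinAt)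
      fun w hw => ?_
    rw [Function.comp_apply, ofComplex_apply_of_im_pos hw]
  · have h1 := hmer.toMeromorphicNFOn_eq_self_on_nhdsNE (x := (z : ℂ)) z.im_pos
    have h2 : Tendsto (UpperHalfPlane.coe) (𝓝[≠] z) (𝓝[≠] (z : ℂ)) :=
      tendsto_nhdsWithin_iff.mpr ⟨(continuous_coe.tendsto z).mono_left nhdsWithin_le_nhds, by
        filter_upwards [self_mem_nhdsWithin] with w hw h
        exact hw (UpperHalfPlane.ext h)⟩
    filter_upwards [h2.eventually h1] with w hw
    rw [hw, ofComplex_apply]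

theorem tendsto_SL_smul_nhdsNE (σ : SL(2, ℤ)) (z : ℍ) :
    Tendsto (fun w : ℍ => σ • w) (𝓝[≠] z) (𝓝[≠] (σ • z)) :=
  tendsto_nhdsWithin_iff.mpr
    ⟨((continuous_const_smul σ).tendsto z).mono_left nhdsWithin_le_nhds, by
      filter_upwards [self_mem_nhdsWithin] with w hw h
      exact hw (smul_left_cancel σ h)⟩

/-- Changing a function on a closed discrete set does not affect the growth of the continuous
extension. -/
theorem HasExpGrowth.of_eventuallyEq {p K : ℍ → ℂ} (hp : Continuous p)
    (h : ∀ z : ℍ, p =ᶠ[𝓝[≠] z] K) (hK : HasExpGrowth K) : HasExpGrowth p := by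
  obtain ⟨A, hA⟩ := hK
  refine ⟨A, ?_⟩
  obtain ⟨C, hC⟩ := hA.bound
  obtain ⟨B, hB⟩ := (atImInfty_mem _).mp hC
  refine Asymptotics.IsBigO.of_bound C ((atImInfty_mem _).mpr ⟨B + 1, fun z hz => ?_⟩)
  have h1 : ∀ᶠ w in 𝓝[≠] z, ‖p w‖ ≤ C * ‖Real.exp (A * w.im)‖ := by
    have h2 : ∀ᶠ w in 𝓝 z, B < w.im :=
      continuous_im.continuousAt.eventually_const_lt (by linarith)
    filter_upwards [h z, h2.filter_mono nhdsWithin_le_nhds] with w hw hw2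
    rw [hw]
    exact hB w hw2.le
  refine le_of_tendsto_of_tendsto (hp.norm.continuousAt.tendsto.mono_left nhdsWithin_le_nhds) ?_ h1
  refine Tendsto.mono_left (ContinuousAt.tendsto ?_) nhdsWithin_le_nhds
  have := continuous_im
  fun_prop

namespace ModularCurve

open RiemannSurface

variable (N : ℕ) [NeZero N]

/-- The poles of a meromorphic function on `X₀(N)` in `ℍ` are cancelled by a polynomial in `j`. -/
theorem exists_eval_jFunction_mul_isBigO {h : X₀ N → ℂ} (hh : IsMeromorphic h) :
    ∃ P : Polynomial ℂ, P ≠ 0 ∧ ∀ z : ℍ,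
      (fun w : ℍ => P.eval (jFunction w) * h (mk (.point w))) =O[𝓝[≠] z] fun _ => (1 : ℂ) := by
  have hj : ∀ (P : Polynomial ℂ) (z : ℍ),
      (fun w : ℍ => P.eval (jFunction w)) =O[𝓝[≠] z] fun _ => (1 : ℂ) := fun P z =>
    (((P.continuous.comp mdifferentiable_jFunction.continuous).tendsto z).mono_left
      nhdsWithin_le_nhds).isBigO_one ℂ
  suffices H : ∃ P : Polynomial ℂ, P ≠ 0 ∧ ∀ z : ℍ, (mk (.point z) : X₀ N) ∈ Set.univ →
      (fun w : ℍ => P.eval (jFunction w) * h (mk (.point w))) =O[𝓝[≠] z] fun _ => (1 : ℂ) by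
    simpa using H
  refine isCompact_univ.induction_on (p := fun s : Set (X₀ N) => ∃ P : Polynomial ℂ, P ≠ 0 ∧
      ∀ z : ℍ, (mk (.point z) : X₀ N) ∈ s →
      (fun w : ℍ => P.eval (jFunction w) * h (mk (.point w))) =O[𝓝[≠] z] fun _ => (1 : ℂ))
    ?_ ?_ ?_ fun x _ => ?_
  · exact ⟨1, one_ne_zero, fun z hz => absurd hz (Set.notMem_empty _)⟩
  · rintro s t hst ⟨P, hP, h1⟩
    exact ⟨P, hP, fun z hz => h1 z (hst hz)⟩
  · rintro s t ⟨P, hP, h1⟩ ⟨Q, hQ, h2⟩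
    refine ⟨P * Q, mul_ne_zero hP hQ, fun z hz => ?_⟩
    rcases hz with hz | hz
    · refine ((hj Q z).mul (h1 z hz)).congr (fun w => ?_) fun w => mul_one 1
      rw [Polynomial.eval_mul]
      ring
    · refine ((hj P z).mul (h2 z hz)).congr (fun w => ?_) fun w => mul_one 1
      rw [Polynomial.eval_mul]
      ring
  · have h1 : ∀ᶠ y in 𝓝 x, y ≠ x → ContinuousAt h y :=
      eventually_nhdsWithin_iff.mp (hh.eventually_continuousAt x)
    have h2 : ∀ z : ℍ, ContinuousAt h (mk (.point z)) →
        (fun w : ℍ => h (mk (.point w))) =O[𝓝[≠] z] fun _ => (1 : ℂ) := fun z hz =>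
      ((hz.tendsto.mono_left nhdsWithin_le_nhds).comp
        (tendsto_mk_point_nhdsNE z)).isBigO_one ℂ
    obtain ⟨P, hP, h3⟩ : ∃ P : Polynomial ℂ, P ≠ 0 ∧ ∀ z : ℍ, mk (.point z) = x →
        (fun w : ℍ => P.eval (jFunction w) * h (mk (.point w))) =O[𝓝[≠] z] fun _ => (1 : ℂ) := by
      by_cases hx : ∃ z₀ : ℍ, mk (.point z₀) = x
      · obtain ⟨z₀, rfl⟩ := hx
        obtain ⟨n, hn⟩ := hh.exists_pow_mul_isBigO (isBelyiFunction_belyiF N).holomorphic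
          (e := RiemannSphere.chartZero) (Or.inl rfl) (x := mk (.point z₀))
          (by rw [RiemannSphere.chartZero_source]; exact ⟨_, rfl⟩)
        refine ⟨(Polynomial.X - Polynomial.C (jFunction z₀)) ^ n,
          pow_ne_zero n (Polynomial.X_sub_C_ne_zero _), fun z hz => ?_⟩
        have h4 := tendsto_mk_point_nhdsNE (Γ := CongruenceSubgroup.Gamma0 N) z
        rw [hz] at h4
        refine ((hn.comp_tendsto h4).const_mul_left (1728 ^ n)).congr_left fun w => ?_
        simp only [Function.comp_apply, belyiF_mk_point, RiemannSphere.chartZero_coe,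
          Polynomial.eval_pow, Polynomial.eval_sub, Polynomial.eval_X, Polynomial.eval_C]
        rw [← mul_assoc, ← mul_pow]
        congr 2
        ring
      · exact ⟨1, one_ne_zero, fun z hz => absurd ⟨z, hz⟩ hx⟩
    refine ⟨_, mem_nhdsWithin_of_mem_nhds h1, P, hP, fun z hz => ?_⟩
    by_cases hzx : mk (.point z) = x
    · exact h3 z hzx
    · exact ((hj P z).mul (h2 z (hz hzx))).congr_right fun w => mul_one 1

/-- A meromorphic function on `X₀(N)` grows at most exponentially at each cusp: its pole there is
compensated by a power of `1 / f`, and `f` grows exponentially. -/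
theorem hasExpGrowth_of_isMeromorphic {h : X₀ N → ℂ} (hh : IsMeromorphic h) (σ : SL(2, ℤ)) :
    HasExpGrowth fun z : ℍ => h (mk (σ • .point z)) := by
  obtain ⟨n, hn⟩ := hh.exists_pow_mul_isBigO (isBelyiFunction_belyiF N).holomorphic
    (e := RiemannSphere.chartInfty) (Or.inr rfl) (x := mk (σ • .cusp OnePoint.infty))
    (by rw [belyiF_mk_smul_cusp, RiemannSphere.mem_chartInfty_source]; exact ⟨0, rfl⟩)
  have h1 := hn.comp_tendsto (tendsto_mk_smul_point_nhdsNE σ)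
  have hj := jFunction_isBigO.pow n
  refine ⟨n * (2 * Real.pi), ?_⟩
  refine (((hj.const_mul_left ((1728 : ℂ)⁻¹ ^ n)).mul h1.norm_right).congr' ?_ ?_)
  · filter_upwards [tendsto_norm_jFunction.eventually_gt_atTop 0] with z hz
    have hz' : jFunction z / 1728 ≠ 0 := div_ne_zero (norm_pos_iff.mp hz) (by norm_num)
    have h2 : belyiF N (mk (σ • .point z)) = ((jFunction z / 1728 : ℂ) : OnePoint ℂ) := by
      rw [← jFunction_smul σ]
      rfl
    simp only [Function.comp_apply, h2, belyiF_mk_smul_cusp, RiemannSphere.chartInfty_apply,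
      RiemannSphere.inversion_infty, RiemannSphere.chartZero_coe, sub_zero,
      RiemannSphere.inversion_coe hz']
    rw [← mul_assoc, ← mul_pow, ← mul_pow]
    have hz'' : jFunction z ≠ 0 := norm_pos_iff.mp hz
    rw [show (1728 : ℂ)⁻¹ * jFunction z * (jFunction z / 1728)⁻¹ = 1 by field_simp, one_pow,
      one_mul]
  · filter_upwards with z
    simp only [Function.comp_apply, norm_one, mul_one]
    rw [← Real.exp_nat_mul, ← mul_assoc]

/-- Up to a polynomial in `j`, a meromorphic function on `X₀(N)` is a `Γ₀(N)`-invariant holomorphic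
function on `ℍ` of exponential growth at the cusps. -/
theorem exists_eq_eval_jFunction_mul {h : X₀ N → ℂ} (hh : IsMeromorphic h) :
    ∃ (P : Polynomial ℂ) (p : cuspAlgebra), P ≠ 0 ∧
      (∀ γ ∈ CongruenceSubgroup.Gamma0 N, ∀ z : ℍ, p.1 (γ • z) = p.1 z) ∧
      ∀ᶠ z in codiscrete ℍ, p.1 z = P.eval (jFunction z) * h (mk (.point z)) := by
  obtain ⟨P, hP, hb⟩ := exists_eval_jFunction_mul_isBigO N hh
  obtain ⟨p, hp, hpK⟩ := UpperHalfPlane.exists_mdifferentiable_of_isBigO (fun z => by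
    refine MeromorphicAt.mul ?_ (meromorphicAt_comp_mk hh z)
    have h1 := (UpperHalfPlane.mdifferentiable_iff.mp mdifferentiable_jFunction).analyticAt
      (isOpen_upperHalfPlaneSet.mem_nhds z.im_pos)
    exact ((Polynomial.differentiable P).analyticAt _ |>.comp h1).meromorphicAt) hb
  refine ⟨P, ⟨p, hp, fun σ => ?_⟩, hP, fun γ hγ z => ?_, mem_codiscrete_iff.mpr hpK⟩
  · refine HasExpGrowth.of_eventuallyEq (hp.continuous.comp (continuous_const_smul σ))
      (fun z => (tendsto_SL_smul_nhdsNE σ z).eventually (hpK (σ • z))) ?_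
    refine HasExpGrowth.mul ?_ (hasExpGrowth_of_isMeromorphic N hh σ)
    have h1 := (Polynomial.aeval cuspAlgebra.j P).2.2 σ
    simpa only [cuspAlgebra.aeval_apply] using! h1
  · have h1 := (tendsto_SL_smul_nhdsNE γ z).eventually (hpK (γ • z))
    have h2 : ∀ᶠ w in 𝓝[≠] z, p (γ • w) = p w := by
      filter_upwards [h1, hpK z] with w hw hw'
      rw [hw, hw', jFunction_smul]
      exact congrArg (fun x => P.eval (jFunction w) * h x) (mk_smul hγ (.point w))
    exact tendsto_nhds_unique_of_eventuallyEq
      (((hp.continuous.comp (continuous_const_smul γ)).tendsto z).mono_left nhdsWithin_le_nhds)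
      ((hp.continuous.tendsto z).mono_left nhdsWithin_le_nhds) h2

end ModularCurve

/-! ### The function field of `X₀(N)` -/

/-- If `k(F) = k(x)` with `x` transcendental, and if the relations between `x` and `y` are the
multiples of a polynomial `Φ(x, Y)` monic in `Y`, then this is the minimal polynomial of `y` over
`k(F)`; this is Gauss's lemma for the integrally closed ring `k[x]`. -/
theorem minpoly_eq_map_aeval {k L : Type*} [Field k] [Field L] [Algebra k L] {F y : L}
    {x : IntermediateField.adjoin k {F}}
    (hx : Function.Injective (Polynomial.aeval (x : L) : Polynomial k →ₐ[k] L))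
    {q : Polynomial k} (hq : F = Polynomial.aeval (x : L) q) {Φ : Polynomial (Polynomial k)}
    (hm : Φ.Monic) (hΦ : ∀ P : Polynomial (Polynomial k),
      P.eval₂ (Polynomial.aeval (x : L)).toRingHom y = 0 ↔ Φ ∣ P) :
    minpoly (IntermediateField.adjoin k {F}) y = Φ.map (Polynomial.aeval x).toRingHom := by
  let _ : Algebra (Polynomial k) (IntermediateField.adjoin k {F}) :=
    (Polynomial.aeval x).toRingHom.toAlgebra
  let _ : Algebra (Polynomial k) L := (Polynomial.aeval (x : L)).toRingHom.toAlgebra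
  have htower : ∀ p : Polynomial k, Polynomial.aeval (x : L) p = ((Polynomial.aeval x p :
      IntermediateField.adjoin k {F}) : L) := fun p =>
    Polynomial.aeval_algebraMap_apply L x p
  have : IsScalarTower (Polynomial k) (IntermediateField.adjoin k {F}) L :=
    .of_algebraMap_eq htower
  have hx' : Function.Injective (algebraMap (Polynomial k) (IntermediateField.adjoin k {F})) :=
    fun a b hab => hx (by rw [htower, htower]; exact congrArg _ hab)
  have : FaithfulSMul (Polynomial k) (IntermediateField.adjoin k {F}) :=
    (faithfulSMul_iff_algebraMap_injective _ _).mpr hx'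
  have : Module.IsTorsionFree (Polynomial k) L :=
    Module.isTorsionFree_iff_algebraMap_injective.mpr hx
  have : IsFractionRing (Polynomial k) (IntermediateField.adjoin k {F}) := by
    refine IsFractionRing.of_field _ _ fun z => ?_
    obtain ⟨r, s, hz⟩ := (IntermediateField.mem_adjoin_simple_iff k (z : L)).mp z.2
    refine ⟨r.comp q, s.comp q, Subtype.ext ?_⟩
    have h : ∀ p : Polynomial k, Polynomial.aeval F p =
        ((Polynomial.aeval x (p.comp q) : IntermediateField.adjoin k {F}) : L) := fun p => by
      rw [← htower, Polynomial.aeval_comp, ← hq]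
    rw [hz, h, h]
    rfl
  have hint : IsIntegral (Polynomial k) y := ⟨Φ, hm, (hΦ Φ).mpr dvd_rfl⟩
  rw [minpoly.isIntegrallyClosed_eq_field_fractions' (IntermediateField.adjoin k {F}) hint]
  congr 1
  refine Polynomial.eq_of_monic_of_associated (minpoly.monic hint) hm
    (associated_of_dvd_dvd ?_ ?_)
  · exact minpoly.isIntegrallyClosed_dvd hint ((hΦ Φ).mpr dvd_rfl)
  · exact (hΦ _).mp (minpoly.aeval _ y)

theorem IntermediateField.eval₂_aeval_mem {k L : Type*} [Field k] [Field L] [Algebra k L]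
    {K : IntermediateField k L} {x y : L} (hx : x ∈ K) (hy : y ∈ K)
    (P : Polynomial (Polynomial k)) : P.eval₂ (Polynomial.aeval x).toRingHom y ∈ K := by
  have h1 : ∀ p : Polynomial k, Polynomial.aeval x p ∈ K := fun p => by
    have h := Polynomial.aeval_algebraMap_apply L (⟨x, hx⟩ : K) p
    have h' : Polynomial.aeval x p = ((Polynomial.aeval (⟨x, hx⟩ : K) p : K) : L) := h
    rw [h']
    exact SetLike.coe_mem _
  rw [Polynomial.eval₂_eq_sum_range]
  exact sum_mem fun i _ => mul_mem (h1 _) (pow_mem hy i)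

namespace ModularCurve

open RiemannSurface

section Pullback

variable {Γ : Subgroup SL(2, ℤ)} [Γ.FiniteIndex]

/-- The pullback of meromorphic functions on `X(Γ)` to `ℍ`, up to equality outside a closed
discrete set. -/
noncomputable def pullback : FunctionField (ModularCurve Γ) →+* Germ (codiscrete ℍ) ℂ where
  toFun φ := φ.1.compTendsto (fun z => mk (.point z)) tendsto_mk_point_codiscrete
  map_one' := rfl
  map_mul' := by
    rintro ⟨_, a, -, rfl⟩ ⟨_, b, -, rfl⟩
    rfl
  map_zero' := rfl
  map_add' := by
    rintro ⟨_, a, -, rfl⟩ ⟨_, b, -, rfl⟩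
    rfl

theorem pullback_mk {φ : FunctionField (ModularCurve Γ)} {h : ModularCurve Γ → ℂ}
    (hφ : φ.1 = (h : Germ (codiscrete (ModularCurve Γ)) ℂ)) :
    pullback φ = ((fun z => h (mk (.point z)) : ℍ → ℂ) : Germ (codiscrete ℍ) ℂ) := by
  change φ.1.compTendsto _ tendsto_mk_point_codiscrete = _
  rw [hφ]
  rfl

theorem pullback_eq_of_represents {φ : FunctionField (ModularCurve Γ)}
    {F : ModularCurve Γ → OnePoint ℂ} (hφ : φ.Represents F) {u : ℍ → ℂ}
    (hu : ∀ z, F (mk (.point z)) = (u z : OnePoint ℂ)) :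
    pullback φ = (u : Germ (codiscrete ℍ) ℂ) := by
  obtain ⟨h, hF, hφ⟩ := hφ
  rw [pullback_mk hφ]
  refine Germ.coe_eq.mpr ?_
  filter_upwards [tendsto_mk_point_codiscrete.eventually hF] with z hz
  rw [hu] at hz
  exact (OnePoint.coe_injective hz).symm

instance : NeBot (codiscrete ℍ) :=
  ⟨fun h => by
    have h1 : (∅ : Set ℍ) ∈ codiscrete ℍ := by rw [h]; exact mem_bot
    exact NeBot.ne (f := 𝓝[≠] I) inferInstance (empty_mem_iff_bot.mp (mem_codiscrete_iff.mp h1 I))⟩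

theorem pullback_injective : Function.Injective (pullback (Γ := Γ)) := pullback.injective

end Pullback

/-- A function in `cuspAlgebra` as a function up to equality outside a closed discrete set. -/
noncomputable def toGerm : cuspAlgebra →+* Germ (codiscrete ℍ) ℂ :=
  (Germ.coeRingHom (codiscrete ℍ)).comp cuspAlgebra.val.toRingHom

theorem toGerm_apply (f : cuspAlgebra) : toGerm f = (f.1 : Germ (codiscrete ℍ) ℂ) := rfl

theorem toGerm_injective : Function.Injective toGerm := by
  rw [injective_iff_map_eq_zero]
  intro f hf
  have h1 : ∀ᶠ z in codiscrete ℍ, f.1 z = 0 := Germ.coe_eq.mp hf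
  refine cuspAlgebra.ext_apply fun z => ?_
  exact tendsto_nhds_unique_of_eventuallyEq
    (((cuspAlgebra.mdifferentiable f).continuous.tendsto z).mono_left nhdsWithin_le_nhds)
    tendsto_const_nhds (mem_codiscrete_iff.mp h1 z)

theorem eventually_belyiF_ne_infty {N : ℕ} :
    ∀ᶠ x in codiscrete (X₀ N), belyiF N x ≠ OnePoint.infty := by
  filter_upwards [eventually_exists_mk_point_eq] with x hx
  obtain ⟨z, rfl⟩ := hx
  exact OnePoint.coe_ne_infty _

variable {N : ℕ} [NeZero N]

theorem eventually_belyiG_ne_infty : ∀ᶠ x in codiscrete (X₀ N), belyiG N x ≠ OnePoint.infty := by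
  filter_upwards [eventually_exists_mk_point_eq] with x hx
  obtain ⟨z, rfl⟩ := hx
  exact OnePoint.coe_ne_infty _

theorem pullback_belyiF {F : FunctionField (X₀ N)} (hF : F.Represents (belyiF N)) :
    pullback (1728 * F) = toGerm cuspAlgebra.j := by
  rw [map_mul, pullback_eq_of_represents hF (fun z => rfl), map_ofNat, toGerm_apply]
  refine congrArg (fun f : ℍ → ℂ => (f : Germ (codiscrete ℍ) ℂ)) (funext fun z => ?_)
  exact mul_div_cancel₀ _ (by norm_num)

theorem pullback_belyiG {G : FunctionField (X₀ N)} (hG : G.Represents (belyiG N)) :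
    pullback (1728 * G) = toGerm (cuspAlgebra.jScale N) := by
  rw [map_mul, pullback_eq_of_represents hG (fun z => rfl), map_ofNat, toGerm_apply]
  refine congrArg (fun f : ℍ → ℂ => (f : Germ (codiscrete ℍ) ℂ)) (funext fun z => ?_)
  exact mul_div_cancel₀ _ (by norm_num)

theorem pullback_eval₂ {x y : FunctionField (X₀ N)} {g : cuspAlgebra}
    (hx : pullback x = toGerm cuspAlgebra.j) (hy : pullback y = toGerm g)
    (P : Polynomial (Polynomial ℂ)) :
    pullback (P.eval₂ (Polynomial.aeval x).toRingHom y) = toGerm (cuspAlgebra.evalPair g P) := by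
  have h : (pullback.comp (Polynomial.eval₂RingHom (Polynomial.aeval x).toRingHom y)) =
      toGerm.comp (cuspAlgebra.evalPair g) := by
    refine Polynomial.ringHom_ext' (Polynomial.ringHom_ext' ?_ ?_) ?_
    · ext c
      simp
      rfl
    · simpa using hx
    · simpa using hy
  exact congrArg (fun f => f P) h

theorem eval₂_eq_zero_iff {x y : FunctionField (X₀ N)} {g : cuspAlgebra}
    (hx : pullback x = toGerm cuspAlgebra.j) (hy : pullback y = toGerm g)
    (P : Polynomial (Polynomial ℂ)) :
    P.eval₂ (Polynomial.aeval x).toRingHom y = 0 ↔ cuspAlgebra.evalPair g P = 0 := by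
  rw [← map_eq_zero_iff pullback pullback_injective, pullback_eval₂ hx hy,
    map_eq_zero_iff toGerm toGerm_injective]

theorem aeval_injective_of_pullback_eq {x : FunctionField (X₀ N)}
    (hx : pullback x = toGerm cuspAlgebra.j) :
    Function.Injective (Polynomial.aeval x : Polynomial ℂ →ₐ[ℂ] FunctionField (X₀ N)) := by
  rw [injective_iff_map_eq_zero]
  intro p hp
  have h1 := (eval₂_eq_zero_iff hx hx (Polynomial.C p)).mp (by
    rw [Polynomial.eval₂_C]
    exact hp)
  rw [cuspAlgebra.evalPair, Polynomial.coe_eval₂RingHom, Polynomial.eval₂_C] at h1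
  exact (map_eq_zero_iff _ cuspAlgebra.aeval_j_injective).mp h1

/-- The functions `f` and `g` generate the function field of `X₀(N)`. -/
theorem adjoin_eq_top {F G : FunctionField (X₀ N)} (hF : F.Represents (belyiF N))
    (hG : G.Represents (belyiG N)) : IntermediateField.adjoin ℂ {F, G} = ⊤ := by
  have hx := pullback_belyiF hF
  have hy := pullback_belyiG hG
  set x := 1728 * F with hxF
  set y := 1728 * G with hyG
  set K := IntermediateField.adjoin ℂ {F, G} with hK
  have h1728 : (1728 : FunctionField (X₀ N)) ∈ K := natCast_mem K 1728
  have hxK : x ∈ K := mul_mem h1728 (IntermediateField.subset_adjoin _ _ (by simp))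
  have hyK : y ∈ K := mul_mem h1728 (IntermediateField.subset_adjoin _ _ (by simp))
  rw [eq_top_iff]
  intro φ _
  obtain ⟨h, hh, hφ⟩ := φ.2
  obtain ⟨P, p, hP, hp, hph⟩ := exists_eq_eval_jFunction_mul N hh
  obtain ⟨δ, hδ, hL⟩ := cuspAlgebra.exists_evalPair_eq_mul (cuspAlgebra.jScale_smul N)
    (cuspAlgebra.conjugate_jScale_injective N)
  obtain ⟨L, hL'⟩ := hL p hp
  obtain ⟨D, hD⟩ := hL 1 fun _ _ _ => rfl
  rw [one_mul] at hD
  have hmain : (Polynomial.C P).eval₂ (Polynomial.aeval x).toRingHom y * φ *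
      D.eval₂ (Polynomial.aeval x).toRingHom y = L.eval₂ (Polynomial.aeval x).toRingHom y := by
    apply pullback_injective
    rw [map_mul, map_mul, pullback_eval₂ hx hy, pullback_eval₂ hx hy, pullback_eval₂ hx hy, hL',
      hD, map_mul]
    congr 1
    rw [pullback_mk hφ, toGerm_apply, toGerm_apply, ← Germ.coe_mul]
    refine Germ.coe_eq.mpr ?_
    filter_upwards [hph] with z hz
    rw [hz, Pi.mul_apply, cuspAlgebra.evalPair_apply, Polynomial.evalEval_C]
  have hDne : D.eval₂ (Polynomial.aeval x).toRingHom y ≠ 0 := by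
    rw [Ne, eval₂_eq_zero_iff hx hy, hD]
    exact hδ
  have hPne : (Polynomial.C P).eval₂ (Polynomial.aeval x).toRingHom y ≠ 0 := by
    rw [Polynomial.eval₂_C]
    exact (map_ne_zero_iff _ (aeval_injective_of_pullback_eq hx)).mpr hP
  have hφ' : φ = L.eval₂ (Polynomial.aeval x).toRingHom y /
      ((Polynomial.C P).eval₂ (Polynomial.aeval x).toRingHom y *
        D.eval₂ (Polynomial.aeval x).toRingHom y) := by
    rw [eq_div_iff (mul_ne_zero hPne hDne), ← hmain]
    ring
  rw [hφ']
  exact div_mem (IntermediateField.eval₂_aeval_mem hxK hyK L)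
    (mul_mem (IntermediateField.eval₂_aeval_mem hxK hyK _)
      (IntermediateField.eval₂_aeval_mem hxK hyK D))

end ModularCurve

/-! ### The modular equation -/

section ModularEquation

variable (N : ℕ) [NeZero N]

theorem evalPair_jScale_eq_zero_iff (P : Polynomial (Polynomial ℂ)) :
    cuspAlgebra.evalPair (cuspAlgebra.jScale N) P = 0 ↔
      ∀ z : ℍ, P.evalEval (jFunction z) (jFunction (scale N z)) = 0 := by
  constructor
  · intro h z
    rw [← cuspAlgebra.jScale_apply, ← cuspAlgebra.evalPair_apply, h]
    rfl
  · intro h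
    refine cuspAlgebra.ext_apply fun z => ?_
    rw [cuspAlgebra.evalPair_apply]
    exact h z

/-- The modular equation exists: it is the polynomial whose roots are the conjugates of
`j(N z)`. -/
theorem exists_isModularEquation : ∃ Φ, IsModularEquation N Φ := by
  obtain ⟨Φ, hm, hΦ⟩ := cuspAlgebra.exists_monic_evalPair_eq_zero_iff (cuspAlgebra.jScale_smul N)
    (cuspAlgebra.conjugate_jScale_injective N)
  exact ⟨Φ, hm, fun P => by rw [← evalPair_jScale_eq_zero_iff, hΦ]⟩

theorem Polynomial.eval_eval_X (a : ℂ) (P : Polynomial (Polynomial ℂ)) :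
    (P.eval Polynomial.X).eval a = P.evalEval a a := by
  have h : (Polynomial.evalRingHom a).comp (Polynomial.evalRingHom Polynomial.X) =
      Polynomial.evalEvalRingHom a a := by
    refine Polynomial.ringHom_ext' (Polynomial.ringHom_ext' ?_ ?_) ?_
    · ext c
      simp
    · simp
    · simp
  exact congrArg (fun f => f P) h

theorem Polynomial.evalEval_swap (a b : ℂ) (P : Polynomial (Polynomial ℂ)) :
    (Polynomial.Bivariate.swap P).evalEval a b = P.evalEval b a := by
  rw [← Polynomial.coe_aevalAeval_eq_evalEval, ← Polynomial.coe_aevalAeval_eq_evalEval]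
  exact Polynomial.Bivariate.aevalAeval_swap a b P

variable {N}

/-- The modular equation is symmetric, because the Fricke involution interchanges `j(z)` and
`j(N z)`. -/
theorem IsModularEquation.swap_eq {Φ : Polynomial (Polynomial ℂ)} (hΦ : IsModularEquation N Φ)
    (hN : 2 ≤ N) : Polynomial.Bivariate.swap Φ = Φ := by
  obtain ⟨hm, hrel⟩ := hΦ
  have h0 : Φ ≠ 0 := hm.ne_zero
  obtain ⟨Q, hQ⟩ : Φ ∣ Polynomial.Bivariate.swap Φ := by
    rw [← hrel]
    intro z
    rw [Polynomial.evalEval_swap]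
    have h1 := (hrel Φ).mpr dvd_rfl (ModularGroup.S • scale N z)
    have h2 : jFunction (scale N (ModularGroup.S • scale N z)) = jFunction z := by
      rw [← jFunction_smul ModularGroup.S, S_smul_scale_S_smul_scale]
    rwa [jFunction_smul, h2] at h1
  have hQ2 : Q * Polynomial.Bivariate.swap Q = 1 := by
    have h1 := congrArg Polynomial.Bivariate.swap hQ
    rw [Polynomial.Bivariate.swap_swap_apply, map_mul, hQ, mul_assoc] at h1
    exact mul_left_cancel₀ h0 (h1.symm.trans (mul_one Φ).symm)
  -- a unit of `ℂ[X, Y]` is a constant, here of square `1`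
  obtain ⟨r, hr, rfl⟩ := Polynomial.isUnit_iff.mp (IsUnit.of_mul_eq_one _ hQ2)
  obtain ⟨c, -, rfl⟩ := Polynomial.isUnit_iff.mp hr
  rw [Polynomial.Bivariate.swap_C_C, ← Polynomial.C_mul, ← Polynomial.C_mul, ← Polynomial.C_1,
    ← Polynomial.C_1, Polynomial.C_inj, Polynomial.C_inj] at hQ2
  rcases mul_self_eq_one_iff.mp hQ2 with rfl | rfl
  · rw [hQ, Polynomial.C_1, Polynomial.C_1, mul_one]
  · -- if `Φ` were antisymmetric, then it would vanish on the diagonal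
    exfalso
    have hdiag : Φ.eval Polynomial.X = 0 := by
      refine Polynomial.funext fun a => ?_
      rw [Polynomial.eval_eval_X, Polynomial.eval_zero]
      have h1 := congrArg (Polynomial.evalEval a a) hQ
      rw [Polynomial.evalEval_swap, Polynomial.evalEval_mul, Polynomial.evalEval_CC] at h1
      have h2 : 2 * Φ.evalEval a a = 0 := by linear_combination h1
      exact (mul_eq_zero.mp h2).resolve_left two_ne_zero
    obtain ⟨R, hR⟩ := Polynomial.dvd_iff_isRoot.mpr hdiag
    have hmul : cuspAlgebra.evalPair (cuspAlgebra.jScale N)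
        (Polynomial.X - Polynomial.C Polynomial.X) *
          cuspAlgebra.evalPair (cuspAlgebra.jScale N) R = 0 := by
      rw [← map_mul, ← hR, evalPair_jScale_eq_zero_iff, hrel]
    rcases mul_eq_zero.mp hmul with h1 | h1
    · rw [evalPair_jScale_eq_zero_iff] at h1
      have h2 := eq_one_of_jFunction_scale N fun z => by
        have := h1 z
        rwa [Polynomial.evalEval_sub, Polynomial.evalEval_X, Polynomial.evalEval_C,
          Polynomial.eval_X, sub_eq_zero] at this
      omega
    · rw [evalPair_jScale_eq_zero_iff, hrel] at h1
      have hR0 : R ≠ 0 := fun h => h0 (by rw [hR, h, mul_zero])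
      have h2 := Polynomial.natDegree_le_of_dvd h1 hR0
      have h3 := congrArg Polynomial.natDegree hR
      rw [Polynomial.natDegree_mul (Polynomial.X_sub_C_ne_zero _) hR0,
        Polynomial.natDegree_X_sub_C] at h3
      omega

theorem IsModularEquation.eq_of_eq_one {Φ : Polynomial (Polynomial ℂ)}
    (hΦ : IsModularEquation N Φ) (hN : N = 1) :
    Φ = Polynomial.X - Polynomial.C Polynomial.X := by
  obtain ⟨hm, hrel⟩ := hΦ
  have hscale : ∀ z : ℍ, scale N z = z := fun z => by
    apply UpperHalfPlane.ext
    simp [scale, hN]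
  refine Polynomial.eq_of_monic_of_associated hm (Polynomial.monic_X_sub_C _)
    (associated_of_dvd_dvd ?_ (Polynomial.dvd_iff_isRoot.mpr ?_))
  · rw [← hrel]
    intro z
    rw [Polynomial.evalEval_sub, Polynomial.evalEval_X, Polynomial.evalEval_C, Polynomial.eval_X,
      hscale, sub_self]
  · refine (map_eq_zero_iff _ cuspAlgebra.aeval_j_injective).mp (cuspAlgebra.ext_apply fun z => ?_)
    rw [cuspAlgebra.aeval_apply, cuspAlgebra.j_apply, Polynomial.eval_eval_X]
    have := (hrel Φ).mpr dvd_rfl z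
    rwa [hscale] at this

end ModularEquation

open RiemannSurface in
theorem proposition4p1 (N : ℕ) [NeZero N] :
    -- `X₀(N)`, with its standard atlas, is a compact Riemann surface
    ∃ _ : RiemannSurface (X₀ N),
      atlas ℂ (X₀ N) = ModularCurve.holomorphicAtlas (CongruenceSubgroup.Gamma0 N) ∧
      CompactSpace (X₀ N) ∧
      -- `f` and `g` are Belyi functions
      IsBelyiFunction (belyiF N) ∧ IsBelyiFunction (belyiG N) ∧
      -- the holomorphic involution `[z] ↦ [-1 / (N z)]` interchanges them
      (∃ w : X₀ N → X₀ N, (∀ z : HStar, w (.mk z) = .mk (frickeStar N z)) ∧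
        MDifferentiable 𝓘(ℂ) 𝓘(ℂ) w ∧ Function.Involutive w ∧
        belyiF N ∘ w = belyiG N ∧ belyiG N ∘ w = belyiF N) ∧
      -- they generate the function field
      ∃ F G : FunctionField (X₀ N), F.Represents (belyiF N) ∧ G.Represents (belyiG N) ∧
        IntermediateField.adjoin ℂ {F, G} = ⊤ ∧
        -- the minimal polynomial of `1728 g` over `ℂ(f)` is the modular equation, with
        -- `X = 1728 f`; it is symmetric (for `N = 1` it is `Y - X`)
        ∃ Φ : Polynomial (Polynomial ℂ), IsModularEquation N Φ ∧
          minpoly (IntermediateField.adjoin ℂ {F}) (1728 * G) =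
            Φ.map (Polynomial.aeval
              (1728 * IntermediateField.AdjoinSimple.gen ℂ F)).toRingHom ∧
          (2 ≤ N → Polynomial.Bivariate.swap Φ = Φ) ∧
          (N = 1 → Φ = Polynomial.X - Polynomial.C Polynomial.X) := by
  let _ : RiemannSurface (X₀ N) := ModularCurve.riemannSurface
  have hFB := ModularCurve.isBelyiFunction_belyiF N
  have hGB := ModularCurve.isBelyiFunction_belyiG N
  obtain ⟨F, hF⟩ := exists_represents hFB.holomorphic ModularCurve.eventually_belyiF_ne_infty
  obtain ⟨G, hG⟩ := exists_represents hGB.holomorphic ModularCurve.eventually_belyiG_ne_infty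
  obtain ⟨Φ, hΦ⟩ := exists_isModularEquation N
  have hx := ModularCurve.pullback_belyiF hF
  have hy := ModularCurve.pullback_belyiG hG
  refine ⟨ModularCurve.riemannSurface, rfl, inferInstance, hFB, hGB,
    ⟨ModularCurve.fricke N, ModularCurve.fricke_mk N, ModularCurve.mdifferentiable_fricke N,
      ModularCurve.involutive_fricke N, ModularCurve.belyiF_comp_fricke N,
      ModularCurve.belyiG_comp_fricke N⟩,
    F, G, hF, hG, ModularCurve.adjoin_eq_top hF hG, Φ, hΦ, ?_, hΦ.swap_eq, hΦ.eq_of_eq_one⟩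
  refine minpoly_eq_map_aeval (ModularCurve.aeval_injective_of_pullback_eq hx)
    (q := Polynomial.C (1728 : ℂ)⁻¹ * Polynomial.X) ?_ hΦ.1 fun P => ?_
  · have h1 : (algebraMap ℂ (FunctionField (X₀ N)) (1728 : ℂ)⁻¹) * 1728 = 1 := by
      rw [← map_ofNat (algebraMap ℂ (FunctionField (X₀ N))) 1728, ← map_mul,
        inv_mul_cancel₀ (by norm_num), map_one]
    have h2 : ((1728 * IntermediateField.AdjoinSimple.gen ℂ F :
        IntermediateField.adjoin ℂ {F}) : FunctionField (X₀ N)) = 1728 * F := rfl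
    rw [map_mul, Polynomial.aeval_C, Polynomial.aeval_X, h2, ← mul_assoc, h1, one_mul]
  · have h2 : ((1728 * IntermediateField.AdjoinSimple.gen ℂ F :
        IntermediateField.adjoin ℂ {F}) : FunctionField (X₀ N)) = 1728 * F := rfl
    rw [h2, ModularCurve.eval₂_eq_zero_iff hx hy, evalPair_jScale_eq_zero_iff, hΦ.2]
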